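/- **Theorem (entropic measure-valued versus strong uniqueness for adiabatic thermoelasticity).** Let $d\ge 1$, $p,q>1$, $0<T<\infty$, $\mathbb T^d=(\mathbb R/2\pi\mathbb Z)^d$ and $Q_T=\mathbb T^d\times[0,T)$. Let $\psi=\psi(F,\theta)\in C^3(\mathbb R^{d\times d}\times[0,\infty))$ be a free energy, and put $$\Sigma=\frac{\partial\psi}{\partial F},\qquad \eta=-\frac{\partial\psi}{\partial\theta},\qquad e=\psi+\theta\eta .$$ Assume: * (G) $\psi_{FF}(F,\theta)$ is positive definite and $\eta_\theta(F,\theta)>0$ for all $F\in\mathbb R^{d\times d}$, $\theta>0$; * (a1) there are constants $c,C>0$ with $c(|F|^p+\theta^q)-C\le e(F,\theta)\le C(|F|^p+\theta^q)+C$ for all $F$ and $\theta\ge0$; * (a2) $|\Sigma(F,\theta)|/(|F|^p+\theta^q)\to0$ as $|F|^p+\theta^q\to\infty$; * (a3) $|\eta(F,\theta)|/(|F|^p+\theta^q)\to0$ as $|F|^p+\theta^q\to\infty$; * (a4) $|v\cdot\Sigma(F,\theta)|/(|F|^p+\theta^q+|v|^2)\to0$ as $|F|^p+\theta^q+|v|^2\to\infty$,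 where $(v\cdot\Sigma)_\alpha=\sum_i v_i\Sigma_{i\alpha}$; * (a5) the limit $$\lim_{s\to\infty}\frac{e(s^{1/p}F,s^{1/q}\theta)+\frac12 s|v|^2}{1+s(|F|^p+\theta^q+|v|^2)}$$ exists and is continuous in $(F,v,\theta)$ on the set of those $(F,v,\theta)$ for which $\theta>0$ and $(|F|^{p-1}F,|v|v,\theta^q)$ is a unit vector. An *entropic measure-valued solution* $(U,\boldsymbol\nu,\boldsymbol\mu)$ of adiabatic thermoelasticity (with radiation $r=0$), with initial data $(\boldsymbol\nu_0,\boldsymbol\mu_0)$, consists of measurable families of probability measures $\boldsymbol\nu=(\boldsymbol\nu_{(x,t)})_{(x,t)\in Q_T}$ and $\boldsymbol\nu_0=(\boldsymbol\nu_{0,x})_{x\in\mathbb T^d}$ on $\mathbb R^{d\times d}\times\mathbb R^d\times[0,\infty)\ni(\lambda_F,\lambda_v,\lambda_\theta)$, nonnegative Radon measures $\boldsymbol\mu$ on $Q_T$ and $\boldsymbol\mu_0$ on $\mathbb T^d$, and $U=(F,v,\theta)=\langle\boldsymbol\nu,(\lambda_F,\lambda_v,\lambda_\theta)\rangle$ a.e.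 with $F\in L^\infty(0,T;L^p)$, $v\in L^\infty(0,T;L^2)$, $\theta\in L^\infty(0,T;L^q)$, such that $\langle\boldsymbol\nu,|\lambda_F|^p+|\lambda_v|^2+\lambda_\theta^q\rangle\in L^1(\mathbb T^d\times(0,T'))$ for every $T'<T$, $\langle\boldsymbol\nu_0,|\lambda_F|^p+|\lambda_v|^2+\lambda_\theta^q\rangle\in L^1(\mathbb T^d)$, and $$\begin{aligned} \partial_t\langle\boldsymbol\nu,\lambda_F\rangle&=\nabla\langle\boldsymbol\nu,\lambda_v\rangle,\\ \partial_t\langle\boldsymbol\nu,\lambda_v\rangle&=\operatorname{div}\langle\boldsymbol\nu,\Sigma(\lambda_F,\lambda_\theta)\rangle,\\ \partial_t\big(\langle\boldsymbol\nu,\tfrac12|\lambda_v|^2+e(\lambda_F,\lambda_\theta)\rangle+\boldsymbol\mu\big)&=\operatorname{div}\langle\boldsymbol\nu,\lambda_v\cdot\Sigma(\lambda_F,\lambda_\theta)\rangle,\\ \partial_t\langle\boldsymbol\nu,\eta(\lambda_F,\lambda_\theta)\rangle&\ge0 \end{aligned}$$ in the sense of distributions on $\mathbb T^d\times[0,T)$,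 that is, tested against $\varphi\in C_c^\infty(\mathbb T^d\times[0,T))$ (with $\varphi\ge0$ in the inequality), with the initial terms given by $\boldsymbol\nu_0$ and, in the energy equation, by $\boldsymbol\nu_0$ and $\boldsymbol\mu_0$. Let $(U,\boldsymbol\nu,\boldsymbol\mu)$ be such a solution. Let $\bar U=(\bar F,\bar v,\bar\theta)\in W^{1,\infty}(\overline{Q_T})$ (taken as its Lipschitz representative on $\mathbb T^d\times[0,T]$) be a strong solution, that is, $$\partial_t\bar F=\nabla\bar v,\quad \partial_t\bar v=\operatorname{div}\Sigma(\bar F,\bar\theta),\quad \partial_t\big(\tfrac12|\bar v|^2+e(\bar F,\bar\theta)\big)=\operatorname{div}\big(\bar v\cdot\Sigma(\bar F,\bar\theta)\big),\quad \partial_t\eta(\bar F,\bar\theta)=0$$ a.e. in $Q_T$, and suppose that for some $M,\delta>0$ $$\bar U(x,t)\in\Gamma_{M,\delta}=\{(F,v,\theta):|F|\le M,\ |v|\le M,\ \delta\le\theta\le M\}\qquad\text{for all }(x,t)\in Q_T.$$ If $\boldsymbol\mu_0=0$ and $\boldsymbol\nu_{0,x}=\delta_{\bar U(x,0)}$ for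 a.e. $x\in\mathbb T^d$, then $\boldsymbol\nu_{(x,t)}=\delta_{\bar U(x,t)}$ and $U(x,t)=\bar U(x,t)$ for a.e. $(x,t)\in Q_T$. -/

import Mathlib

open MeasureTheory ProbabilityTheory Filter Set Topology
open scoped ContDiff ENNReal NNReal

noncomputable section

namespace Thermoelasticity

/-! ### The periodic domain and its calculus -/

instance fact_two_pi_pos : Fact (0 < 2 * Real.pi) := ⟨Real.two_pi_pos⟩

/-- The flat torus `(ℝ / 2πℤ)^d`, with its Lebesgue measure of total mass `(2π)^d`. -/
abbrev Torus (d : ℕ) : Type := Fin d → AddCircle (2 * Real.pi)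

/-- `Q_T = 𝕋^d × [0, T)`. -/
def Q (d : ℕ) (T : ℝ) : Set (Torus d × ℝ) := univ ×ˢ Ico 0 T

/-- `∂_t f`. -/
def dt {d : ℕ} (f : Torus d × ℝ → ℝ) (z : Torus d × ℝ) : ℝ :=
  deriv (fun s : ℝ => f (z.1, s)) z.2

/-- `∂_{x_α} f`. -/
def dx {d : ℕ} (α : Fin d) (f : Torus d × ℝ → ℝ) (z : Torus d × ℝ) : ℝ :=
  deriv (fun s : ℝ => f (z.1 + Pi.single α (s : AddCircle (2 * Real.pi)), z.2)) 0

/-- Test functions `φ ∈ C_c^∞(𝕋^d × [0, T))`: the lift of `φ` to `ℝ^d × ℝ` is smooth and `φ`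
vanishes for times beyond some `T' < T`; the value at time `0` is free. -/
def IsTest {d : ℕ} (T : ℝ) (φ : Torus d × ℝ → ℝ) : Prop :=
  ContDiff ℝ ∞ (fun y : (Fin d → ℝ) × ℝ =>
      φ (fun i => ((y.1 i : ℝ) : AddCircle (2 * Real.pi)), y.2)) ∧
    ∃ T' < T, ∀ (x : Torus d) (t : ℝ), T' ≤ t → φ (x, t) = 0

/-! ### States and constitutive functions -/

/-- `d × d` real matrices as column vectors in `ℝ^{d²}`, with the Euclidean norm. -/
abbrev Mat (d : ℕ) : Type := EuclideanSpace ℝ (Fin d × Fin d)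

/-- `ℝ^d` with the Euclidean norm. -/
abbrev Vec (d : ℕ) : Type := EuclideanSpace ℝ (Fin d)

/-- States `(F, v, θ)`: the components of `u` are `u.1`, `u.2.1`, `u.2.2`. Physical states have
`θ ≥ 0`. -/
abbrev State (d : ℕ) : Type := Mat d × Vec d × ℝ

variable {d : ℕ}

/-- The stress `Σ = ∂ψ/∂F`. -/
def stress (ψ : Mat d → ℝ → ℝ) (F : Mat d) (θ : ℝ) : Mat d :=
  gradient (fun G : Mat d => ψ G θ) F

/-- The entropy `η = -∂ψ/∂θ` on `θ ≥ 0` (one-sided derivative at `θ = 0`). -/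
def entropy (ψ : Mat d → ℝ → ℝ) (F : Mat d) (θ : ℝ) : ℝ :=
  -derivWithin (fun s : ℝ => ψ F s) (Ici 0) θ

/-- The internal energy `e = ψ + θ η`. -/
def internalEnergy (ψ : Mat d → ℝ → ℝ) (F : Mat d) (θ : ℝ) : ℝ :=
  ψ F θ + θ * entropy ψ F θ

/-- The total energy `½|v|² + e(F, θ)`. -/
def totalEnergy (ψ : Mat d → ℝ → ℝ) (u : State d) : ℝ :=
  (1 / 2) * ‖u.2.1‖ ^ 2 + internalEnergy ψ u.1 u.2.2

/-- The power of the stresses `v · Σ(F, θ)`, with components `∑_i v_i Σ_{iα}`. -/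
def power (ψ : Mat d → ℝ → ℝ) (u : State d) : Vec d :=
  WithLp.toLp 2 (fun α => ∑ i, u.2.1 i * stress ψ u.1 u.2.2 (i, α))

/-- `ψ ∈ C³(ℝ^{d×d} × [0, ∞))`, with derivatives continuous up to `θ = 0`. -/
def Regular (ψ : Mat d → ℝ → ℝ) : Prop :=
  ContDiffOn ℝ 3 (fun w : Mat d × ℝ => ψ w.1 w.2) (univ ×ˢ Ici 0)

/-- Gibbs stability: `ψ_FF > 0` (positive definite) and `η_θ > 0` at all `θ > 0`. -/
def Gibbs (ψ : Mat d → ℝ → ℝ) : Prop :=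
  ∀ (F : Mat d) (θ : ℝ), 0 < θ →
    (∀ H : Mat d, H ≠ 0 → 0 < fderiv ℝ (fderiv ℝ (fun G : Mat d => ψ G θ)) F H H) ∧
    0 < deriv (fun s : ℝ => entropy ψ F s) θ

/-- Growth of the internal energy: comparable to `|F|^p + θ^q` up to additive constants. -/
def EnergyGrowth (ψ : Mat d → ℝ → ℝ) (p q : ℝ) : Prop :=
  ∃ c > 0, ∃ C > 0, ∀ (F : Mat d) (θ : ℝ), 0 ≤ θ →
    c * (‖F‖ ^ p + θ ^ q) - C ≤ internalEnergy ψ F θ ∧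
    internalEnergy ψ F θ ≤ C * (‖F‖ ^ p + θ ^ q) + C

/-- The filter `|F|^p + θ^q → ∞` on `ℝ^{d×d} × [0, ∞)`. -/
def atInfty (d : ℕ) (p q : ℝ) : Filter (Mat d × ℝ) :=
  comap (fun w => ‖w.1‖ ^ p + w.2 ^ q) atTop ⊓ 𝓟 {w | 0 ≤ w.2}

/-- The filter `|F|^p + θ^q + |v|² → ∞` on states with `θ ≥ 0`. -/
def atInftyState (d : ℕ) (p q : ℝ) : Filter (State d) :=
  comap (fun u => ‖u.1‖ ^ p + u.2.2 ^ q + ‖u.2.1‖ ^ 2) atTop ⊓ 𝓟 {u | 0 ≤ u.2.2}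

/-- `|Σ(F, θ)| = o(|F|^p + θ^q)`. -/
def StressGrowth (ψ : Mat d → ℝ → ℝ) (p q : ℝ) : Prop :=
  Tendsto (fun w : Mat d × ℝ => ‖stress ψ w.1 w.2‖ / (‖w.1‖ ^ p + w.2 ^ q))
    (atInfty d p q) (𝓝 0)

/-- `|η(F, θ)| = o(|F|^p + θ^q)`. -/
def EntropyGrowth (ψ : Mat d → ℝ → ℝ) (p q : ℝ) : Prop :=
  Tendsto (fun w : Mat d × ℝ => |entropy ψ w.1 w.2| / (‖w.1‖ ^ p + w.2 ^ q))
    (atInfty d p q) (𝓝 0)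

/-- `|v · Σ(F, θ)| = o(|F|^p + θ^q + |v|²)`. -/
def PowerGrowth (ψ : Mat d → ℝ → ℝ) (p q : ℝ) : Prop :=
  Tendsto (fun u : State d => ‖power ψ u‖ / (‖u.1‖ ^ p + u.2.2 ^ q + ‖u.2.1‖ ^ 2))
    (atInftyState d p q) (𝓝 0)

/-- The states for which `(|F|^{p-1} F, |v| v, θ^q)` is a unit vector with `θ > 0`. -/
def recessionSphere (d : ℕ) (p q : ℝ) : Set (State d) :=
  {u | 0 < u.2.2 ∧
    ‖(‖u.1‖ ^ (p - 1)) • u.1‖ ^ 2 + ‖‖u.2.1‖ • u.2.1‖ ^ 2 + (u.2.2 ^ q) ^ 2 = 1}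

/-- The recession function of the total energy exists and is continuous on `recessionSphere`
(`(F, v, θ) ↦ (|F|^{p-1} F, |v| v, θ^q)` is a homeomorphism on `θ ≥ 0`). -/
def HasEnergyRecession (ψ : Mat d → ℝ → ℝ) (p q : ℝ) : Prop :=
  ∃ einf : State d → ℝ, ContinuousOn einf (recessionSphere d p q) ∧
    ∀ u ∈ recessionSphere d p q,
      Tendsto (fun s : ℝ =>
          (internalEnergy ψ (s ^ (1 / p) • u.1) (s ^ (1 / q) * u.2.2)
              + (1 / 2) * s * ‖u.2.1‖ ^ 2) /
            (1 + s * (‖u.1‖ ^ p + u.2.2 ^ q + ‖u.2.1‖ ^ 2)))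
        atTop (𝓝 (einf u))

/-! ### Entropic measure-valued solutions -/

/-- `f ∈ L^∞(0, T; L^r(𝕋^d))` (the measurability of `f` is not part of this bound). -/
def LinftyLr {E : Type*} [NormedAddCommGroup E] (T r : ℝ) (f : Torus d × ℝ → E) : Prop :=
  ∃ C : ℝ≥0, ∀ᵐ t ∂(volume.restrict (Ioo 0 T)),
    eLpNorm (fun x : Torus d => f (x, t)) (ENNReal.ofReal r) volume ≤ C

/-- `|F|^p + |v|² + θ^q` (for `θ ≥ 0`) as an extended nonnegative number. -/
def weight (p q : ℝ) (u : State d) : ℝ≥0∞ :=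
  ENNReal.ofReal (‖u.1‖ ^ p + ‖u.2.1‖ ^ 2 + |u.2.2| ^ q)

/-- Entropic measure-valued solutions `(U, ν, μ)` on `Q_T`, with initial Young measure `ν₀` and
initial concentration measure `μ₀`, of adiabatic thermoelasticity without radiation
```
  ∂_t F = ∇v,   ∂_t v = div Σ,   ∂_t (½|v|² + e) = div (v · Σ),   ∂_t η ≥ 0 .
```
The equations hold in the sense of distributions on `𝕋^d × [0, T)`, initial data included; the
concentration measure enters the energy equation only. Young measures are Markov kernels, i.e.
measurable families of probability measures; only their values at almost every point of `Q_T`,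
respectively `𝕋^d`, matter. -/
structure IsEntropicMVSolution (ψ : Mat d → ℝ → ℝ) (p q T : ℝ)
    (U : Torus d × ℝ → State d)
    (ν : Kernel (Torus d × ℝ) (State d)) [IsMarkovKernel ν] (μ : Measure (Torus d × ℝ))
    (ν₀ : Kernel (Torus d) (State d)) [IsMarkovKernel ν₀] (μ₀ : Measure (Torus d)) : Prop where
  /-- The measures `ν z` and `ν₀ x` live on `ℝ^{d×d} × ℝ^d × [0, ∞)`. -/
  temp_nonneg : ∀ᵐ z ∂(volume.restrict (Q d T)), ∀ᵐ u ∂(ν z), 0 ≤ u.2.2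
  temp_nonneg_init : ∀ᵐ x : Torus d, ∀ᵐ u ∂(ν₀ x), 0 ≤ u.2.2
  /-- `μ` is a Radon measure on `Q_T` and `μ₀` is a Radon measure on `𝕋^d`. -/
  radon : ∀ T' < T, μ (Q d T') < ⊤
  radon_init : μ₀ univ < ⊤
  /-- The averaged energy is locally integrable on `Q_T`, and integrable at time `0`, so that all
  the averages below make sense. -/
  moment : ∀ T' < T, ∫⁻ z in Q d T', ∫⁻ u, weight p q u ∂(ν z) < ⊤
  moment_init : ∫⁻ x : Torus d, ∫⁻ u, weight p q u ∂(ν₀ x) < ⊤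
  /-- `U = (F, v, θ)` is the average of `ν`. -/
  mean : ∀ᵐ z ∂(volume.restrict (Q d T)),
    U z = (∫ u, u.1 ∂(ν z), ∫ u, u.2.1 ∂(ν z), ∫ u, u.2.2 ∂(ν z))
  F_bound : LinftyLr T p (fun z => (U z).1)
  v_bound : LinftyLr T 2 (fun z => (U z).2.1)
  θ_bound : LinftyLr T q (fun z => (U z).2.2)
  /-- `∂_t ⟨ν, λ_F⟩ = ∇ ⟨ν, λ_v⟩`. -/
  eq_F : ∀ φ : Torus d × ℝ → ℝ, IsTest T φ → ∀ i α : Fin d,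
    (∫ z in Q d T, dt φ z * ∫ u, u.1 (i, α) ∂(ν z))
      + (∫ x : Torus d, φ (x, 0) * ∫ u, u.1 (i, α) ∂(ν₀ x))
      = ∫ z in Q d T, dx α φ z * ∫ u, u.2.1 i ∂(ν z)
  /-- `∂_t ⟨ν, λ_v⟩ = div ⟨ν, Σ(λ_F, λ_θ)⟩`. -/
  eq_v : ∀ φ : Torus d × ℝ → ℝ, IsTest T φ → ∀ i : Fin d,
    (∫ z in Q d T, dt φ z * ∫ u, u.2.1 i ∂(ν z))
      + (∫ x : Torus d, φ (x, 0) * ∫ u, u.2.1 i ∂(ν₀ x))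
      = ∫ z in Q d T, ∑ α, dx α φ z * ∫ u, stress ψ u.1 u.2.2 (i, α) ∂(ν z)
  /-- `∂_t (⟨ν, ½|λ_v|² + e(λ_F, λ_θ)⟩ + μ) = div ⟨ν, λ_v · Σ(λ_F, λ_θ)⟩`. -/
  eq_energy : ∀ φ : Torus d × ℝ → ℝ, IsTest T φ →
    (∫ z in Q d T, dt φ z * ∫ u, totalEnergy ψ u ∂(ν z))
      + (∫ z in Q d T, dt φ z ∂μ)
      + (∫ x : Torus d, φ (x, 0) * ∫ u, totalEnergy ψ u ∂(ν₀ x))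
      + (∫ x : Torus d, φ (x, 0) ∂μ₀)
      = ∫ z in Q d T, ∑ α, dx α φ z * ∫ u, power ψ u α ∂(ν z)
  /-- `∂_t ⟨ν, η(λ_F, λ_θ)⟩ ≥ 0`. -/
  ineq_entropy : ∀ φ : Torus d × ℝ → ℝ, IsTest T φ → (∀ z ∈ Q d T, 0 ≤ φ z) →
    (∫ z in Q d T, dt φ z * ∫ u, entropy ψ u.1 u.2.2 ∂(ν z))
      + (∫ x : Torus d, φ (x, 0) * ∫ u, entropy ψ u.1 u.2.2 ∂(ν₀ x)) ≤ 0

/-! ### Strong solutions -/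

/-- The set `Γ_{M,δ}`. -/
def Gam (d : ℕ) (M δ : ℝ) : Set (State d) :=
  {u | ‖u.1‖ ≤ M ∧ ‖u.2.1‖ ≤ M ∧ δ ≤ u.2.2 ∧ u.2.2 ≤ M}

/-- Strong solutions `Ū ∈ W^{1,∞}` of adiabatic thermoelasticity without radiation: `Ū` is the
Lipschitz representative on `𝕋^d × [0, T]`, and the balance laws and the entropy identity hold
almost everywhere (all fields involved are Lipschitz, hence differentiable almost everywhere, when
`Ū` takes values in some `Γ_{M,δ}` and `ψ` is regular). -/
structure IsStrongSolution (ψ : Mat d → ℝ → ℝ) (T : ℝ) (Ub : Torus d × ℝ → State d) :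
    Prop where
  lipschitz : ∃ K : ℝ≥0, LipschitzOnWith K Ub (univ ×ˢ Icc 0 T)
  eq_F : ∀ᵐ z ∂(volume.restrict (Q d T)), ∀ i α : Fin d,
    dt (fun w => (Ub w).1 (i, α)) z = dx α (fun w => (Ub w).2.1 i) z
  eq_v : ∀ᵐ z ∂(volume.restrict (Q d T)), ∀ i : Fin d,
    dt (fun w => (Ub w).2.1 i) z
      = ∑ α, dx α (fun w => stress ψ (Ub w).1 (Ub w).2.2 (i, α)) z
  eq_energy : ∀ᵐ z ∂(volume.restrict (Q d T)),
    dt (fun w => totalEnergy ψ (Ub w)) z = ∑ α, dx α (fun w => power ψ (Ub w) α) z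
  eq_entropy : ∀ᵐ z ∂(volume.restrict (Q d T)),
    dt (fun w => entropy ψ (Ub w).1 (Ub w).2.2) z = 0

end Thermoelasticity

end

/-! The proof is the relative energy method, run directly on the space-time Young measure. For a
state `u = (F, v, θ)` and the strong state `Ū`, set H = e(F, θ) - θ̄ η(F, θ) - ψ̄ - Σ̄ · (F - F̄) +
½|v - v̄|² (`relTotal`). Passing from (F̄, θ̄) to (F, θ) through (F, θ̄), the thermal part splits
into a Taylor remainder of ψ in F, governed by ψ_FF, and a term governed by η_θ
(`Regular.relEnergy_eq`). Gibbs stability therefore makes H nonnegative, and zero only at u = Ū.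

The energy equation is tested with a cut-off φ(t), the entropy inequality with φθ̄, the momentum
equation with φv̄ and the deformation equation with φΣ̄. To these are added two null contributions
built from `Ū` alone: a total time derivative, up to its initial term, and a spatial divergence.
Since φ is nonincreasing, the concentration measure and the entropy production have a favourable
sign. The initial terms cancel because the initial data agree, and so the integral of `balance` is
nonnegative (`IsEntropicMVSolution.integral_balance_nonneg`).

Pointwise, the equations of `Ū`, the conservation of its entropy and the symmetry of the Hessian of
ψ remove everything linear in u - Ū. What is left is φ' H plus φ times the quadratic Taylor
remainders of Σ and η, paired with ∂_t F̄ and -∂_t θ̄ (`relative_energy_identity`). These remainders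
are at most C H (`exists_remainder_le`): by Taylor expansion near `Ū`, by compactness at
intermediate distance, and by comparison of growth at infinity. Choosing φ with φ' ≤ -(K C + 1) φ,
where K is a Lipschitz constant of `Ū`, gives `balance` ≤ -φ H, which takes the place of Gronwall's
inequality. Hence φ H integrates to zero, H vanishes almost everywhere for the Young measure, and
the measure is Dirac.

Because `Ū` is only Lipschitz, θ̄, v̄ and Σ̄ are not smooth test functions; they are reached by
mollification on the covering space (`exists_smooth_approx`, `exists_test_seq`). The argument runs
on slabs [0, S) with S < T, which then exhaust `Q_T`. -/

noncomputable section

namespace Thermoelasticity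

section

/-! ### Two Taylor formulas on the line -/

/-- The constant `A` makes `s ↦ f s - s * g 0 - A * s ^ 2` take equal values at both ends. Rolle's
theorem applies to this function, and then to its derivative, which also vanishes at `0`. -/
theorem exists_taylor_two {f g m : ℝ → ℝ}
    (hf : ∀ s ∈ Icc (0 : ℝ) 1, HasDerivAt f (g s) s)
    (hg : ∀ s ∈ Icc (0 : ℝ) 1, HasDerivAt g (m s) s) :
    ∃ ξ ∈ Ioo (0 : ℝ) 1, f 1 - f 0 - g 0 = m ξ / 2 := by
  set A := f 1 - f 0 - g 0 with hA
  have hk : ∀ s ∈ Icc (0 : ℝ) 1, HasDerivAt (fun s => f s - s * g 0 - A * s ^ 2)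
      (g s - g 0 - A * (2 * s)) s := by
    intro s hs
    have h1 := (hf s hs).sub ((hasDerivAt_id s).mul_const (g 0))
    have h2 := ((hasDerivAt_id s).pow 2).const_mul A
    refine (h1.sub h2).congr_deriv ?_
    simp
  obtain ⟨ξ, hξ, h0⟩ := exists_hasDerivAt_eq_zero (a := (0 : ℝ)) (b := 1) one_pos
    (fun s hs => (hk s hs).continuousAt.continuousWithinAt)
    (by simp only [hA]; ring) (fun s hs => hk s (Ioo_subset_Icc_self hs))
  have hl : ∀ s ∈ Icc (0 : ℝ) 1, HasDerivAt (fun s => g s - g 0 - A * (2 * s))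
      (m s - A * 2) s := by
    intro s hs
    have h1 := ((hg s hs).sub_const (g 0)).sub (((hasDerivAt_id s).const_mul 2).const_mul A)
    refine h1.congr_deriv ?_
    simp
  have hsub : Icc 0 ξ ⊆ Icc (0 : ℝ) 1 := Icc_subset_Icc_right hξ.2.le
  obtain ⟨ζ, hζ, h1⟩ := exists_hasDerivAt_eq_zero (a := (0 : ℝ)) (b := ξ) hξ.1
    (fun s hs => (hl s (hsub hs)).continuousAt.continuousWithinAt)
    (by simp only [h0]; ring) (fun s hs => hl s (hsub (Ioo_subset_Icc_self hs)))
  exact ⟨ζ, ⟨hζ.1, hζ.2.trans hξ.2⟩, by linarith⟩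

/-- Cauchy's mean value theorem against (s - a)²/2, after which the factor ξ - a cancels. Only
continuity is needed at `0`, so the endpoint `b = 0` (zero temperature) is allowed. -/
theorem exists_weighted_taylor {k m : ℝ → ℝ} {a b : ℝ} (ha : 0 < a) (hb : 0 ≤ b)
    (hc : ContinuousOn k (Ici 0)) (hk : ∀ s, 0 < s → HasDerivAt k ((s - a) * m s) s) :
    ∃ ξ, min a b ≤ ξ ∧ ξ ≤ max a b ∧ 0 < ξ ∧ k b - k a = m ξ / 2 * (b - a) ^ 2 := by
  have hq : ∀ s : ℝ, HasDerivAt (fun s => (s - a) ^ 2 / 2) (s - a) s := by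
    intro s
    refine ((((hasDerivAt_id s).sub_const a).pow 2).div_const 2).congr_deriv ?_
    simp
  have hqc : Continuous fun s : ℝ => (s - a) ^ 2 / 2 := by fun_prop
  rcases lt_trichotomy a b with h | rfl | h
  · obtain ⟨ξ, hξ, h1⟩ := exists_ratio_hasDerivAt_eq_ratio_slope k (fun s => (s - a) * m s) h
      (hc.mono fun s hs => ha.le.trans hs.1) (fun s hs => hk s (ha.trans hs.1))
      (fun s => (s - a) ^ 2 / 2) (fun s => s - a) hqc.continuousOn (fun s _ => hq s)
    refine ⟨ξ, by simp [h.le, hξ.1.le], by simp [h.le, hξ.2.le], ha.trans hξ.1, ?_⟩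
    have : ξ - a ≠ 0 := sub_ne_zero.2 hξ.1.ne'
    apply mul_right_cancel₀ this
    linear_combination -h1
  · exact ⟨a, by simp, by simp, ha, by ring⟩
  · obtain ⟨ξ, hξ, h1⟩ := exists_ratio_hasDerivAt_eq_ratio_slope k (fun s => (s - a) * m s) h
      (hc.mono fun s hs => hb.trans hs.1) (fun s hs => hk s (hb.trans_lt hs.1))
      (fun s => (s - a) ^ 2 / 2) (fun s => s - a) hqc.continuousOn (fun s _ => hq s)
    refine ⟨ξ, by simp [h.le, hξ.1.le], by simp [h.le, hξ.2.le], hb.trans_lt hξ.1, ?_⟩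
    have : ξ - a ≠ 0 := sub_ne_zero.2 hξ.2.ne
    apply mul_right_cancel₀ this
    linear_combination h1

/-! ### Differentiability of the constitutive functions up to `θ = 0` -/

variable {d : ℕ} {ψ : Mat d → ℝ → ℝ}

/-- Deformation gradients and temperatures with `θ ≥ 0`. -/
def halfSpace (d : ℕ) : Set (Mat d × ℝ) := univ ×ˢ Ici 0

theorem mem_halfSpace {w : Mat d × ℝ} : w ∈ halfSpace d ↔ 0 ≤ w.2 := by simp [halfSpace]

theorem uniqueDiffOn_halfSpace : UniqueDiffOn ℝ (halfSpace d) :=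
  uniqueDiffOn_univ.prod (uniqueDiffOn_Ici 0)

theorem halfSpace_mem_nhds {w : Mat d × ℝ} (hw : 0 < w.2) : halfSpace d ∈ 𝓝 w :=
  prod_mem_nhds univ_mem (Ici_mem_nhds hw)

/-- The differential of the free energy on `θ ≥ 0`. -/
def dfree (ψ : Mat d → ℝ → ℝ) (w : Mat d × ℝ) : Mat d × ℝ →L[ℝ] ℝ :=
  fderivWithin ℝ (fun w : Mat d × ℝ => ψ w.1 w.2) (halfSpace d) w

theorem Regular.contDiffOn_dfree (h : Regular ψ) : ContDiffOn ℝ 2 (dfree ψ) (halfSpace d) :=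
  ContDiffOn.fderivWithin h uniqueDiffOn_halfSpace (by norm_num)

theorem Regular.hasFDerivWithinAt (h : Regular ψ) {w : Mat d × ℝ} (hw : 0 ≤ w.2) :
    HasFDerivWithinAt (fun w : Mat d × ℝ => ψ w.1 w.2) (dfree ψ w) (halfSpace d) w :=
  ((h.differentiableOn (by norm_num)) w (mem_halfSpace.2 hw)).hasFDerivWithinAt

theorem Regular.hasFDerivAt (h : Regular ψ) {w : Mat d × ℝ} (hw : 0 < w.2) :
    HasFDerivAt (fun w : Mat d × ℝ => ψ w.1 w.2) (dfree ψ w) w :=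
  (h.hasFDerivWithinAt hw.le).hasFDerivAt (halfSpace_mem_nhds hw)

/-- At fixed θ ≥ 0 the slice never leaves the half-space, so the derivative in F is two-sided even
at θ = 0. -/
theorem Regular.hasFDerivAt_left (h : Regular ψ) (F : Mat d) {θ : ℝ} (hθ : 0 ≤ θ) :
    HasFDerivAt (fun G => ψ G θ) ((dfree ψ (F, θ)).comp (.inl ℝ (Mat d) ℝ)) F := by
  have h1 : HasFDerivWithinAt (fun G : Mat d => (G, θ)) (.inl ℝ (Mat d) ℝ) univ F :=
    ((hasFDerivAt_id F).prodMk (hasFDerivAt_const θ F)).hasFDerivWithinAt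
  have h2 := (h.hasFDerivWithinAt (w := (F, θ)) hθ).comp F h1
    (fun G _ => mem_halfSpace.2 hθ)
  exact hasFDerivWithinAt_univ.1 h2

theorem Regular.stress_eq (h : Regular ψ) (F : Mat d) {θ : ℝ} (hθ : 0 ≤ θ) :
    stress ψ F θ = (InnerProductSpace.toDual ℝ (Mat d)).symm
      ((dfree ψ (F, θ)).comp (.inl ℝ (Mat d) ℝ)) := by
  rw [stress, gradient, (h.hasFDerivAt_left F hθ).fderiv]

theorem Regular.entropy_eq (h : Regular ψ) (F : Mat d) {θ : ℝ} (hθ : 0 ≤ θ) :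
    entropy ψ F θ = -dfree ψ (F, θ) (0, 1) := by
  have h1 : HasDerivWithinAt (fun s : ℝ => (F, s)) ((0 : Mat d), (1 : ℝ)) (Ici 0) θ :=
    ((hasDerivAt_const θ F).prodMk (hasDerivAt_id θ)).hasDerivWithinAt
  have h2 := (h.hasFDerivWithinAt (w := (F, θ)) hθ).comp_hasDerivWithinAt θ h1
    (fun s hs => mem_halfSpace.2 hs)
  rw [entropy]
  congr 1
  exact h2.derivWithin (uniqueDiffOn_Ici 0 θ hθ)

theorem Regular.dfree_apply (h : Regular ψ) {w : Mat d × ℝ} (hw : 0 ≤ w.2) (X : Mat d × ℝ) :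
    dfree ψ w X = inner ℝ (stress ψ w.1 w.2) X.1 - entropy ψ w.1 w.2 * X.2 := by
  rw [h.stress_eq w.1 hw, h.entropy_eq w.1 hw, InnerProductSpace.toDual_symm_apply]
  have : X = (X.1, 0) + X.2 • ((0 : Mat d), (1 : ℝ)) := by ext <;> simp
  conv_lhs => rw [this, map_add, map_smul]
  simp [mul_comm]

theorem Regular.contDiffOn_stress (h : Regular ψ) :
    ContDiffOn ℝ 2 (fun w : Mat d × ℝ => stress ψ w.1 w.2) (halfSpace d) := by
  have h1 : ContDiffOn ℝ 2 (fun w => (InnerProductSpace.toDual ℝ (Mat d)).symm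
      ((dfree ψ w).comp (.inl ℝ (Mat d) ℝ))) (halfSpace d) :=
    (InnerProductSpace.toDual ℝ (Mat d)).symm.toContinuousLinearEquiv.contDiff.comp_contDiffOn
      (h.contDiffOn_dfree.clm_comp contDiffOn_const)
  exact h1.congr fun w hw => h.stress_eq w.1 (mem_halfSpace.1 hw)

theorem Regular.contDiffOn_entropy (h : Regular ψ) :
    ContDiffOn ℝ 2 (fun w : Mat d × ℝ => entropy ψ w.1 w.2) (halfSpace d) :=
  ((h.contDiffOn_dfree.clm_apply contDiffOn_const).neg).congr
    fun w hw => h.entropy_eq w.1 (mem_halfSpace.1 hw)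

theorem Regular.continuousOn_energy (h : Regular ψ) :
    ContinuousOn (fun w : Mat d × ℝ => internalEnergy ψ w.1 w.2) (halfSpace d) :=
  h.continuousOn.add (continuousOn_snd.mul h.contDiffOn_entropy.continuousOn)

/-- The differential of the stress, meaningful for `θ > 0`. -/
def dstress (ψ : Mat d → ℝ → ℝ) (w : Mat d × ℝ) : Mat d × ℝ →L[ℝ] Mat d :=
  fderiv ℝ (fun w : Mat d × ℝ => stress ψ w.1 w.2) w

/-- The differential of the entropy, meaningful for `θ > 0`. -/
def dentropy (ψ : Mat d → ℝ → ℝ) (w : Mat d × ℝ) : Mat d × ℝ →L[ℝ] ℝ :=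
  fderiv ℝ (fun w : Mat d × ℝ => entropy ψ w.1 w.2) w

theorem Regular.contDiffAt_stress (h : Regular ψ) {w : Mat d × ℝ} (hw : 0 < w.2) :
    ContDiffAt ℝ 2 (fun w : Mat d × ℝ => stress ψ w.1 w.2) w :=
  h.contDiffOn_stress.contDiffAt (halfSpace_mem_nhds hw)

theorem Regular.contDiffAt_entropy (h : Regular ψ) {w : Mat d × ℝ} (hw : 0 < w.2) :
    ContDiffAt ℝ 2 (fun w : Mat d × ℝ => entropy ψ w.1 w.2) w :=
  h.contDiffOn_entropy.contDiffAt (halfSpace_mem_nhds hw)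

theorem Regular.hasFDerivAt_stress (h : Regular ψ) {w : Mat d × ℝ} (hw : 0 < w.2) :
    HasFDerivAt (fun w : Mat d × ℝ => stress ψ w.1 w.2) (dstress ψ w) w :=
  ((h.contDiffAt_stress hw).differentiableAt (by norm_num)).hasFDerivAt

theorem Regular.hasFDerivAt_entropy (h : Regular ψ) {w : Mat d × ℝ} (hw : 0 < w.2) :
    HasFDerivAt (fun w : Mat d × ℝ => entropy ψ w.1 w.2) (dentropy ψ w) w :=
  ((h.contDiffAt_entropy hw).differentiableAt (by norm_num)).hasFDerivAt

theorem Regular.contDiffAt_dstress (h : Regular ψ) {w : Mat d × ℝ} (hw : 0 < w.2) :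
    ContDiffAt ℝ 1 (dstress ψ) w :=
  (h.contDiffAt_stress hw).fderiv_right (by norm_num)

theorem Regular.contDiffAt_dentropy (h : Regular ψ) {w : Mat d × ℝ} (hw : 0 < w.2) :
    ContDiffAt ℝ 1 (dentropy ψ) w :=
  (h.contDiffAt_entropy hw).fderiv_right (by norm_num)

/-- Symmetry of the Hessian of the free energy. -/
theorem Regular.hessian_symm (h : Regular ψ) {w : Mat d × ℝ} (hw : 0 < w.2) (X Y : Mat d × ℝ) :
    inner ℝ (dstress ψ w X) Y.1 - dentropy ψ w X * Y.2
      = inner ℝ (dstress ψ w Y) X.1 - dentropy ψ w Y * X.2 := by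
  have hev : fderiv ℝ (fun w : Mat d × ℝ => ψ w.1 w.2) =ᶠ[𝓝 w] dfree ψ := by
    filter_upwards [(isOpen_Ioi.preimage continuous_snd).mem_nhds hw] with y hy
    exact (h.hasFDerivAt hy).fderiv
  have hsymm := (ContDiffOn.contDiffAt h (halfSpace_mem_nhds hw)).isSymmSndFDerivAt
    (by simp only [minSmoothness_of_isRCLikeNormedField]; norm_num) X Y
  -- The Hessian in terms of dΣ and dη; its symmetry contains the Maxwell relation Σ_θ = -η_F.
  have key : ∀ X Y : Mat d × ℝ, fderiv ℝ (fderiv ℝ (fun w : Mat d × ℝ => ψ w.1 w.2)) w X Y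
      = inner ℝ (dstress ψ w X) Y.1 - dentropy ψ w X * Y.2 := by
    intro X Y
    rw [hev.fderiv_eq]
    have hD : HasFDerivAt (dfree ψ) (fderiv ℝ (dfree ψ) w) w :=
      ((h.contDiffOn_dfree.contDiffAt (halfSpace_mem_nhds hw)).differentiableAt
        (by norm_num)).hasFDerivAt
    have h1 := hD.clm_apply (hasFDerivAt_const Y w)
    have h2 : HasFDerivAt (fun w => dfree ψ w Y) _ w :=
      ((((h.hasFDerivAt_stress hw).inner ℝ (hasFDerivAt_const Y.1 w))).sub
        ((h.hasFDerivAt_entropy hw).mul_const Y.2)).congr_of_eventuallyEq (by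
          filter_upwards [(isOpen_Ioi.preimage continuous_snd).mem_nhds hw] with y hy
          exact h.dfree_apply (le_of_lt hy) Y)
    have h3 := congrArg (fun L => L X) (h1.unique h2)
    simpa [fderivInnerCLM_apply, mul_comm] using h3
  rw [← key, ← key, hsymm]

theorem Gibbs.stress_pos (h : Regular ψ) (hG : Gibbs ψ) {w : Mat d × ℝ} (hw : 0 < w.2)
    {H : Mat d} (hH : H ≠ 0) : 0 < inner ℝ (dstress ψ w (H, 0)) H := by
  have h0 := (hG w.1 w.2 hw).1 H hH
  have h1 : fderiv ℝ (fun G : Mat d => ψ G w.2) = fun G => innerSL ℝ (stress ψ G w.2) := by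
    ext G X
    rw [(h.hasFDerivAt_left G hw.le).fderiv]
    simp [h.dfree_apply (w := (G, w.2)) hw.le]
  have h2 : HasFDerivAt (fun G : Mat d => (G, w.2)) (.inl ℝ (Mat d) ℝ) w.1 :=
    (hasFDerivAt_id w.1).prodMk (hasFDerivAt_const w.2 w.1)
  have h3 : HasFDerivAt (fun G => stress ψ G w.2) ((dstress ψ w).comp (.inl ℝ (Mat d) ℝ)) w.1 :=
    HasFDerivAt.comp (g := fun w : Mat d × ℝ => stress ψ w.1 w.2) w.1 (h.hasFDerivAt_stress hw) h2
  have h4 := ((innerSL ℝ (E := Mat d)).hasFDerivAt (x := stress ψ w.1 w.2)).comp w.1 h3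
  rw [h1] at h0
  have h5 : fderiv ℝ (fun G => innerSL ℝ (stress ψ G w.2)) w.1 = _ := h4.fderiv
  rw [h5] at h0
  exact h0

theorem Regular.hasDerivAt_entropy (h : Regular ψ) (F : Mat d) {θ : ℝ} (hθ : 0 < θ) :
    HasDerivAt (entropy ψ F) (dentropy ψ (F, θ) (0, 1)) θ :=
  (h.hasFDerivAt_entropy (w := (F, θ)) hθ).comp_hasDerivAt θ
    ((hasDerivAt_const θ F).prodMk (hasDerivAt_id θ))

theorem Gibbs.entropy_pos (h : Regular ψ) (hG : Gibbs ψ) {w : Mat d × ℝ} (hw : 0 < w.2) :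
    0 < dentropy ψ w (0, 1) := by
  rw [← (h.hasDerivAt_entropy w.1 hw).deriv]
  exact (hG w.1 w.2 hw).2

/-! ### The relative energy -/

/-- The thermal part of the relative energy of `w` with respect to `wb`. -/
def relEnergy (ψ : Mat d → ℝ → ℝ) (wb w : Mat d × ℝ) : ℝ :=
  internalEnergy ψ w.1 w.2 - wb.2 * entropy ψ w.1 w.2 - ψ wb.1 wb.2
    - inner ℝ (stress ψ wb.1 wb.2) (w.1 - wb.1)

/-- With k(s) = ψ(F, s) + (s - θ̄) η(F, s), the relative energy is k(θ) - k(θ̄) plus the first-order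
Taylor remainder of ψ(·, θ̄) at F̄. The two copies of η cancel in k', leaving (s - θ̄) η_θ. All
second derivatives are taken at positive temperature, even if θ = 0. -/
theorem Regular.relEnergy_eq (h : Regular ψ) {wb w : Mat d × ℝ} (hb : 0 < wb.2) (hw : 0 ≤ w.2) :
    ∃ ξ, min wb.2 w.2 ≤ ξ ∧ ξ ≤ max wb.2 w.2 ∧ 0 < ξ ∧ ∃ s ∈ Ioo (0 : ℝ) 1,
      relEnergy ψ wb w = dentropy ψ (w.1, ξ) (0, 1) / 2 * (w.2 - wb.2) ^ 2
        + inner ℝ (dstress ψ (wb.1 + s • (w.1 - wb.1), wb.2) (w.1 - wb.1, 0)) (w.1 - wb.1) / 2 := by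
  set k : ℝ → ℝ := fun s => ψ w.1 s + (s - wb.2) * entropy ψ w.1 s with hk
  have hcurve : ContinuousOn (fun s : ℝ => (w.1, s)) (Ici 0) := by fun_prop
  have hmaps : MapsTo (fun s : ℝ => (w.1, s)) (Ici 0) (halfSpace d) :=
    fun s hs => mem_halfSpace.2 hs
  have hkc : ContinuousOn k (Ici 0) := by
    have h1 : ContinuousOn (fun s => ψ w.1 s) (Ici 0) :=
      (ContDiffOn.continuousOn h).comp hcurve hmaps
    have h2 : ContinuousOn (fun s => entropy ψ w.1 s) (Ici 0) :=
      h.contDiffOn_entropy.continuousOn.comp hcurve hmaps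
    exact h1.add ((continuousOn_id.sub continuousOn_const).mul h2)
  have hkd : ∀ s, 0 < s → HasDerivAt k ((s - wb.2) * dentropy ψ (w.1, s) (0, 1)) s := by
    intro s hs
    have h1 : HasDerivAt (fun s => ψ w.1 s) (dfree ψ (w.1, s) (0, 1)) s :=
      (h.hasFDerivAt (w := (w.1, s)) hs).comp_hasDerivAt s
        ((hasDerivAt_const s w.1).prodMk (hasDerivAt_id s))
    have h2 := ((hasDerivAt_id s).sub_const wb.2).mul (h.hasDerivAt_entropy w.1 hs)
    refine (h1.add h2).congr_deriv ?_
    rw [h.dfree_apply (w := (w.1, s)) hs.le]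
    simp
  obtain ⟨ξ, h1, h2, h3, h4⟩ := exists_weighted_taylor hb hw hkc hkd
  have hline : ∀ s : ℝ, HasDerivAt (fun s : ℝ => (wb.1 + s • (w.1 - wb.1), wb.2))
      (w.1 - wb.1, (0 : ℝ)) s := by
    intro s
    refine HasDerivAt.prodMk ?_ (hasDerivAt_const s wb.2)
    simpa using ((hasDerivAt_id s).smul_const (w.1 - wb.1)).const_add wb.1
  obtain ⟨s, hs, h5⟩ := exists_taylor_two
    (f := fun s => ψ (wb.1 + s • (w.1 - wb.1)) wb.2)
    (g := fun s => inner ℝ (stress ψ (wb.1 + s • (w.1 - wb.1)) wb.2) (w.1 - wb.1))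
    (m := fun s => inner ℝ (dstress ψ (wb.1 + s • (w.1 - wb.1), wb.2) (w.1 - wb.1, 0))
      (w.1 - wb.1))
    (fun s _ => by
      have := (h.hasFDerivAt (w := (wb.1 + s • (w.1 - wb.1), wb.2)) hb).comp_hasDerivAt s (hline s)
      refine this.congr_deriv ?_
      rw [h.dfree_apply (w := (wb.1 + s • (w.1 - wb.1), wb.2)) hb.le]
      simp)
    (fun s _ => by
      have := (h.hasFDerivAt_stress (w := (wb.1 + s • (w.1 - wb.1), wb.2)) hb).comp_hasDerivAt s
        (hline s)
      simpa using this.inner ℝ (hasDerivAt_const s (w.1 - wb.1)))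
  refine ⟨ξ, h1, h2, h3, s, hs, ?_⟩
  simp only [zero_smul, add_zero, one_smul, add_sub_cancel] at h5
  rw [← h5, ← h4, relEnergy, internalEnergy, hk]
  ring

theorem relEnergy_nonneg (h : Regular ψ) (hG : Gibbs ψ) {wb w : Mat d × ℝ} (hb : 0 < wb.2)
    (hw : 0 ≤ w.2) : 0 ≤ relEnergy ψ wb w := by
  obtain ⟨ξ, -, -, h3, s, hs, he⟩ := h.relEnergy_eq hb hw
  rw [he]
  have h1 := hG.entropy_pos h (w := (w.1, ξ)) h3
  have h2 : 0 ≤ inner ℝ (dstress ψ (wb.1 + s • (w.1 - wb.1), wb.2) (w.1 - wb.1, 0))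
      (w.1 - wb.1) := by
    rcases eq_or_ne (w.1 - wb.1) 0 with h0 | h0
    · simp [h0]
    · exact (hG.stress_pos h (w := (wb.1 + s • (w.1 - wb.1), wb.2)) hb h0).le
  positivity

theorem relEnergy_pos (h : Regular ψ) (hG : Gibbs ψ) {wb w : Mat d × ℝ} (hb : 0 < wb.2)
    (hw : 0 ≤ w.2) (hne : w ≠ wb) : 0 < relEnergy ψ wb w := by
  obtain ⟨ξ, -, -, h3, s, hs, he⟩ := h.relEnergy_eq hb hw
  rw [he]
  have h1 := hG.entropy_pos h (w := (w.1, ξ)) h3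
  rcases eq_or_ne (w.1 - wb.1) 0 with h0 | h0
  · have h2 : w.2 - wb.2 ≠ 0 := fun h4 =>
      hne (Prod.ext (sub_eq_zero.1 h0) (sub_eq_zero.1 h4))
    simp only [h0, inner_zero_right, zero_div, add_zero]
    positivity
  · have h2 := hG.stress_pos h (w := (wb.1 + s • (w.1 - wb.1), wb.2)) hb h0
    positivity

end

section

variable {d : ℕ} {ψ : Mat d → ℝ → ℝ}

/-! ### Growth -/

theorem self_le_one_add_rpow {x r : ℝ} (hx : 0 ≤ x) (hr : 1 ≤ r) : x ≤ 1 + x ^ r := by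
  rcases le_total x 1 with h | h
  · have := Real.rpow_nonneg hx r
    linarith
  · have := Real.rpow_le_rpow_of_exponent_le h hr
    rw [Real.rpow_one] at this
    linarith

theorem exists_le_rpow_add {r ε : ℝ} (hr : 1 < r) (hε : 0 < ε) :
    ∃ C, 0 ≤ C ∧ ∀ x : ℝ, 0 ≤ x → x ≤ ε * x ^ r + C := by
  obtain ⟨K, hK⟩ := eventually_atTop.1
    ((tendsto_rpow_atTop (sub_pos.2 hr)).eventually_ge_atTop (1 / ε))
  refine ⟨max K 1, by positivity, fun x hx => ?_⟩
  have h0 : 0 ≤ ε * x ^ r := mul_nonneg hε.le (Real.rpow_nonneg hx r)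
  rcases le_total x (max K 1) with h | h
  · linarith
  · have hx1 : 0 < x := one_pos.trans_le ((le_max_right K 1).trans h)
    have h1 := hK x ((le_max_left K 1).trans h)
    rw [Real.rpow_sub_one hx1.ne', div_le_div_iff₀ hε hx1] at h1
    have : (0 : ℝ) ≤ max K 1 := by positivity
    linarith

/-- The weight `|F|^p + θ^q`. -/
def elasticWeight (p q : ℝ) (w : Mat d × ℝ) : ℝ := ‖w.1‖ ^ p + w.2 ^ q

theorem elasticWeight_nonneg {p q : ℝ} {w : Mat d × ℝ} (hw : 0 ≤ w.2) :
    0 ≤ elasticWeight p q w :=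
  add_nonneg (Real.rpow_nonneg (norm_nonneg _) _) (Real.rpow_nonneg hw _)

/-- A box of states. -/
def box (d : ℕ) (R a : ℝ) : Set (Mat d × ℝ) := Metric.closedBall 0 R ×ˢ Icc a R

theorem mem_box {R a : ℝ} {w : Mat d × ℝ} : w ∈ box d R a ↔ ‖w.1‖ ≤ R ∧ a ≤ w.2 ∧ w.2 ≤ R := by
  simp [box]

theorem isCompact_box (R a : ℝ) : IsCompact (box d R a) :=
  (isCompact_closedBall 0 R).prod isCompact_Icc

theorem convex_box (R a : ℝ) : Convex ℝ (box d R a) :=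
  (convex_closedBall 0 R).prod (convex_Icc a R)

theorem mem_box_of_elasticWeight_le {p q R : ℝ} (hp : 1 < p) (hq : 1 < q) (hR : 1 ≤ R)
    {w : Mat d × ℝ} (hw : 0 ≤ w.2) (h : elasticWeight p q w ≤ R) : w ∈ box d R 0 := by
  have key : ∀ {x r : ℝ}, 1 < r → 0 ≤ x → x ^ r ≤ R → x ≤ R := by
    intro x r hr hx hxr
    rcases le_total x 1 with h1 | h1
    · exact h1.trans hR
    · have := Real.rpow_le_rpow_of_exponent_le h1 hr.le
      rw [Real.rpow_one] at this
      exact this.trans hxr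
  have h1 := Real.rpow_nonneg (norm_nonneg w.1) p
  have h2 := Real.rpow_nonneg hw q
  rw [elasticWeight] at h
  exact mem_box.2 ⟨key hp (norm_nonneg _) (by linarith), hw, key hq hw (by linarith)⟩

theorem box_subset_halfSpace {R a : ℝ} (ha : 0 ≤ a) : box d R a ⊆ halfSpace d :=
  fun _ hw => mem_halfSpace.2 (ha.trans (mem_box.1 hw).2.1)

/-- The limit handles large weights; small weights confine `w` to a compact box, on which `g` is
bounded. -/
theorem exists_norm_le_weight_add {E : Type*} [NormedAddCommGroup E] {p q : ℝ} (hp : 1 < p)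
    (hq : 1 < q) {g : Mat d × ℝ → E} (hg : ContinuousOn g (halfSpace d))
    (hlim : Tendsto (fun w => ‖g w‖ / elasticWeight p q w) (atInfty d p q) (𝓝 0))
    {ε : ℝ} (hε : 0 < ε) :
    ∃ C, 0 ≤ C ∧ ∀ w : Mat d × ℝ, 0 ≤ w.2 → ‖g w‖ ≤ ε * elasticWeight p q w + C := by
  have h1 := hlim.eventually_lt_const hε
  rw [atInfty, eventually_inf_principal, eventually_comap] at h1
  obtain ⟨R, hR⟩ := eventually_atTop.1 h1
  obtain ⟨C, hC⟩ := (isCompact_box (d := d) (max R 1) 0).exists_bound_of_continuousOn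
    (hg.mono (box_subset_halfSpace le_rfl))
  refine ⟨max C 0, le_max_right _ _, fun w hw => ?_⟩
  have hW := elasticWeight_nonneg (p := p) (q := q) hw
  rcases le_total (elasticWeight p q w) (max R 1) with h | h
  · have h2 := hC w (mem_box_of_elasticWeight_le hp hq (le_max_right _ _) hw h)
    have := le_max_left C 0
    nlinarith [mul_nonneg hε.le hW]
  · have h2 : ‖g w‖ / elasticWeight p q w < ε :=
      hR _ ((le_max_left _ _).trans h) w rfl hw
    have h3 : 0 < elasticWeight p q w := one_pos.trans_le ((le_max_right _ _).trans h)
    rw [div_lt_iff₀ h3] at h2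
    have := le_max_right C 0
    linarith

theorem exists_snd_fst_le {p q ε : ℝ} (hp : 1 < p) (hq : 1 < q) (hε : 0 < ε) :
    ∃ C, 0 ≤ C ∧ ∀ w : Mat d × ℝ, 0 ≤ w.2 →
      ‖w‖ ≤ ε * elasticWeight p q w + C := by
  obtain ⟨C1, h1, hC1⟩ := exists_le_rpow_add hp hε
  obtain ⟨C2, h2, hC2⟩ := exists_le_rpow_add hq hε
  refine ⟨C1 + C2, by positivity, fun w hw => ?_⟩
  have h3 := hC1 ‖w.1‖ (norm_nonneg _)
  have h4 := hC2 w.2 hw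
  have h5 := mul_nonneg hε.le (Real.rpow_nonneg (norm_nonneg w.1) p)
  have h6 := mul_nonneg hε.le (Real.rpow_nonneg hw q)
  rw [elasticWeight, Prod.norm_def, Real.norm_of_nonneg hw]
  refine max_le ?_ ?_ <;> nlinarith

/-! ### Domination of the relative stress and entropy by the relative energy -/

/-- The sum of the sizes of the quadratic remainders of stress and entropy. -/
def relRemainder (ψ : Mat d → ℝ → ℝ) (wb w : Mat d × ℝ) : ℝ :=
  ‖stress ψ w.1 w.2 - stress ψ wb.1 wb.2 - dstress ψ wb (w - wb)‖
    + |entropy ψ w.1 w.2 - entropy ψ wb.1 wb.2 - dentropy ψ wb (w - wb)|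

theorem exists_lipschitzOnWith_of_contDiffAt {E F : Type*} [NormedAddCommGroup E]
    [NormedSpace ℝ E] [NormedAddCommGroup F] [NormedSpace ℝ F] {f : E → F} {s : Set E}
    (hs : IsCompact s) (hf : ∀ x ∈ s, ContDiffAt ℝ 1 f x) : ∃ K, LipschitzOnWith K f s := by
  refine LocallyLipschitzOn.exists_lipschitzOnWith_of_compact hs fun x hx => ?_
  obtain ⟨K, t, ht, hK⟩ := (hf x hx).exists_lipschitzOnWith
  exact ⟨K, t, mem_nhdsWithin_of_mem_nhds ht, hK⟩

/-- The mean value inequality on the part of `s` within distance `‖y - x‖` of `x`, where `f'`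
differs from `f' x` by at most `K * ‖y - x‖`. -/
theorem norm_taylor_le_of_lipschitzOnWith {E F : Type*} [NormedAddCommGroup E]
    [NormedSpace ℝ E] [NormedAddCommGroup F] [NormedSpace ℝ F] {f : E → F} {f' : E → E →L[ℝ] F}
    {s : Set E} (hs : Convex ℝ s) {K : ℝ≥0} (hK : LipschitzOnWith K f' s)
    (hf : ∀ x ∈ s, HasFDerivAt f (f' x) x) {x y : E} (hx : x ∈ s) (hy : y ∈ s) :
    ‖f y - f x - f' x (y - x)‖ ≤ K * ‖y - x‖ ^ 2 := by
  have h1 := Convex.norm_image_sub_le_of_norm_hasFDerivWithin_le'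
    (s := s ∩ Metric.closedBall x ‖y - x‖) (f := f) (f' := f') (φ := f' x) (C := K * ‖y - x‖)
    (x := x) (y := y) (fun z hz => (hf z hz.1).hasFDerivWithinAt) (fun z hz => ?_)
    (hs.inter (convex_closedBall _ _)) ⟨hx, by simp⟩ ⟨hy, by simp [dist_eq_norm]⟩
  · calc _ ≤ _ := h1
      _ = _ := by ring
  · refine (hK.norm_sub_le hz.1 hx).trans ?_
    have h2 := hz.2
    rw [Metric.mem_closedBall, dist_eq_norm] at h2
    gcongr

/-- On a compact convex box at positive temperature both sides are compared with ‖w - wb‖²: the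
remainders from above, since dΣ and dη are Lipschitz there, and the relative energy from below,
since ψ_FF and η_θ are uniformly positive there. -/
theorem exists_remainder_le_near (h : Regular ψ) (hG : Gibbs ψ) {R a : ℝ} (ha : 0 < a) :
    ∃ C, 0 ≤ C ∧ ∀ wb ∈ box d R a, ∀ w ∈ box d R a,
      relRemainder ψ wb w ≤ C * relEnergy ψ wb w := by
  have hpos : ∀ w ∈ box d R a, 0 < w.2 := fun w hw => ha.trans_le (mem_box.1 hw).2.1
  have hcs : ContinuousOn (dstress ψ) (box d R a) := fun w hw =>
    (h.contDiffAt_dstress (hpos w hw)).continuousAt.continuousWithinAt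
  have hce : ContinuousOn (dentropy ψ) (box d R a) := fun w hw =>
    (h.contDiffAt_dentropy (hpos w hw)).continuousAt.continuousWithinAt
  obtain ⟨c1, hc1, h1⟩ := (isCompact_box R a).exists_forall_le'
    (f := fun w => dentropy ψ w (0, 1)) (hce.clm_apply continuousOn_const)
    (fun w hw => hG.entropy_pos h (hpos w hw))
  obtain ⟨c2, hc2, h2⟩ := ((isCompact_box R a).prod (isCompact_sphere (0 : Mat d) 1)).exists_forall_le'
    (f := fun x : (Mat d × ℝ) × Mat d => inner ℝ (dstress ψ x.1 (x.2, 0)) x.2) (a := 0)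
    (by
      refine ContinuousOn.inner (𝕜 := ℝ) ?_ continuousOn_snd
      refine ContinuousOn.clm_apply ?_ (by fun_prop)
      exact hcs.comp continuousOn_fst fun x hx => hx.1)
    (fun x hx => hG.stress_pos h (hpos _ hx.1) (by
      have := hx.2
      rintro h0
      simp [h0] at this))
  -- The minimum over the unit sphere extends to all directions by homogeneity.
  have h2' : ∀ w ∈ box d R a, ∀ H : Mat d, c2 * ‖H‖ ^ 2 ≤ inner ℝ (dstress ψ w (H, 0)) H := by
    intro w hw H
    rcases eq_or_ne H 0 with rfl | hH
    · simp
    · have hn : ‖H‖ ≠ 0 := norm_ne_zero_iff.2 hH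
      have h3 := h2 (w, ‖H‖⁻¹ • H) ⟨hw, by simp [norm_smul, hn]⟩
      have h4 : dstress ψ w (‖H‖⁻¹ • H, 0) = ‖H‖⁻¹ • dstress ψ w (H, 0) := by
        rw [← map_smul]; simp
      simp only [h4, real_inner_smul_left, real_inner_smul_right] at h3
      have h5 : 0 < ‖H‖ := norm_pos_iff.2 hH
      calc c2 * ‖H‖ ^ 2 ≤ (‖H‖⁻¹ * (‖H‖⁻¹ * inner ℝ (dstress ψ w (H, 0)) H)) * ‖H‖ ^ 2 := by
            gcongr
        _ = _ := by field_simp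
  obtain ⟨L1, hL1⟩ := exists_lipschitzOnWith_of_contDiffAt (isCompact_box R a)
    (fun w hw => h.contDiffAt_dstress (hpos w hw))
  obtain ⟨L2, hL2⟩ := exists_lipschitzOnWith_of_contDiffAt (isCompact_box R a)
    (fun w hw => h.contDiffAt_dentropy (hpos w hw))
  set c := min c1 c2 with hc
  have hc0 : 0 < c := lt_min hc1 hc2
  refine ⟨(L1 + L2) * 2 / c, by positivity, fun wb hb w hw => ?_⟩
  have hR1 := norm_taylor_le_of_lipschitzOnWith (convex_box R a) hL1
    (fun x hx => h.hasFDerivAt_stress (hpos x hx)) hb hw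
  have hR2 := norm_taylor_le_of_lipschitzOnWith (convex_box R a) hL2
    (fun x hx => h.hasFDerivAt_entropy (hpos x hx)) hb hw
  have hE : c / 2 * ‖w - wb‖ ^ 2 ≤ relEnergy ψ wb w := by
    obtain ⟨ξ, h3, h4, -, s, hs, he⟩ := h.relEnergy_eq (hpos wb hb) (hpos w hw).le
    obtain ⟨hb1, hb2, hb3⟩ := mem_box.1 hb
    obtain ⟨hw1, hw2, hw3⟩ := mem_box.1 hw
    have h5 := h1 (w.1, ξ) (mem_box.2 ⟨hw1, (le_min hb2 hw2).trans h3, h4.trans (max_le hb3 hw3)⟩)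
    have h6 := h2' (wb.1 + s • (w.1 - wb.1), wb.2) (mem_box.2 ⟨by
      have := (convex_closedBall (0 : Mat d) R).add_smul_sub_mem (x := wb.1) (y := w.1)
        (by simpa using hb1) (by simpa using hw1) (Ioo_subset_Icc_self hs)
      simpa using this, hb2, hb3⟩) (w.1 - wb.1)
    have h7 : ‖w - wb‖ ^ 2 ≤ ‖w.1 - wb.1‖ ^ 2 + (w.2 - wb.2) ^ 2 := by
      rw [Prod.norm_def]
      rcases max_choice ‖(w - wb).1‖ ‖(w - wb).2‖ with h8 | h8 <;> rw [h8]
      · simp; positivity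
      · simp
    rw [he]
    have hcc1 : c ≤ c1 := min_le_left _ _
    have hcc2 : c ≤ c2 := min_le_right _ _
    have h8 : c * (w.2 - wb.2) ^ 2 ≤ dentropy ψ (w.1, ξ) (0, 1) * (w.2 - wb.2) ^ 2 := by
      gcongr; exact hcc1.trans h5
    have h9 : c * ‖w.1 - wb.1‖ ^ 2 ≤ c2 * ‖w.1 - wb.1‖ ^ 2 := by gcongr
    have h10 : c * ‖w - wb‖ ^ 2 ≤ c * (‖w.1 - wb.1‖ ^ 2 + (w.2 - wb.2) ^ 2) := by gcongr
    linarith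
  calc relRemainder ψ wb w ≤ L1 * ‖w - wb‖ ^ 2 + L2 * ‖w - wb‖ ^ 2 := add_le_add hR1 hR2
    _ = (L1 + L2) * 2 / c * (c / 2 * ‖w - wb‖ ^ 2) := by field_simp
    _ ≤ _ := by gcongr

/-- The internal energy dominates the weight, while θ̄ η is of lower order by the entropy growth and
Σ̄ · F is of lower order because p > 1. -/
theorem exists_energy_growth (h : Regular ψ) {p q : ℝ} (hp : 1 < p) (hq : 1 < q)
    (ha1 : EnergyGrowth ψ p q) (ha3 : EntropyGrowth ψ p q) {M δ : ℝ} (hδ : 0 < δ) :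
    ∃ c, 0 < c ∧ ∃ C, 0 ≤ C ∧ ∀ wb ∈ box d M δ, ∀ w : Mat d × ℝ, 0 ≤ w.2 →
      c * elasticWeight p q w - C ≤ relEnergy ψ wb w := by
  obtain ⟨c, hc, C, hC, he⟩ := ha1
  have hsub := box_subset_halfSpace (d := d) (R := M) hδ.le
  obtain ⟨S, hS⟩ := (isCompact_box (d := d) M δ).exists_bound_of_continuousOn
    (h.contDiffOn_stress.continuousOn.mono hsub)
  obtain ⟨B, hB⟩ := (isCompact_box (d := d) M δ).exists_bound_of_continuousOn
    ((ContDiffOn.continuousOn h).mono hsub)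
  set M' := |M| + 1
  set S' := |S| + 1
  have hM' : 0 < M' := by positivity
  have hS' : 0 < S' := by positivity
  -- The entropy term and the stress term may each absorb a quarter of `c`, after division by the
  -- bounds `M'` and `S'` of their coefficients; half of `c` remains.
  obtain ⟨C1, hC1, h1⟩ := exists_norm_le_weight_add hp hq h.contDiffOn_entropy.continuousOn ha3
    (ε := c / 4 / M') (by positivity)
  obtain ⟨C2, hC2, h2⟩ := exists_snd_fst_le (d := d) hp hq (ε := c / 4 / S') (by positivity)
  refine ⟨c / 2, by positivity, C + M' * C1 + S' * C2 + S' * M' + |B|, by positivity,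
    fun wb hb w hw => ?_⟩
  obtain ⟨hb1, hb2, hb3⟩ := mem_box.1 hb
  have e1 := (he w.1 w.2 hw).1
  have e2 : wb.2 * entropy ψ w.1 w.2 ≤ M' * (c / 4 / M' * elasticWeight p q w + C1) := by
    have : wb.2 ≤ M' := by have := le_abs_self M; simp only [M']; linarith
    calc _ ≤ wb.2 * ‖entropy ψ w.1 w.2‖ := by
          gcongr
          · exact hδ.le.trans hb2
          · exact Real.le_norm_self _
      _ ≤ M' * ‖entropy ψ w.1 w.2‖ := by gcongr
      _ ≤ _ := by gcongr; exact h1 w hw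
  have e3 : ψ wb.1 wb.2 ≤ |B| := (Real.le_norm_self _).trans ((hB wb hb).trans (le_abs_self B))
  have e4 : inner ℝ (stress ψ wb.1 wb.2) (w.1 - wb.1)
      ≤ S' * (c / 4 / S' * elasticWeight p q w + C2) + S' * M' := by
    have h3 : ‖stress ψ wb.1 wb.2‖ ≤ S' :=
      (hS wb hb).trans (by have := le_abs_self S; simp only [S']; linarith)
    have h4 : ‖wb.1‖ ≤ M' := hb1.trans (by have := le_abs_self M; simp only [M']; linarith)
    calc _ ≤ ‖stress ψ wb.1 wb.2‖ * ‖w.1 - wb.1‖ := real_inner_le_norm _ _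
      _ ≤ S' * (‖w.1‖ + ‖wb.1‖) := by gcongr; exact norm_sub_le _ _
      _ ≤ S' * ((c / 4 / S' * elasticWeight p q w + C2) + M') := by
          gcongr
          exact (norm_fst_le w).trans (h2 w hw)
      _ = _ := by ring
  have e5 : M' * (c / 4 / M' * elasticWeight p q w + C1)
      = c / 4 * elasticWeight p q w + M' * C1 := by field_simp
  have e6 : S' * (c / 4 / S' * elasticWeight p q w + C2)
      = c / 4 * elasticWeight p q w + S' * C2 := by field_simp
  have e7 : elasticWeight p q w = ‖w.1‖ ^ p + w.2 ^ q := rfl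
  rw [relEnergy]
  rw [← e7] at e1
  linarith

theorem exists_remainder_growth (h : Regular ψ) {p q : ℝ} (hp : 1 < p) (hq : 1 < q)
    (ha2 : StressGrowth ψ p q) (ha3 : EntropyGrowth ψ p q) {M δ : ℝ} (hδ : 0 < δ) :
    ∃ C, 0 ≤ C ∧ ∀ wb ∈ box d M δ, ∀ w : Mat d × ℝ, 0 ≤ w.2 →
      relRemainder ψ wb w ≤ C * (elasticWeight p q w + 1) := by
  have hsub := box_subset_halfSpace (d := d) (R := M) hδ.le
  have hpos : ∀ w ∈ box d M δ, 0 < w.2 := fun w hw => hδ.trans_le (mem_box.1 hw).2.1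
  have hK := isCompact_box (d := d) M δ
  obtain ⟨S, hS⟩ := hK.exists_bound_of_continuousOn (h.contDiffOn_stress.continuousOn.mono hsub)
  obtain ⟨B, hB⟩ := hK.exists_bound_of_continuousOn (h.contDiffOn_entropy.continuousOn.mono hsub)
  obtain ⟨S', hS'⟩ := hK.exists_bound_of_continuousOn (f := dstress ψ) fun w hw =>
    (h.contDiffAt_dstress (hpos w hw)).continuousAt.continuousWithinAt
  obtain ⟨B', hB'⟩ := hK.exists_bound_of_continuousOn (f := dentropy ψ) fun w hw =>
    (h.contDiffAt_dentropy (hpos w hw)).continuousAt.continuousWithinAt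
  obtain ⟨N, hN⟩ := hK.exists_bound_of_continuousOn (f := fun w : Mat d × ℝ => w) continuousOn_id
  obtain ⟨C1, hC1, h1⟩ := exists_norm_le_weight_add hp hq h.contDiffOn_stress.continuousOn ha2
    one_pos
  obtain ⟨C2, hC2, h2⟩ := exists_norm_le_weight_add hp hq h.contDiffOn_entropy.continuousOn ha3
    one_pos
  obtain ⟨C3, hC3, h3⟩ := exists_snd_fst_le (d := d) hp hq one_pos
  refine ⟨2 + |S'| + |B'| + (C1 + C2 + |S| + |B| + (|S'| + |B'|) * (C3 + |N|)), by positivity,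
    fun wb hb w hw => ?_⟩
  have hW := elasticWeight_nonneg (p := p) (q := q) hw
  set W := elasticWeight p q w
  have hd : ‖w - wb‖ ≤ W + C3 + |N| := by
    have := h3 w hw
    have h4 := norm_sub_le w wb
    have h5 := (hN wb hb).trans (le_abs_self N)
    linarith
  have e1 : ‖stress ψ w.1 w.2 - stress ψ wb.1 wb.2 - dstress ψ wb (w - wb)‖
      ≤ W + C1 + |S| + |S'| * (W + C3 + |N|) := by
    have t1 := h1 w hw
    have t2 := (hS wb hb).trans (le_abs_self S)
    have t3 : ‖dstress ψ wb (w - wb)‖ ≤ |S'| * (W + C3 + |N|) :=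
      ((dstress ψ wb).le_opNorm _).trans (by
        gcongr
        exact (hS' wb hb).trans (le_abs_self S'))
    have t4 := norm_sub_le (stress ψ w.1 w.2 - stress ψ wb.1 wb.2) (dstress ψ wb (w - wb))
    have t5 := norm_sub_le (stress ψ w.1 w.2) (stress ψ wb.1 wb.2)
    linarith
  have e2 : |entropy ψ w.1 w.2 - entropy ψ wb.1 wb.2 - dentropy ψ wb (w - wb)|
      ≤ W + C2 + |B| + |B'| * (W + C3 + |N|) := by
    have t1 := h2 w hw
    have t2 := (hB wb hb).trans (le_abs_self B)
    have t3 : ‖dentropy ψ wb (w - wb)‖ ≤ |B'| * (W + C3 + |N|) :=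
      ((dentropy ψ wb).le_opNorm _).trans (by
        gcongr
        exact (hB' wb hb).trans (le_abs_self B'))
    have t4 := norm_sub_le (entropy ψ w.1 w.2 - entropy ψ wb.1 wb.2) (dentropy ψ wb (w - wb))
    have t5 := norm_sub_le (entropy ψ w.1 w.2) (entropy ψ wb.1 wb.2)
    rw [← Real.norm_eq_abs]
    linarith
  have e3 : 0 ≤ C1 + C2 + |S| + |B| + (|S'| + |B'|) * (C3 + |N|) := by positivity
  rw [relRemainder]
  nlinarith [mul_nonneg e3 hW, abs_nonneg S', abs_nonneg B']

/-- Three regimes of `w` relative to `wb`: close, where the quadratic comparison applies; large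
weight, where the remainder is at most linear and the relative energy at least linear in the weight;
and the compact set in between, where the relative energy has a positive minimum. -/
theorem exists_remainder_le (h : Regular ψ) (hG : Gibbs ψ) {p q : ℝ} (hp : 1 < p) (hq : 1 < q)
    (ha1 : EnergyGrowth ψ p q) (ha2 : StressGrowth ψ p q) (ha3 : EntropyGrowth ψ p q)
    {M δ : ℝ} (hδ : 0 < δ) :
    ∃ C, 0 ≤ C ∧ ∀ wb ∈ box d M δ, ∀ w : Mat d × ℝ, 0 ≤ w.2 →
      relRemainder ψ wb w ≤ C * relEnergy ψ wb w := by
  obtain ⟨A, hA, near⟩ := exists_remainder_le_near h hG (R := M + 1) (half_pos hδ)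
  obtain ⟨c, hc, C1, hC1, far⟩ := exists_energy_growth h hp hq ha1 ha3 (M := M) hδ
  obtain ⟨C2, hC2, rem⟩ := exists_remainder_growth h hp hq ha2 ha3 (M := M) hδ
  -- Beyond `R`, the constant `C1` is at most half of `c` times the weight, and the weight is at
  -- least `1`.
  set R := max 1 ((2 * C1 + 1) / c) with hR
  -- Within `r` of `box d M δ` the norm bounds grow by at most `1` and the temperature stays above
  -- `δ / 2`.
  set r := min 1 (δ / 2) with hr
  have hr0 : 0 < r := lt_min one_pos (half_pos hδ)
  set Z : Set ((Mat d × ℝ) × (Mat d × ℝ)) :=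
    (box d M δ ×ˢ box d R 0) ∩ {x | r ≤ ‖x.2 - x.1‖} with hZ
  have hZc : IsCompact Z := ((isCompact_box M δ).prod (isCompact_box R 0)).inter_right
    (isClosed_le continuous_const (by fun_prop))
  -- This compact set reaches θ = 0, where the relative energy is still continuous and strictly
  -- positive.
  obtain ⟨e, he, mid⟩ := hZc.exists_forall_le' (a := 0) (f := fun x => relEnergy ψ x.1 x.2) (by
      have m1 : MapsTo Prod.fst Z (halfSpace d) :=
        fun x hx => box_subset_halfSpace hδ.le hx.1.1
      have m2 : MapsTo Prod.snd Z (halfSpace d) :=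
        fun x hx => box_subset_halfSpace le_rfl hx.1.2
      have k1 : ContinuousOn (fun x : (Mat d × ℝ) × (Mat d × ℝ) =>
          internalEnergy ψ x.2.1 x.2.2) Z := h.continuousOn_energy.comp continuousOn_snd m2
      have k2 : ContinuousOn (fun x : (Mat d × ℝ) × (Mat d × ℝ) => entropy ψ x.2.1 x.2.2) Z :=
        h.contDiffOn_entropy.continuousOn.comp continuousOn_snd m2
      have k3 : ContinuousOn (fun x : (Mat d × ℝ) × (Mat d × ℝ) => ψ x.1.1 x.1.2) Z :=
        (ContDiffOn.continuousOn h).comp continuousOn_fst m1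
      have k4 : ContinuousOn (fun x : (Mat d × ℝ) × (Mat d × ℝ) => stress ψ x.1.1 x.1.2) Z :=
        h.contDiffOn_stress.continuousOn.comp continuousOn_fst m1
      exact ((k1.sub (ContinuousOn.mul (by fun_prop) k2)).sub k3).sub
        (k4.inner (𝕜 := ℝ) ((continuousOn_snd.fst).sub (continuousOn_fst.fst))))
    (fun x hx => relEnergy_pos h hG (hδ.trans_le (mem_box.1 hx.1.1).2.1) (mem_box.1 hx.1.2).2.1
      (by
        rintro h0
        have h1 : r ≤ ‖x.2 - x.1‖ := hx.2
        simp [h0] at h1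
        linarith))
  refine ⟨A + C2 * (R + 1) / e + 4 * C2 / c, by positivity, fun wb hb w hw => ?_⟩
  obtain ⟨hb1, hb2, hb3⟩ := mem_box.1 hb
  have hW := elasticWeight_nonneg (p := p) (q := q) hw
  have hE := relEnergy_nonneg h hG (hδ.trans_le hb2) hw
  have hrem := rem wb hb w hw
  have hR1 : 1 ≤ R := le_max_left _ _
  have t1 := mul_nonneg hA hE
  have t2 : 0 ≤ C2 * (R + 1) / e * relEnergy ψ wb w := by positivity
  have t3 : 0 ≤ 4 * C2 / c * relEnergy ψ wb w := by positivity
  rw [add_mul, add_mul]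
  rcases le_total (elasticWeight p q w) R with hWR | hWR
  · rcases lt_or_ge ‖w - wb‖ r with hlt | hge
    · have h1 : ‖w.1 - wb.1‖ ≤ 1 :=
        (norm_fst_le (w - wb)).trans (hlt.le.trans (min_le_left _ _))
      have h2 : |w.2 - wb.2| ≤ 1 :=
        (norm_snd_le (w - wb)).trans (hlt.le.trans (min_le_left _ _))
      have h3 : |w.2 - wb.2| ≤ δ / 2 :=
        (norm_snd_le (w - wb)).trans (hlt.le.trans (min_le_right _ _))
      rw [abs_le] at h2 h3
      have h4 : ‖w.1‖ ≤ M + 1 := by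
        have := norm_le_norm_add_norm_sub' w.1 wb.1
        linarith
      have := near wb (mem_box.2 ⟨by linarith, by linarith, by linarith⟩) w
        (mem_box.2 ⟨h4, by linarith, by linarith⟩)
      linarith
    · have h1 := mid (wb, w) ⟨⟨hb, mem_box_of_elasticWeight_le hp hq hR1 hw hWR⟩, hge⟩
      have h2 : C2 * (elasticWeight p q w + 1) ≤ C2 * (R + 1) / e * relEnergy ψ wb w := by
        calc _ ≤ C2 * (R + 1) := by gcongr
          _ = C2 * (R + 1) / e * e := by field_simp
          _ ≤ _ := by gcongr
      linarith
  · have h1 := far wb hb w hw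
    have h2 : (2 * C1 + 1) / c ≤ elasticWeight p q w := (le_max_right _ _).trans hWR
    rw [div_le_iff₀ hc] at h2
    have h3 : C2 * (elasticWeight p q w + 1) ≤ 4 * C2 / c * relEnergy ψ wb w := by
      have h4 : c / 2 * elasticWeight p q w ≤ relEnergy ψ wb w := by linarith
      calc _ ≤ C2 * (2 * elasticWeight p q w) := by
            gcongr
            linarith
        _ = 4 * C2 / c * (c / 2 * elasticWeight p q w) := by field_simp; ring
        _ ≤ _ := by gcongr
    linarith

end

section

/-! ### Mollification of Lipschitz functions on a normed space -/

section Mollify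

set_option linter.unusedSectionVars false

open scoped Convolution

variable {E : Type*} [NormedAddCommGroup E] [NormedSpace ℝ E] [FiniteDimensional ℝ E]
  [MeasurableSpace E] [BorelSpace E] {m : Measure E} [m.IsAddHaarMeasure]

/-- Convolution with a normalized bump function. -/
def mollify (m : Measure E) (ρ : ContDiffBump (0 : E)) (g : E → ℝ) (x : E) : ℝ :=
  ∫ y, ρ.normed m y * g (x - y) ∂m

theorem mollify_eq_convolution (ρ : ContDiffBump (0 : E)) (g : E → ℝ) :
    mollify m ρ g = ρ.normed m ⋆[ContinuousLinearMap.lsmul ℝ ℝ, m] g := rfl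

theorem abs_mollify_le (ρ : ContDiffBump (0 : E)) {g : E → ℝ} {B : ℝ} (hB : ∀ x, |g x| ≤ B)
    (x : E) : |mollify m ρ g x| ≤ B := by
  calc |mollify m ρ g x| ≤ ∫ y, ρ.normed m y * B ∂m := by
        rw [← Real.norm_eq_abs, mollify]
        refine norm_integral_le_of_norm_le ((ρ.integrable_normed (μ := m)).mul_const B)
          (.of_forall fun y => ?_)
        rw [norm_mul, Real.norm_of_nonneg (ρ.nonneg_normed y)]
        exact mul_le_mul_of_nonneg_left (hB _) (ρ.nonneg_normed y)
    _ = B := by rw [integral_mul_const, ρ.integral_normed, one_mul]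

theorem mollify_nonneg (ρ : ContDiffBump (0 : E)) {g : E → ℝ} (hg : ∀ x, 0 ≤ g x) (x : E) :
    0 ≤ mollify m ρ g x :=
  integral_nonneg fun y => mul_nonneg (ρ.nonneg_normed y) (hg _)

theorem contDiff_mollify (ρ : ContDiffBump (0 : E)) {g : E → ℝ} (hg : Continuous g) :
    ContDiff ℝ ∞ (mollify m ρ g) := by
  rw [mollify_eq_convolution]
  exact ρ.hasCompactSupport_normed.contDiff_convolution_left _ ρ.contDiff_normed
    hg.locallyIntegrable

/-- Differentiation falls on the Lipschitz factor `g`: the difference quotients are dominated by its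
Lipschitz constant and converge almost everywhere by Rademacher's theorem. -/
theorem hasLineDerivAt_mollify (ρ : ContDiffBump (0 : E)) {g : E → ℝ} {K : ℝ≥0}
    (hg : LipschitzWith K g) (x v : E) :
    HasLineDerivAt ℝ (mollify m ρ g) (mollify m ρ (fun y => lineDeriv ℝ g y v) x) x v := by
  have hae : ∀ᵐ y ∂m, LineDifferentiableAt ℝ g (x - y) v :=
    (quasiMeasurePreserving_sub_left m x).ae (hg.ae_lineDifferentiableAt v)
  have hcont : ∀ t : ℝ, Continuous fun y => ρ.normed m y * g (x + t • v - y) := fun t =>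
    ρ.continuous_normed.mul (hg.continuous.comp (by fun_prop))
  have hcs : ∀ t : ℝ, HasCompactSupport fun y => ρ.normed m y * g (x + t • v - y) := fun t =>
    ρ.hasCompactSupport_normed.mul_right
  refine (hasDerivAt_integral_of_dominated_loc_of_lip (𝕜 := ℝ) (μ := m)
    (F := fun t y => ρ.normed m y * g (x + t • v - y))
    (F' := fun y => ρ.normed m y * lineDeriv ℝ g (x - y) v)
    (bound := fun y => ρ.normed m y * (K * ‖v‖)) (x₀ := 0) univ_mem
    (.of_forall fun t => (hcont t).aestronglyMeasurable)
    ((hcont 0).integrable_of_hasCompactSupport (hcs 0)) ?_ ?_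
    (ρ.integrable_normed.mul_const _) ?_).2
  · exact ρ.continuous_normed.aestronglyMeasurable.mul
      ((measurable_lineDeriv hg.continuous).comp (measurable_const.sub measurable_id)).aestronglyMeasurable
  · refine .of_forall fun y => LipschitzOnWith.of_dist_le_mul fun s _ t _ => ?_
    have h1 := hg.dist_le_mul (x + s • v - y) (x + t • v - y)
    rw [Real.dist_eq, ← mul_sub, abs_mul, abs_of_nonneg (ρ.nonneg_normed y), Real.coe_nnabs,
      abs_of_nonneg (mul_nonneg (ρ.nonneg_normed y) (by positivity)), mul_assoc]
    refine mul_le_mul_of_nonneg_left ?_ (ρ.nonneg_normed y)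
    rw [← Real.dist_eq]
    refine h1.trans_eq ?_
    rw [dist_eq_norm, show x + s • v - y - (x + t • v - y) = (s - t) • v by module, norm_smul,
      dist_eq_norm]
    ring
  · filter_upwards [hae] with y hy
    have h1 := hy.hasLineDerivAt.const_mul (ρ.normed m y)
    refine h1.congr_of_eventuallyEq (.of_forall fun t => ?_)
    simp only
    congr 2
    abel

/-- The bounded ratio of outer to inner radius is what lets mollifications of a merely locally
integrable function converge at almost every point. -/
theorem exists_bump_seq : ∃ ρ : ℕ → ContDiffBump (0 : E),
    Tendsto (fun n => (ρ n).rOut) atTop (𝓝 0) ∧ ∀ n, (ρ n).rOut ≤ 2 * (ρ n).rIn := by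
  refine ⟨fun n => ⟨1 / (n + 1), 2 * (1 / (n + 1)), by positivity, by
    have : (0 : ℝ) < 1 / (n + 1) := by positivity
    linarith⟩, ?_, fun n => le_rfl⟩
  simpa using (tendsto_one_div_add_atTop_nhds_zero_nat (𝕜 := ℝ)).const_mul 2

end Mollify

/-! ### The covering of the torus -/

variable {d : ℕ}

instance isAddHaarMeasure_volume_spaceTime :
    (volume : Measure ((Fin d → ℝ) × ℝ)).IsAddHaarMeasure :=
  inferInstanceAs ((volume : Measure (Fin d → ℝ)).prod (volume : Measure ℝ)).IsAddHaarMeasure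

/-- The covering map of space-time. -/
def cover (y : (Fin d → ℝ) × ℝ) : Torus d × ℝ :=
  (fun i => ((y.1 i : ℝ) : AddCircle (2 * Real.pi)), y.2)

theorem cover_sub (y z : (Fin d → ℝ) × ℝ) : cover (y - z) = cover y - cover z := rfl

theorem norm_coe_addCircle_le {p : ℝ} (x : ℝ) : ‖(x : AddCircle p)‖ ≤ |x| :=
  QuotientAddGroup.norm_mk_le_norm

theorem lipschitzWith_cover : LipschitzWith 1 (cover (d := d)) := by
  refine LipschitzWith.of_dist_le_mul fun y z => ?_
  rw [dist_eq_norm, dist_eq_norm, ← cover_sub, NNReal.coe_one, one_mul]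
  generalize y - z = x
  refine max_le ((pi_norm_le_iff_of_nonneg (norm_nonneg _)).2 fun i => ?_) (norm_snd_le x)
  exact (norm_coe_addCircle_le _).trans ((norm_le_pi_norm x.1 i).trans (norm_fst_le x))

/-- A measurable section of the covering map. -/
def coverSection (z : Torus d × ℝ) : (Fin d → ℝ) × ℝ :=
  (fun i => (AddCircle.equivIoc (2 * Real.pi) 0 (z.1 i) : ℝ), z.2)

theorem cover_coverSection (z : Torus d × ℝ) : cover (coverSection z) = z := by
  refine Prod.ext (funext fun i => ?_) rfl
  exact (AddCircle.equivIoc (2 * Real.pi) 0).symm_apply_apply (z.1 i)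

/-- The section carries the measure of the torus to Lebesgue measure on a fundamental cell. Null
sets upstairs therefore pull back to null sets, and almost-everywhere statements descend from the
covering space. -/
theorem quasiMeasurePreserving_coverSection :
    Measure.QuasiMeasurePreserving (coverSection (d := d)) volume volume := by
  have h1 : MeasurePreserving
      (fun x : AddCircle (2 * Real.pi) => (AddCircle.equivIoc (2 * Real.pi) 0 x : ℝ)) volume
      (volume.restrict (Ioc 0 (0 + 2 * Real.pi))) :=
    (measurePreserving_subtype_coe measurableSet_Ioc).comp
      (AddCircle.measurePreserving_equivIoc _)
  have h2 := measurePreserving_pi (fun _ : Fin d => volume) (fun _ : Fin d => _) (fun _ => h1)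
  have h3 := h2.prod (MeasurePreserving.id (volume : Measure ℝ))
  refine ⟨h3.measurable, ?_⟩
  have h4 : Measure.map coverSection (volume : Measure (Torus d × ℝ)) = _ := h3.map_eq
  rw [h4, ← Measure.restrict_pi_pi, ← volume_pi, Measure.volume_eq_prod]
  exact Measure.restrict_le_self.absolutelyContinuous.prod .rfl

theorem ae_of_ae_cover {P : Torus d × ℝ → Prop} (h : ∀ᵐ y, P (cover y)) : ∀ᵐ z, P z := by
  filter_upwards [quasiMeasurePreserving_coverSection.ae h] with z hz
  rwa [cover_coverSection] at hz

/-- The velocity of the line `s ↦ x + s e_α`. -/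
def spaceDir (α : Fin d) : (Fin d → ℝ) × ℝ := (Pi.single α 1, 0)

/-- The velocity of the line `s ↦ t + s`. -/
def timeDir : (Fin d → ℝ) × ℝ := (0, 1)

theorem norm_spaceDir (α : Fin d) : ‖spaceDir α‖ ≤ 1 := by
  refine max_le ?_ (by simp [spaceDir])
  simp [spaceDir, Pi.norm_single]

theorem norm_timeDir : ‖(timeDir : (Fin d → ℝ) × ℝ)‖ ≤ 1 := by
  simp [timeDir, Prod.norm_def]

/-- The line in direction `e_α` through `z`. -/
def spaceLine (α : Fin d) (z : Torus d × ℝ) (s : ℝ) : Torus d × ℝ :=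
  (z.1 + Pi.single α (s : AddCircle (2 * Real.pi)), z.2)

/-- The line in time through `z`. -/
def timeLine (z : Torus d × ℝ) (s : ℝ) : Torus d × ℝ := (z.1, s)

theorem cover_add_smul_spaceDir (y : (Fin d → ℝ) × ℝ) (α : Fin d) (s : ℝ) :
    cover (y + s • spaceDir α) = spaceLine α (cover y) s := by
  refine Prod.ext (funext fun i => ?_) (by simp [cover, spaceDir, spaceLine])
  rcases eq_or_ne i α with rfl | hi
  · simp [cover, spaceDir, spaceLine]
  · simp [cover, spaceDir, spaceLine, hi]

theorem cover_add_smul_timeDir (y : (Fin d → ℝ) × ℝ) (s : ℝ) :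
    cover (y + s • timeDir) = timeLine (cover y) (y.2 + s) := by
  refine Prod.ext (funext fun i => ?_) ?_ <;> simp [cover, timeDir, timeLine]

theorem dx_cover (f : Torus d × ℝ → ℝ) (α : Fin d) (y : (Fin d → ℝ) × ℝ) :
    dx α f (cover y) = lineDeriv ℝ (f ∘ cover) y (spaceDir α) := by
  simp only [lineDeriv, Function.comp, cover_add_smul_spaceDir]
  rfl

theorem dt_cover (f : Torus d × ℝ → ℝ) (y : (Fin d → ℝ) × ℝ) :
    dt f (cover y) = lineDeriv ℝ (f ∘ cover) y timeDir := by
  simp only [lineDeriv, Function.comp, cover_add_smul_timeDir]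
  have := deriv_comp_const_add (f := fun s => f (timeLine (cover y) s)) y.2 0
  rw [add_zero] at this
  rw [this]
  rfl

theorem lipschitzWith_spaceLine (α : Fin d) (z : Torus d × ℝ) :
    LipschitzWith 1 (spaceLine α z) := by
  obtain ⟨y, rfl⟩ : ∃ y, cover y = z := ⟨_, cover_coverSection z⟩
  have h : spaceLine α (cover y) = cover ∘ fun s : ℝ => y + s • spaceDir α :=
    funext fun s => (cover_add_smul_spaceDir y α s).symm
  rw [h, ← one_mul (1 : ℝ≥0)]
  refine lipschitzWith_cover.comp (LipschitzWith.of_dist_le_mul fun s t => ?_)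
  rw [dist_add_left, dist_eq_norm, ← sub_smul, norm_smul, ← dist_eq_norm, NNReal.coe_one, one_mul]
  exact mul_le_of_le_one_right dist_nonneg (norm_spaceDir α)

theorem lipschitzWith_timeLine (z : Torus d × ℝ) : LipschitzWith 1 (timeLine z) :=
  LipschitzWith.prodMk_left z.1

theorem dx_eq (f : Torus d × ℝ → ℝ) (α : Fin d) (z : Torus d × ℝ) :
    dx α f z = deriv (fun s => f (spaceLine α z s)) 0 := rfl

theorem dt_eq (f : Torus d × ℝ → ℝ) (z : Torus d × ℝ) :
    dt f z = deriv (fun s => f (timeLine z s)) z.2 := rfl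

theorem abs_dx_le {f : Torus d × ℝ → ℝ} {K : ℝ≥0} (hf : LipschitzWith K f) (α : Fin d)
    (z : Torus d × ℝ) : |dx α f z| ≤ K := by
  have h := hf.comp (lipschitzWith_spaceLine α z)
  rw [mul_one] at h
  exact norm_deriv_le_of_lipschitz h

theorem abs_dt_le {f : Torus d × ℝ → ℝ} {K : ℝ≥0} (hf : LipschitzWith K f)
    (z : Torus d × ℝ) : |dt f z| ≤ K := by
  have h := hf.comp (lipschitzWith_timeLine z)
  rw [mul_one] at h
  exact norm_deriv_le_of_lipschitz h

theorem continuous_spaceLine (α : Fin d) :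
    Continuous fun x : (Torus d × ℝ) × ℝ => spaceLine α x.1 x.2 := by
  refine Continuous.prodMk ?_ (by fun_prop)
  refine Continuous.add (by fun_prop) ?_
  exact (continuous_single α).comp ((AddCircle.continuous_mk' _).comp continuous_snd)

theorem measurable_dx {f : Torus d × ℝ → ℝ} (hf : Continuous f) (α : Fin d) :
    Measurable (dx α f) :=
  (measurable_deriv_with_param (f := fun z s => f (spaceLine α z s))
    (hf.comp (continuous_spaceLine α))).comp (measurable_id.prodMk measurable_const)

theorem measurable_dt {f : Torus d × ℝ → ℝ} (hf : Continuous f) : Measurable (dt f) :=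
  (measurable_deriv_with_param (f := fun (x : Torus d) s => f (x, s)) hf)

/-- Rademacher's theorem on space-time, along the coordinate lines. -/
theorem ae_differentiableAt_lines {F : Type*} [NormedAddCommGroup F] [NormedSpace ℝ F]
    [FiniteDimensional ℝ F] {f : Torus d × ℝ → F} {K : ℝ≥0} (hf : LipschitzWith K f) :
    ∀ᵐ z, DifferentiableAt ℝ (fun s => f (timeLine z s)) z.2 ∧
      ∀ α, DifferentiableAt ℝ (fun s => f (spaceLine α z s)) 0 := by
  refine ae_of_ae_cover ?_
  filter_upwards [(hf.comp lipschitzWith_cover).ae_differentiableAt] with y hy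
  constructor
  · have h1 : DifferentiableAt ℝ (fun s : ℝ => y + s • timeDir) 0 := by fun_prop
    have h2 : DifferentiableAt ℝ (fun s : ℝ => (f ∘ cover) (y + s • timeDir)) 0 :=
      DifferentiableAt.comp (g := f ∘ cover) 0 (by simpa using hy) h1
    simp only [Function.comp, cover_add_smul_timeDir] at h2
    have h3 : DifferentiableAt ℝ (fun s : ℝ => s - y.2) y.2 := by fun_prop
    have h4 := DifferentiableAt.comp (g := fun s => f (timeLine (cover y) (y.2 + s))) y.2
      (by simpa using h2) h3
    simpa [Function.comp_def, cover] using h4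
  · intro α
    have h1 : DifferentiableAt ℝ (fun s : ℝ => y + s • spaceDir α) 0 := by fun_prop
    have h2 : DifferentiableAt ℝ (fun s : ℝ => (f ∘ cover) (y + s • spaceDir α)) 0 :=
      DifferentiableAt.comp (g := f ∘ cover) 0 (by simpa using hy) h1
    simpa only [Function.comp, cover_add_smul_spaceDir] using h2

/-- Lipschitz functions on space-time are limits of smooth ones, along with the first
derivatives. -/
theorem exists_smooth_approx {f : Torus d × ℝ → ℝ} {K : ℝ≥0} (hf : LipschitzWith K f) {B : ℝ}
    (hB : ∀ z, |f z| ≤ B) :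
    ∃ g : ℕ → Torus d × ℝ → ℝ, (∀ n, ContDiff ℝ ∞ (g n ∘ cover)) ∧ (∀ n z, |g n z| ≤ B) ∧
      ((∀ z, 0 ≤ f z) → ∀ n z, 0 ≤ g n z) ∧ (∀ z, Tendsto (fun n => g n z) atTop (𝓝 (f z))) ∧
      (∀ n z, |dt (g n) z| ≤ K) ∧ (∀ n α z, |dx α (g n) z| ≤ K) ∧
      (∀ᵐ z, Tendsto (fun n => dt (g n) z) atTop (𝓝 (dt f z))) ∧
      ∀ α, ∀ᵐ z, Tendsto (fun n => dx α (g n) z) atTop (𝓝 (dx α f z)) := by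
  obtain ⟨ρ, hρ, hρ'⟩ := exists_bump_seq (E := (Fin d → ℝ) × ℝ)
  have hL : LipschitzWith K (f ∘ cover) := by simpa using hf.comp lipschitzWith_cover
  set g : ℕ → Torus d × ℝ → ℝ := fun n z => ∫ y, (ρ n).normed volume y * f (z - cover y) with hg
  have hlift : ∀ n, g n ∘ cover = mollify volume (ρ n) (f ∘ cover) := fun n => rfl
  have hld : ∀ n v y, lineDeriv ℝ (g n ∘ cover) y v
      = mollify volume (ρ n) (fun y => lineDeriv ℝ (f ∘ cover) y v) y := fun n v y => by
    rw [hlift]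
    exact (hasLineDerivAt_mollify (ρ n) hL y v).lineDeriv
  have hbd : ∀ v : (Fin d → ℝ) × ℝ, ‖v‖ ≤ 1 → ∀ n y, |lineDeriv ℝ (g n ∘ cover) y v| ≤ K := by
    intro v hv n y
    rw [hld]
    refine abs_mollify_le (ρ n) (fun x => ?_) y
    exact (norm_lineDeriv_le_of_lipschitz ℝ hL).trans (mul_le_of_le_one_right K.2 hv)
  -- The derivative of the mollification is the mollification of the bounded derivative, so it
  -- converges almost everywhere by Lebesgue differentiation.
  have hlim : ∀ v, ∀ᵐ y, Tendsto (fun n => lineDeriv ℝ (g n ∘ cover) y v) atTop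
      (𝓝 (lineDeriv ℝ (f ∘ cover) y v)) := by
    intro v
    have := ContDiffBump.ae_convolution_tendsto_right_of_locallyIntegrable
      (μ := (volume : Measure ((Fin d → ℝ) × ℝ))) (φ := ρ) (l := atTop) (K := 2) hρ
      (.of_forall hρ') (hL.locallyIntegrable_lineDeriv v)
    filter_upwards [this] with y hy
    simp only [hld]
    exact hy
  have hsurj : ∀ z : Torus d × ℝ, ∃ y, cover y = z := fun z => ⟨_, cover_coverSection z⟩
  refine ⟨g, fun n => ?_, fun n z => ?_, fun h0 n z => ?_, fun z => ?_, fun n z => ?_,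
    fun n α z => ?_, ?_, fun α => ?_⟩
  · rw [hlift]
    exact contDiff_mollify (ρ n) hL.continuous
  · obtain ⟨y, rfl⟩ := hsurj z
    exact abs_mollify_le (ρ n) (g := f ∘ cover) (fun x => hB _) y
  · obtain ⟨y, rfl⟩ := hsurj z
    exact mollify_nonneg (ρ n) (g := f ∘ cover) (fun x => h0 _) y
  · obtain ⟨y, rfl⟩ := hsurj z
    exact ContDiffBump.convolution_tendsto_right_of_continuous
      (μ := (volume : Measure ((Fin d → ℝ) × ℝ))) hρ hL.continuous y
  · obtain ⟨y, rfl⟩ := hsurj z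
    rw [dt_cover]
    exact hbd _ norm_timeDir n y
  · obtain ⟨y, rfl⟩ := hsurj z
    rw [dx_cover]
    exact hbd _ (norm_spaceDir α) n y
  · refine ae_of_ae_cover ?_
    simp only [dt_cover]
    exact hlim _
  · refine ae_of_ae_cover ?_
    simp only [dx_cover]
    exact hlim _

end

section

variable {d : ℕ}

/-! ### Integration over space-time slabs -/

theorem measurableSet_Q (T : ℝ) : MeasurableSet (Q d T) := MeasurableSet.univ.prod measurableSet_Ico

theorem Q_mono {S T : ℝ} (h : S ≤ T) : Q d S ⊆ Q d T :=
  prod_mono subset_rfl (Ico_subset_Ico_right h)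

theorem volume_restrict_Q (T : ℝ) : (volume : Measure (Torus d × ℝ)).restrict (Q d T)
    = (volume : Measure (Torus d)).prod (volume.restrict (Ico 0 T)) := by
  rw [Q, Measure.volume_eq_prod, ← Measure.prod_restrict, Measure.restrict_univ]

instance isFiniteMeasure_volume_torus : IsFiniteMeasure (volume : Measure (Torus d)) :=
  inferInstanceAs (IsFiniteMeasure (Measure.pi fun _ : Fin d => volume))

instance isFiniteMeasure_restrict_Q (T : ℝ) :
    IsFiniteMeasure ((volume : Measure (Torus d × ℝ)).restrict (Q d T)) := by
  rw [volume_restrict_Q]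
  infer_instance

theorem ae_mem_Q (T : ℝ) : ∀ᵐ z ∂(volume.restrict (Q d T)), z ∈ Q d T :=
  ae_restrict_mem (measurableSet_Q T)

theorem measurePreserving_spaceLine (T : ℝ) (α : Fin d) (s : ℝ) :
    MeasurePreserving (fun z => spaceLine α z s) ((volume : Measure (Torus d × ℝ)).restrict (Q d T))
      (volume.restrict (Q d T)) := by
  rw [volume_restrict_Q]
  exact (measurePreserving_add_right volume _).prod (MeasurePreserving.id _)

theorem integrableOn_Q_of_bound {T : ℝ} {f : Torus d × ℝ → ℝ} (hf : Measurable f) {C : ℝ}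
    (hC : ∀ z ∈ Q d T, |f z| ≤ C) : IntegrableOn f (Q d T) :=
  Integrable.of_bound hf.aestronglyMeasurable C (by
    filter_upwards [ae_mem_Q T] with z hz using hC z hz)

theorem exists_abs_le_of_mem_Q {φ : ℝ → ℝ} (hφ : Continuous φ) (T : ℝ) :
    ∃ C, 0 ≤ C ∧ ∀ z ∈ Q d T, |φ z.2| ≤ C := by
  obtain ⟨C, hC⟩ := (isCompact_Icc (a := (0 : ℝ)) (b := T)).exists_bound_of_continuousOn
    hφ.continuousOn
  exact ⟨|C|, abs_nonneg _, fun z hz =>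
    (hC z.2 (Ico_subset_Icc_self hz.2)).trans (le_abs_self C)⟩

/-- The divergence theorem on the torus. -/
theorem integral_dx_eq_zero {T : ℝ} {k : Torus d × ℝ → ℝ} {K : ℝ≥0} (hk : LipschitzWith K k)
    {B : ℝ} (hB : ∀ z, |k z| ≤ B) {φ : ℝ → ℝ} (hφ : Continuous φ) (α : Fin d) :
    ∫ z in Q d T, φ z.2 * dx α k z = 0 := by
  obtain ⟨C, hC0, hC⟩ := exists_abs_le_of_mem_Q (d := d) hφ T
  set h : ℕ → ℝ := fun n => 1 / ((n : ℝ) + 1) with hh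
  have hpos : ∀ n, 0 < h n := fun n => by positivity
  have hlim : Tendsto h atTop (𝓝[≠] 0) := tendsto_nhdsWithin_iff.2
    ⟨tendsto_one_div_add_atTop_nhds_zero_nat, .of_forall fun n => (hpos n).ne'⟩
  have hint : IntegrableOn (fun z => φ z.2 * k z) (Q d T) :=
    integrableOn_Q_of_bound (by
      exact (hφ.measurable.comp measurable_snd).mul hk.continuous.measurable) (C := C * B)
      fun z hz => by
        rw [abs_mul]
        exact mul_le_mul (hC z hz) (hB z) (abs_nonneg _) hC0
  -- Every difference quotient has zero integral by translation invariance, as φ depends on time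
  -- only; dominated convergence then passes to the derivative.
  have hzero : ∀ n, ∫ z in Q d T, (h n)⁻¹ * (φ z.2 * k (spaceLine α z (h n)) - φ z.2 * k z)
      = 0 := by
    intro n
    have mp := measurePreserving_spaceLine T α (h n)
    have h1 : Integrable (fun z => φ z.2 * k (spaceLine α z (h n))) (volume.restrict (Q d T)) :=
      mp.integrable_comp_of_integrable hint
    have h2 : ∫ z in Q d T, φ z.2 * k (spaceLine α z (h n)) = ∫ z in Q d T, φ z.2 * k z := by
      have hm : AEStronglyMeasurable (fun z : Torus d × ℝ => φ z.2 * k z)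
          (Measure.map (fun z => spaceLine α z (h n)) (volume.restrict (Q d T))) := by
        rw [mp.map_eq]
        exact hint.aestronglyMeasurable
      have := integral_map mp.measurable.aemeasurable hm
      rw [mp.map_eq] at this
      exact this.symm
    rw [integral_const_mul, integral_sub h1 hint, h2, sub_self, mul_zero]
  have hconv := tendsto_integral_of_dominated_convergence (μ := volume.restrict (Q d T))
    (F := fun n z => (h n)⁻¹ * (φ z.2 * k (spaceLine α z (h n)) - φ z.2 * k z))
    (f := fun z => φ z.2 * dx α k z) (fun _ => C * K)
    (fun n => by
      have : Continuous fun z : Torus d × ℝ => k (spaceLine α z (h n)) :=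
        hk.continuous.comp ((continuous_spaceLine α).comp
          (continuous_id.prodMk continuous_const))
      exact (continuous_const.mul (((hφ.comp continuous_snd).mul this).sub
        ((hφ.comp continuous_snd).mul hk.continuous))).aestronglyMeasurable)
    (integrable_const _)
    (fun n => by
      filter_upwards [ae_mem_Q T] with z hz
      rw [← mul_sub, norm_mul, norm_mul, norm_inv, Real.norm_of_nonneg (hpos n).le]
      have h1 := (hk.comp (lipschitzWith_spaceLine α z)).norm_sub_le (h n) 0
      simp only [Function.comp, mul_one, sub_zero, Real.norm_of_nonneg (hpos n).le] at h1
      have h2 : spaceLine α z 0 = z := by simp [spaceLine]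
      rw [h2] at h1
      calc (h n)⁻¹ * (‖φ z.2‖ * ‖k (spaceLine α z (h n)) - k z‖)
          ≤ (h n)⁻¹ * (C * (K * h n)) := by
            gcongr
            exact hC z hz
        _ = C * K := by field_simp [(hpos n).ne'])
    (by
      filter_upwards [ae_restrict_of_ae (ae_differentiableAt_lines hk)] with z hz
      have h1 := (hz.2 α).hasDerivAt.tendsto_slope.comp hlim
      have h2 := h1.const_mul (φ z.2)
      rw [dx_eq]
      refine h2.congr fun n => ?_
      have h3 : spaceLine α z 0 = z := by simp [spaceLine]
      simp only [Function.comp, slope, h3, vsub_eq_sub, smul_eq_mul, sub_zero]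
      ring)
  simp only [hzero] at hconv
  exact (tendsto_nhds_unique hconv tendsto_const_nhds)

/-- Integration by parts in time against a cut-off function. -/
theorem integral_dt_eq {T : ℝ} (hT : 0 ≤ T) {k : Torus d × ℝ → ℝ} {K : ℝ≥0}
    (hk : LipschitzWith K k) {B : ℝ} (hB : ∀ z, |k z| ≤ B) {φ : ℝ → ℝ} (hφ : ContDiff ℝ ∞ φ)
    (hφT : ∀ t, T ≤ t → φ t = 0) :
    ∫ z in Q d T, (φ z.2 * dt k z + deriv φ z.2 * k z) = -∫ x : Torus d, φ 0 * k (x, 0) := by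
  have hφ' : Continuous (deriv φ) := hφ.continuous_deriv (by simp)
  obtain ⟨C, hC0, hC⟩ := exists_abs_le_of_mem_Q (d := d) hφ.continuous T
  obtain ⟨C', hC0', hC'⟩ := exists_abs_le_of_mem_Q (d := d) hφ' T
  have hint : Integrable (fun z => φ z.2 * dt k z + deriv φ z.2 * k z)
      (volume.restrict (Q d T)) :=
    integrableOn_Q_of_bound (((hφ.continuous.measurable.comp measurable_snd).mul
      (measurable_dt hk.continuous)).add ((hφ'.measurable.comp measurable_snd).mul
      hk.continuous.measurable)) (C := C * K + C' * B) fun z hz => by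
        refine (abs_add_le _ _).trans (add_le_add ?_ ?_) <;> rw [abs_mul]
        · exact mul_le_mul (hC z hz) (abs_dt_le hk z) (abs_nonneg _) hC0
        · exact mul_le_mul (hC' z hz) (hB z) (abs_nonneg _) hC0'
  rw [volume_restrict_Q] at hint ⊢
  rw [integral_prod _ hint, ← integral_neg]
  congr 1
  ext x
  rw [integral_Ico_eq_integral_Ioo, ← integral_Ioc_eq_integral_Ioo,
    ← intervalIntegral.integral_of_le hT]
  obtain ⟨L, hL⟩ := exists_lipschitzOnWith_of_contDiffAt (isCompact_uIcc (a := (0 : ℝ)) (b := T))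
    (fun t _ => (hφ.of_le (by simp)).contDiffAt)
  -- On each time fibre this is the fundamental theorem for a product of absolutely continuous
  -- functions; the endpoint `T` drops out because φ vanishes there.
  have h1 := hL.absolutelyContinuousOnInterval.integral_deriv_mul_eq_sub
    ((hk.comp (lipschitzWith_timeLine (x, 0))).lipschitzOnWith).absolutelyContinuousOnInterval
  rw [hφT T le_rfl, zero_mul, zero_sub] at h1
  rw [show -(φ 0 * k (x, 0)) = -(φ 0 * (k ∘ timeLine (x, 0)) 0) from rfl, ← h1]
  congr 1
  ext t
  rw [add_comm]
  rfl

/-- A cut-off function decreasing fast enough to replace Gronwall's inequality. -/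
theorem exists_cutoff {T C : ℝ} (hT : 0 < T) (hC : 0 ≤ C) :
    ∃ φ : ℝ → ℝ, ContDiff ℝ ∞ φ ∧ (∀ t, T ≤ t → φ t = 0) ∧ (∀ t, 0 ≤ φ t) ∧
      (∀ t < T, 0 < φ t) ∧ ∀ t, 0 ≤ t → deriv φ t ≤ -(C * φ t) := by
  -- The cut-off is exp(-K / (T - t)), with logarithmic derivative -K / (T - t)². This value of `K`
  -- makes it at most -(C + 1) on [0, T).
  set K := (C + 1) * T ^ 2 with hK
  have hK0 : 0 < K := by positivity
  refine ⟨fun t => expNegInvGlue ((T - t) / K),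
    expNegInvGlue.contDiff.comp (by fun_prop), fun t ht =>
      expNegInvGlue.zero_of_nonpos (div_nonpos_of_nonpos_of_nonneg (by linarith) hK0.le),
    fun t => expNegInvGlue.nonneg _, fun t ht => expNegInvGlue.pos_of_pos (by
      have : 0 < T - t := by linarith
      positivity), fun t ht => ?_⟩
  rcases le_or_gt T t with h | h
  · have h0 : expNegInvGlue ((T - t) / K) = 0 :=
      expNegInvGlue.zero_of_nonpos (div_nonpos_of_nonpos_of_nonneg (by linarith) hK0.le)
    have hmin : IsLocalMin (fun t => expNegInvGlue ((T - t) / K)) t :=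
      .of_forall fun s => by simp only [h0]; exact expNegInvGlue.nonneg _
    rw [hmin.deriv_eq_zero]
    simp [h0]
  · have hTt : 0 < T - t := by linarith
    have hev : (fun t => expNegInvGlue ((T - t) / K)) =ᶠ[𝓝 t] fun t => Real.exp (-(K / (T - t))) := by
      filter_upwards [Iio_mem_nhds h] with s hs
      have : 0 < (T - s) / K := div_pos (sub_pos.2 hs) hK0
      rw [expNegInvGlue, if_neg this.not_ge, inv_div]
    have hd : HasDerivAt (fun t => Real.exp (-(K / (T - t))))
        (Real.exp (-(K / (T - t))) * -(K / (T - t) ^ 2)) t := by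
      have h1 : HasDerivAt (fun t => K / (T - t)) (K / (T - t) ^ 2) t := by
        refine ((hasDerivAt_const t K).div ((hasDerivAt_id t).const_sub T) hTt.ne').congr_deriv ?_
        simp
      exact h1.neg.exp
    rw [hev.deriv_eq, hd.deriv, show (fun t => expNegInvGlue ((T - t) / K)) t
      = Real.exp (-(K / (T - t))) from hev.eq_of_nhds]
    have h1 : C ≤ K / (T - t) ^ 2 := by
      rw [le_div_iff₀ (by positivity)]
      have : (T - t) ^ 2 ≤ T ^ 2 := by gcongr; linarith
      nlinarith [sq_nonneg T]
    have h2 := Real.exp_pos (-(K / (T - t)))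
    nlinarith

/-! ### Lipschitz test functions -/

theorem isOpenQuotientMap_cover : IsOpenQuotientMap (cover (d := d)) :=
  (IsOpenQuotientMap.piMap fun _ => QuotientAddGroup.isOpenQuotientMap_mk).prodMap
    IsOpenQuotientMap.id

theorem continuous_of_comp_cover {f : Torus d × ℝ → ℝ} (hf : Continuous (f ∘ cover)) :
    Continuous f :=
  isOpenQuotientMap_cover.isQuotientMap.continuous_iff.2 hf

theorem dt_mul_time {g : Torus d × ℝ → ℝ} {φ : ℝ → ℝ} {z : Torus d × ℝ}
    (hg : DifferentiableAt ℝ (fun s => g (timeLine z s)) z.2) (hφ : DifferentiableAt ℝ φ z.2) :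
    dt (fun w => g w * φ w.2) z = φ z.2 * dt g z + deriv φ z.2 * g z := by
  have h := (hg.hasDerivAt.mul hφ.hasDerivAt).deriv
  rw [dt_eq, dt_eq]
  refine h.trans ?_
  simp only [timeLine]
  ring

theorem dx_mul_time (g : Torus d × ℝ → ℝ) (φ : ℝ → ℝ) (α : Fin d) (z : Torus d × ℝ) :
    dx α (fun w => g w * φ w.2) z = φ z.2 * dx α g z := by
  rw [dx_eq, dx_eq, mul_comm (φ z.2)]
  exact deriv_mul_const_field (φ z.2)

theorem differentiable_timeLine_of_contDiff {g : Torus d × ℝ → ℝ} (hg : ContDiff ℝ ∞ (g ∘ cover))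
    (z : Torus d × ℝ) : DifferentiableAt ℝ (fun s => g (timeLine z s)) z.2 := by
  have h1 : DifferentiableAt ℝ (fun s : ℝ => ((coverSection z).1, s)) z.2 := by fun_prop
  have h2 : DifferentiableAt ℝ ((g ∘ cover) ∘ fun s : ℝ => ((coverSection z).1, s)) z.2 :=
    ((hg.differentiable (by simp)) _).comp z.2 h1
  have h3 : (fun s => g (timeLine z s)) = (g ∘ cover) ∘ fun s : ℝ => ((coverSection z).1, s) := by
    ext s
    conv_lhs => rw [← cover_coverSection z]
    rfl
  rw [h3]
  exact h2

theorem integrableOn_mul_of_bound {s : Set (Torus d × ℝ)} {a h : Torus d × ℝ → ℝ}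
    (hs : MeasurableSet s) (ha : Measurable a) {C : ℝ} (hC : ∀ z ∈ s, |a z| ≤ C)
    (hh : IntegrableOn h s) : IntegrableOn (fun z => a z * h z) s :=
  Integrable.bdd_mul hh ha.aestronglyMeasurable (c := C) (by
    filter_upwards [ae_restrict_mem hs] with z hz using hC z hz)

theorem integral_Q_eq_of_support {S T : ℝ} (hST : S ≤ T) {f : Torus d × ℝ → ℝ}
    (hf : ∀ z : Torus d × ℝ, S ≤ z.2 → f z = 0) : ∫ z in Q d T, f z = ∫ z in Q d S, f z :=
  setIntegral_eq_of_subset_of_forall_sdiff_eq_zero (measurableSet_Q T) (Q_mono hST)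
    fun z hz => hf z (not_lt.1 fun h => hz.2 ⟨mem_univ _, hz.1.2.1, h⟩)

theorem tendsto_integral_Q_mul {T : ℝ} {a : ℕ → Torus d × ℝ → ℝ} {b h : Torus d × ℝ → ℝ}
    (ha : ∀ n, Measurable (a n)) {C : ℝ} (hC : ∀ n, ∀ z ∈ Q d T, |a n z| ≤ C)
    (hlim : ∀ᵐ z, Tendsto (fun n => a n z) atTop (𝓝 (b z))) (hh : IntegrableOn h (Q d T)) :
    Tendsto (fun n => ∫ z in Q d T, a n z * h z) atTop (𝓝 (∫ z in Q d T, b z * h z)) := by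
  refine tendsto_integral_of_dominated_convergence (fun z => C * ‖h z‖)
    (fun n => (ha n).aestronglyMeasurable.mul hh.aestronglyMeasurable)
    (hh.norm.const_mul C) (fun n => ?_) ?_
  · filter_upwards [ae_mem_Q T] with z hz
    rw [norm_mul]
    exact mul_le_mul_of_nonneg_right (hC n z hz) (norm_nonneg _)
  · filter_upwards [ae_restrict_of_ae hlim] with z hz using hz.mul_const _

/-- The weak formulations extend from smooth test functions to products of a Lipschitz function
with a smooth cut-off in time. -/
theorem exists_test_seq {S T : ℝ} (hST : S < T) {f : Torus d × ℝ → ℝ} {K : ℝ≥0}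
    (hf : LipschitzWith K f) {B : ℝ} (hB : ∀ z, |f z| ≤ B) {φ : ℝ → ℝ} (hφ : ContDiff ℝ ∞ φ)
    (hφS : ∀ t, S ≤ t → φ t = 0) (hφ0 : ∀ t, 0 ≤ φ t) :
    ∃ G : ℕ → Torus d × ℝ → ℝ, (∀ n, IsTest T (G n)) ∧
      ((∀ z, 0 ≤ f z) → ∀ n z, 0 ≤ G n z) ∧
      (∀ h, IntegrableOn h (Q d S) → Tendsto (fun n => ∫ z in Q d T, dt (G n) z * h z) atTop
        (𝓝 (∫ z in Q d S, (φ z.2 * dt f z + deriv φ z.2 * f z) * h z))) ∧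
      (∀ h α, IntegrableOn h (Q d S) → Tendsto (fun n => ∫ z in Q d T, dx α (G n) z * h z) atTop
        (𝓝 (∫ z in Q d S, (φ z.2 * dx α f z) * h z))) ∧
      (∀ h : Fin d → Torus d × ℝ → ℝ, (∀ α, IntegrableOn (h α) (Q d S)) →
        Tendsto (fun n => ∫ z in Q d T, ∑ α, dx α (G n) z * h α z) atTop
          (𝓝 (∑ α, ∫ z in Q d S, (φ z.2 * dx α f z) * h α z))) ∧
      (∀ h : Torus d → ℝ, Integrable h → Tendsto (fun n => ∫ x, G n (x, 0) * h x) atTop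
        (𝓝 (∫ x, φ 0 * f (x, 0) * h x))) := by
  obtain ⟨g, hg, hgB, hg0, hglim, hgt, hgx, hgtlim, hgxlim⟩ := exists_smooth_approx hf hB
  have hφ' : Continuous (deriv φ) := hφ.continuous_deriv (by simp)
  have hφd : Differentiable ℝ φ := hφ.differentiable (by simp)
  obtain ⟨C, hC0, hC⟩ := exists_abs_le_of_mem_Q (d := d) hφ.continuous S
  obtain ⟨C', hC0', hC'⟩ := exists_abs_le_of_mem_Q (d := d) hφ' S
  have hgc : ∀ n, Continuous (g n) := fun n => continuous_of_comp_cover (hg n).continuous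
  -- A zero of the nonnegative φ is a minimum, so φ' vanishes there too.
  have hdφ : ∀ t, S ≤ t → deriv φ t = 0 := fun t ht =>
    IsLocalMin.deriv_eq_zero (.of_forall fun s => by rw [hφS t ht]; exact hφ0 s)
  have hdt : ∀ n z, dt (fun w => g n w * φ w.2) z = φ z.2 * dt (g n) z + deriv φ z.2 * g n z :=
    fun n z => dt_mul_time (differentiable_timeLine_of_contDiff (hg n) z) (hφd _)
  have hmx : ∀ n α, Measurable fun z : Torus d × ℝ => φ z.2 * dx α (g n) z := fun n α =>
    (hφ.continuous.measurable.comp measurable_snd).mul (measurable_dx (hgc n) α)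
  have hbx : ∀ n α, ∀ z ∈ Q d S, |φ z.2 * dx α (g n) z| ≤ C * K := fun n α z hz => by
    rw [abs_mul]
    exact mul_le_mul (hC z hz) (hgx n α z) (abs_nonneg _) hC0
  have hxlim : ∀ h α, IntegrableOn h (Q d S) →
      Tendsto (fun n => ∫ z in Q d S, φ z.2 * dx α (g n) z * h z) atTop
        (𝓝 (∫ z in Q d S, (φ z.2 * dx α f z) * h z)) := fun h α hh =>
    tendsto_integral_Q_mul (fun n => hmx n α) (fun n => hbx n α)
      (by filter_upwards [hgxlim α] with z hz using hz.const_mul _) hh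
  -- Only `f` is mollified; multiplying by φ afterwards keeps the support before time `S`.
  refine ⟨fun n z => g n z * φ z.2, fun n => ⟨?_, S, hST, fun x t ht => by simp [hφS t ht]⟩,
    fun h0 n z => mul_nonneg (hg0 h0 n z) (hφ0 _), fun h hh => ?_, fun h α hh => ?_,
    fun h hh => ?_, fun h hh => ?_⟩
  · exact (hg n).mul (hφ.comp contDiff_snd)
  · have h1 : ∀ n, ∫ z in Q d T, dt (fun w => g n w * φ w.2) z * h z
        = ∫ z in Q d S, (φ z.2 * dt (g n) z + deriv φ z.2 * g n z) * h z := fun n => by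
      simp only [hdt]
      exact integral_Q_eq_of_support hST.le fun z hz => by simp [hφS _ hz, hdφ _ hz]
    simp only [h1]
    refine tendsto_integral_Q_mul (C := C * K + C' * B)
      (fun n => ((hφ.continuous.measurable.comp measurable_snd).mul (measurable_dt (hgc n))).add
        ((hφ'.measurable.comp measurable_snd).mul (hgc n).measurable)) (fun n z hz => ?_) ?_ hh
    · refine (abs_add_le _ _).trans (add_le_add ?_ ?_) <;> rw [abs_mul]
      · exact mul_le_mul (hC z hz) (hgt n z) (abs_nonneg _) hC0
      · exact mul_le_mul (hC' z hz) (hgB n z) (abs_nonneg _) hC0'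
    · filter_upwards [hgtlim] with z hz
      exact (hz.const_mul _).add ((hglim z).const_mul _)
  · have h1 : ∀ n, ∫ z in Q d T, dx α (fun w => g n w * φ w.2) z * h z
        = ∫ z in Q d S, φ z.2 * dx α (g n) z * h z := fun n => by
      simp only [dx_mul_time]
      exact integral_Q_eq_of_support hST.le fun z hz => by simp [hφS _ hz]
    simp only [h1]
    exact hxlim h α hh
  · have h1 : ∀ n, ∫ z in Q d T, ∑ α, dx α (fun w => g n w * φ w.2) z * h α z
        = ∑ α, ∫ z in Q d S, φ z.2 * dx α (g n) z * h α z := fun n => by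
      simp only [dx_mul_time]
      rw [integral_Q_eq_of_support hST.le fun z hz => by simp [hφS _ hz]]
      exact integral_finsetSum _ fun α _ =>
        integrableOn_mul_of_bound (measurableSet_Q S) (hmx n α) (hbx n α) (hh α)
    simp only [h1]
    exact tendsto_finsetSum _ fun α _ => hxlim (h α) α (hh α)
  · refine tendsto_integral_of_dominated_convergence (fun x => B * |φ 0| * ‖h x‖)
      (fun n => Measurable.aestronglyMeasurable (by
        have := hgc n
        exact Continuous.measurable (by fun_prop)) |>.mul hh.aestronglyMeasurable)
      (hh.norm.const_mul _) (fun n => .of_forall fun x => ?_) (.of_forall fun x => ?_)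
    · rw [norm_mul, norm_mul]
      have := hgB n (x, 0)
      rw [← Real.norm_eq_abs] at this
      gcongr
      · exact (norm_nonneg _).trans this
      · exact le_rfl
    · rw [mul_comm (φ 0)]
      exact ((hglim _).mul_const _).mul_const _

end

section

variable {d : ℕ}

/-! ### Observables integrable against a Young measure -/

/-- The weight `|F|^p + |v|² + |θ|^q`. -/
def stateWeight (p q : ℝ) (u : State d) : ℝ := ‖u.1‖ ^ p + ‖u.2.1‖ ^ 2 + |u.2.2| ^ q

theorem stateWeight_nonneg (p q : ℝ) (u : State d) : 0 ≤ stateWeight p q u :=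
  add_nonneg (add_nonneg (Real.rpow_nonneg (norm_nonneg _) _) (sq_nonneg _))
    (Real.rpow_nonneg (abs_nonneg _) _)

/-- The physical states. -/
def physical (d : ℕ) : Set (State d) := {u | 0 ≤ u.2.2}

theorem isClosed_physical : IsClosed (physical d) :=
  isClosed_le continuous_const (by fun_prop)

/-- Continuous functions on the physical states of at most the growth of the energy. -/
structure Admissible (p q : ℝ) (h : State d → ℝ) : Prop where
  continuousOn : ContinuousOn h (physical d)
  growth : ∃ C, ∀ u ∈ physical d, |h u| ≤ C * (1 + stateWeight p q u)

section Admissible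

variable {p q : ℝ} {ψ : Mat d → ℝ → ℝ}

theorem norm_fst_le_stateWeight (hp : 1 < p) (u : State d) : ‖u.1‖ ≤ 1 + stateWeight p q u := by
  have h1 := self_le_one_add_rpow (norm_nonneg u.1) hp.le
  have h2 := sq_nonneg ‖u.2.1‖
  have h3 := Real.rpow_nonneg (abs_nonneg u.2.2) q
  rw [stateWeight]
  linarith

theorem norm_velocity_le_stateWeight (u : State d) : ‖u.2.1‖ ≤ 1 + stateWeight p q u := by
  have h1 := Real.rpow_nonneg (norm_nonneg u.1) p
  have h3 := Real.rpow_nonneg (abs_nonneg u.2.2) q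
  rw [stateWeight]
  nlinarith [sq_nonneg (‖u.2.1‖ - 1), sq_nonneg ‖u.2.1‖]

theorem elasticWeight_le_stateWeight {u : State d} (hu : u ∈ physical d) :
    elasticWeight p q (u.1, u.2.2) ≤ stateWeight p q u := by
  have h2 := sq_nonneg ‖u.2.1‖
  rw [stateWeight, elasticWeight, abs_of_nonneg hu]
  linarith

theorem admissible_deformation (hp : 1 < p) (i : Fin d × Fin d) :
    Admissible p q (fun u : State d => u.1 i) :=
  ⟨by fun_prop, 1, fun u _ => by
    rw [one_mul]
    exact (PiLp.norm_apply_le u.1 i).trans (norm_fst_le_stateWeight hp u)⟩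

theorem admissible_velocity (i : Fin d) : Admissible p q (fun u : State d => u.2.1 i) :=
  ⟨by fun_prop, 1, fun u _ => by
    rw [one_mul]
    exact (PiLp.norm_apply_le u.2.1 i).trans (norm_velocity_le_stateWeight u)⟩

theorem continuous_elastic : Continuous fun u : State d => ((u.1, u.2.2) : Mat d × ℝ) := by
  fun_prop

theorem continuousOn_comp_elastic {E : Type*} [TopologicalSpace E] {g : Mat d × ℝ → E}
    (hg : ContinuousOn g (halfSpace d)) :
    ContinuousOn (fun u : State d => g (u.1, u.2.2)) (physical d) :=
  hg.comp continuous_elastic.continuousOn fun _ hu => mem_halfSpace.2 hu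

theorem admissible_of_growth (hp : 1 < p) (hq : 1 < q) {E : Type*} [NormedAddCommGroup E]
    {g : Mat d × ℝ → E} (hg : ContinuousOn g (halfSpace d))
    (hlim : Tendsto (fun w => ‖g w‖ / elasticWeight p q w) (atInfty d p q) (𝓝 0))
    {l : E → ℝ} (hl : Continuous l) (hle : ∀ x, |l x| ≤ ‖x‖) :
    Admissible p q (fun u : State d => l (g (u.1, u.2.2))) := by
  obtain ⟨C, hC0, hC⟩ := exists_norm_le_weight_add hp hq hg hlim one_pos
  refine ⟨hl.comp_continuousOn (continuousOn_comp_elastic hg), 1 + C, fun u hu => ?_⟩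
  have h1 := hC (u.1, u.2.2) hu
  have h2 := elasticWeight_le_stateWeight (p := p) (q := q) hu
  have h3 := stateWeight_nonneg p q u
  refine (hle _).trans (h1.trans ?_)
  nlinarith [mul_nonneg hC0 h3]

theorem admissible_stress (h : Regular ψ) (hp : 1 < p) (hq : 1 < q) (ha2 : StressGrowth ψ p q)
    (i : Fin d × Fin d) : Admissible p q (fun u : State d => stress ψ u.1 u.2.2 i) :=
  admissible_of_growth hp hq (g := fun w : Mat d × ℝ => stress ψ w.1 w.2)
    h.contDiffOn_stress.continuousOn ha2 (l := fun X : Mat d => X i) (by fun_prop)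
    fun X => PiLp.norm_apply_le X i

theorem admissible_entropy (h : Regular ψ) (hp : 1 < p) (hq : 1 < q) (ha3 : EntropyGrowth ψ p q) :
    Admissible p q (fun u : State d => entropy ψ u.1 u.2.2) :=
  admissible_of_growth hp hq (g := fun w : Mat d × ℝ => entropy ψ w.1 w.2)
    h.contDiffOn_entropy.continuousOn ha3 (l := fun x : ℝ => x) continuous_id fun _ => le_rfl

theorem admissible_totalEnergy (h : Regular ψ) (ha1 : EnergyGrowth ψ p q) :
    Admissible p q (totalEnergy ψ) := by
  obtain ⟨c, hc, C, hC, he⟩ := ha1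
  refine ⟨ContinuousOn.add (by fun_prop) (continuousOn_comp_elastic h.continuousOn_energy),
    1 + C, fun u hu => ?_⟩
  obtain ⟨h1, h2⟩ := he u.1 u.2.2 hu
  have h3 := elasticWeight_le_stateWeight (p := p) (q := q) hu
  have h4 : 0 ≤ elasticWeight p q (u.1, u.2.2) := elasticWeight_nonneg hu
  have h5 := stateWeight_nonneg p q u
  have h6 : ‖u.2.1‖ ^ 2 ≤ stateWeight p q u := by
    have := Real.rpow_nonneg (norm_nonneg u.1) p
    have := Real.rpow_nonneg (abs_nonneg u.2.2) q
    rw [stateWeight]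
    linarith
  have h7 : ‖u.1‖ ^ p + u.2.2 ^ q = elasticWeight p q (u.1, u.2.2) := rfl
  rw [h7] at h1 h2
  have h8 := mul_nonneg hc.le h4
  have h9 := mul_le_mul_of_nonneg_left h3 hC.le
  have h10 := sq_nonneg ‖u.2.1‖
  rw [totalEnergy, abs_le]
  constructor <;> nlinarith

end Admissible

/-! ### Weak formulations against the Young measure -/

/-- The measure `dν_z(u) dz` on `Q_S × State`. -/
def young (S : ℝ) (ν : Kernel (Torus d × ℝ) (State d)) : Measure ((Torus d × ℝ) × State d) :=
  (volume.restrict (Q d S)) ⊗ₘ ν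

section Weak

set_option linter.unusedSectionVars false

variable {ψ : Mat d → ℝ → ℝ} {p q T : ℝ} {U : Torus d × ℝ → State d}
  {ν : Kernel (Torus d × ℝ) (State d)} [IsMarkovKernel ν] {μ : Measure (Torus d × ℝ)}
  {ν₀ : Kernel (Torus d) (State d)} [IsMarkovKernel ν₀] {μ₀ : Measure (Torus d)}

theorem IsEntropicMVSolution.ae_physical (hsol : IsEntropicMVSolution ψ p q T U ν μ ν₀ μ₀)
    {S : ℝ} (hS : S < T) : ∀ᵐ x ∂(young S ν), x.2 ∈ physical d := by
  refine Measure.ae_compProd_of_ae_ae ?_ ?_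
  · exact (isClosed_physical.preimage continuous_snd).measurableSet
  · exact ae_restrict_of_ae_restrict_of_subset (Q_mono hS.le) hsol.temp_nonneg

theorem IsEntropicMVSolution.integrable_comp_snd
    (hsol : IsEntropicMVSolution ψ p q T U ν μ ν₀ μ₀) {S : ℝ} (hS : S < T) {h : State d → ℝ}
    (hh : Admissible p q h) : Integrable (fun x => h x.2) (young S ν) := by
  obtain ⟨C, hC⟩ := hh.growth
  have hphys := hsol.ae_physical hS
  have hmw : Measurable (stateWeight p q : State d → ℝ) := by
    unfold stateWeight
    fun_prop
  have hw : Integrable (fun x => stateWeight p q x.2) (young S ν) := by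
    refine ⟨(hmw.comp measurable_snd).aestronglyMeasurable, ?_⟩
    rw [HasFiniteIntegral, young, Measure.lintegral_compProd
      (f := fun x : (Torus d × ℝ) × State d => ‖stateWeight p q x.2‖ₑ)
      (hmw.comp measurable_snd).enorm]
    refine lt_of_eq_of_lt ?_ (hsol.moment S hS)
    refine lintegral_congr fun z => lintegral_congr fun u => ?_
    exact Real.enorm_of_nonneg (stateWeight_nonneg p q u)
  have : IsFiniteMeasure (young S ν) := by unfold young; infer_instance
  refine (((integrable_const (1 : ℝ)).add hw).const_mul C).mono' ?_ ?_
  -- Nothing is known about `h` at negative temperatures, so measurability is obtained for its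
  -- cut-off to the physical states, which agrees with it almost everywhere.
  · have hm : Measurable ((physical d).indicator h) := by
      classical
      have := hh.continuousOn.measurable_piecewise (g := fun _ => (0 : ℝ))
        continuousOn_const isClosed_physical.measurableSet
      convert! this
    refine ((hm.comp measurable_snd).aestronglyMeasurable (μ := young S ν)).congr ?_
    filter_upwards [hphys] with x hx
    exact indicator_of_mem hx h
  · filter_upwards [hphys] with x hx
    exact hC x.2 hx

theorem integrable_young_mul {S : ℝ} {h : State d → ℝ}
    (hh : Integrable (fun x => h x.2) (young S ν)) {a : Torus d × ℝ → ℝ} (ha : Measurable a)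
    {C : ℝ} (hC : ∀ z ∈ Q d S, |a z| ≤ C) :
    Integrable (fun x => a x.1 * h x.2) (young S ν) := by
  refine Integrable.bdd_mul hh (ha.comp measurable_fst).aestronglyMeasurable (c := C) ?_
  refine Measure.ae_compProd_of_ae_ae ?_ ?_
  · exact measurableSet_le (ha.comp measurable_fst).norm measurable_const
  · filter_upwards [ae_mem_Q S] with z hz
    exact .of_forall fun _ => hC z hz

theorem integral_young_mul {S : ℝ} {h : State d → ℝ} {a : Torus d × ℝ → ℝ}
    (hah : Integrable (fun x => a x.1 * h x.2) (young S ν)) :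
    ∫ x, a x.1 * h x.2 ∂(young S ν) = ∫ z in Q d S, a z * ∫ u, h u ∂(ν z) := by
  rw [young] at hah ⊢
  rw [Measure.integral_compProd hah]
  simp only [integral_const_mul]

/-- The base measure is read as a constant kernel over `Unit`, so that the Fubini statement for
kernels applies. -/
theorem integrableOn_average {S : ℝ} {h : State d → ℝ}
    (hh : Integrable (fun x => h x.2) (young S ν)) :
    IntegrableOn (fun z => ∫ u, h u ∂(ν z)) (Q d S) :=
  Integrable.integral_compProd (κ := Kernel.const Unit (volume.restrict (Q d S)))
    (η := Kernel.prodMkLeft Unit ν) (a := ()) (f := fun x : (Torus d × ℝ) × State d => h x.2) hh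

theorem integral_init_eq {Ub : Torus d × ℝ → State d}
    (hν₀ : ∀ᵐ x : Torus d, ν₀ x = Measure.dirac (Ub (x, 0))) (φ : Torus d × ℝ → ℝ)
    (h : State d → ℝ) :
    ∫ x : Torus d, φ (x, 0) * ∫ u, h u ∂(ν₀ x) = ∫ x : Torus d, φ (x, 0) * h (Ub (x, 0)) := by
  refine integral_congr_ae ?_
  filter_upwards [hν₀] with x hx
  rw [hx, integral_dirac]

variable {S : ℝ} {Ub : Torus d × ℝ → State d} {φ : ℝ → ℝ}

/-- The coefficient `∂_t (f φ)`. -/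
def timeCoeff (φ : ℝ → ℝ) (f : Torus d × ℝ → ℝ) (z : Torus d × ℝ) : ℝ :=
  φ z.2 * dt f z + deriv φ z.2 * f z

theorem integrable_timeCoeff {h : State d → ℝ} (hh : Integrable (fun x => h x.2) (young S ν))
    {f : Torus d × ℝ → ℝ} {K : ℝ≥0} (hf : LipschitzWith K f) {B : ℝ} (hB : ∀ z, |f z| ≤ B)
    (hφ : ContDiff ℝ ∞ φ) : Integrable (fun x => timeCoeff φ f x.1 * h x.2) (young S ν) := by
  have hφ' : Continuous (deriv φ) := hφ.continuous_deriv (by simp)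
  obtain ⟨C, hC0, hC⟩ := exists_abs_le_of_mem_Q (d := d) hφ.continuous S
  obtain ⟨C', hC0', hC'⟩ := exists_abs_le_of_mem_Q (d := d) hφ' S
  refine integrable_young_mul hh (((hφ.continuous.measurable.comp measurable_snd).mul
      (measurable_dt hf.continuous)).add ((hφ'.measurable.comp measurable_snd).mul
      hf.continuous.measurable)) (C := C * K + C' * B) fun z hz => ?_
  refine (abs_add_le _ _).trans (add_le_add ?_ ?_) <;> rw [abs_mul]
  · exact mul_le_mul (hC z hz) (abs_dt_le hf z) (abs_nonneg _) hC0
  · exact mul_le_mul (hC' z hz) (hB z) (abs_nonneg _) hC0'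

theorem integrable_spaceCoeff {h : State d → ℝ} (hh : Integrable (fun x => h x.2) (young S ν))
    {f : Torus d × ℝ → ℝ} {K : ℝ≥0} (hf : LipschitzWith K f) (hφ : Continuous φ) (α : Fin d) :
    Integrable (fun x => φ x.1.2 * dx α f x.1 * h x.2) (young S ν) := by
  obtain ⟨C, hC0, hC⟩ := exists_abs_le_of_mem_Q (d := d) hφ S
  refine integrable_young_mul (a := fun z => φ z.2 * dx α f z) hh
    ((hφ.measurable.comp measurable_snd).mul (measurable_dx hf.continuous α)) (C := C * K)
    fun z hz => ?_
  rw [abs_mul]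
  exact mul_le_mul (hC z hz) (abs_dx_le hf α z) (abs_nonneg _) hC0

theorem IsEntropicMVSolution.weak_F (hsol : IsEntropicMVSolution ψ p q T U ν μ ν₀ μ₀)
    (hp : 1 < p) (hS : S < T) (hν₀ : ∀ᵐ x : Torus d, ν₀ x = Measure.dirac (Ub (x, 0)))
    (hφ : ContDiff ℝ ∞ φ) (hφS : ∀ t, S ≤ t → φ t = 0) (hφ0 : ∀ t, 0 ≤ φ t)
    {f : Torus d × ℝ → ℝ} {K : ℝ≥0} (hf : LipschitzWith K f) {B : ℝ} (hB : ∀ z, |f z| ≤ B)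
    (i α : Fin d) (hini : Integrable fun x : Torus d => (Ub (x, 0)).1 (i, α)) :
    Integrable (fun x => timeCoeff φ f x.1 * x.2.1 (i, α)
        - φ x.1.2 * dx α f x.1 * x.2.2.1 i) (young S ν) ∧
      ∫ x, (timeCoeff φ f x.1 * x.2.1 (i, α) - φ x.1.2 * dx α f x.1 * x.2.2.1 i) ∂(young S ν)
        = -∫ x : Torus d, φ 0 * f (x, 0) * (Ub (x, 0)).1 (i, α) := by
  have hF := hsol.integrable_comp_snd hS (admissible_deformation (q := q) hp (i, α))
  have hv := hsol.integrable_comp_snd hS (admissible_velocity (p := p) (q := q) i)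
  have i1 := integrable_timeCoeff (h := fun u => u.1 (i, α)) hF hf hB hφ
  have i2 := integrable_spaceCoeff (h := fun u => u.2.1 i) hv hf hφ.continuous α
  refine ⟨i1.sub i2, ?_⟩
  obtain ⟨G, hG, -, hGt, hGx, -, hG0⟩ := exists_test_seq hS hf hB hφ hφS hφ0
  have l1 := (hGt _ (integrableOn_average (h := fun u => u.1 (i, α)) hF)).add (hG0 _ hini)
  have l2 := hGx _ α (integrableOn_average (h := fun u => u.2.1 i) hv)
  have key := tendsto_nhds_unique (l1.congr fun n => by
    rw [← integral_init_eq hν₀ (G n) (fun u => u.1 (i, α))]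
    exact hsol.eq_F (G n) (hG n) i α) l2
  have e1 := integral_young_mul (h := fun u => u.1 (i, α)) i1
  have e2 := integral_young_mul (h := fun u => u.2.1 i) (a := fun z => φ z.2 * dx α f z) i2
  rw [integral_sub i1 i2, e1, e2]
  simp only [timeCoeff]
  linarith

theorem IsEntropicMVSolution.weak_v (hsol : IsEntropicMVSolution ψ p q T U ν μ ν₀ μ₀)
    (hreg : Regular ψ) (hp : 1 < p) (hq : 1 < q) (ha2 : StressGrowth ψ p q)
    (hS : S < T) (hν₀ : ∀ᵐ x : Torus d, ν₀ x = Measure.dirac (Ub (x, 0)))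
    (hφ : ContDiff ℝ ∞ φ) (hφS : ∀ t, S ≤ t → φ t = 0) (hφ0 : ∀ t, 0 ≤ φ t)
    {f : Torus d × ℝ → ℝ} {K : ℝ≥0} (hf : LipschitzWith K f) {B : ℝ} (hB : ∀ z, |f z| ≤ B)
    (i : Fin d) (hini : Integrable fun x : Torus d => (Ub (x, 0)).2.1 i) :
    Integrable (fun x => timeCoeff φ f x.1 * x.2.2.1 i
        - ∑ α, φ x.1.2 * dx α f x.1 * stress ψ x.2.1 x.2.2.2 (i, α)) (young S ν) ∧
      ∫ x, (timeCoeff φ f x.1 * x.2.2.1 i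
          - ∑ α, φ x.1.2 * dx α f x.1 * stress ψ x.2.1 x.2.2.2 (i, α)) ∂(young S ν)
        = -∫ x : Torus d, φ 0 * f (x, 0) * (Ub (x, 0)).2.1 i := by
  have hv := hsol.integrable_comp_snd hS (admissible_velocity (p := p) (q := q) i)
  have hs := fun α => hsol.integrable_comp_snd hS (admissible_stress hreg hp hq ha2 (i, α))
  have i1 := integrable_timeCoeff (h := fun u => u.2.1 i) hv hf hB hφ
  have i2 := fun α => integrable_spaceCoeff (h := fun u => stress ψ u.1 u.2.2 (i, α)) (hs α) hf hφ.continuous α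
  have i3 := integrable_finsetSum Finset.univ fun α _ => i2 α
  refine ⟨i1.sub i3, ?_⟩
  obtain ⟨G, hG, -, hGt, -, hGx, hG0⟩ := exists_test_seq hS hf hB hφ hφS hφ0
  have l1 := (hGt _ (integrableOn_average (h := fun u => u.2.1 i) hv)).add (hG0 _ hini)
  have l2 := hGx _ fun α => integrableOn_average (h := fun u => stress ψ u.1 u.2.2 (i, α)) (hs α)
  have key := tendsto_nhds_unique (l1.congr fun n => by
    rw [← integral_init_eq hν₀ (G n) (fun u => u.2.1 i)]
    exact hsol.eq_v (G n) (hG n) i) l2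
  have e1 := integral_young_mul (h := fun u => u.2.1 i) i1
  have e2 := fun α => integral_young_mul (h := fun u => stress ψ u.1 u.2.2 (i, α)) (a := fun z => φ z.2 * dx α f z) (i2 α)
  rw [integral_sub i1 i3, integral_finsetSum _ fun α _ => i2 α, e1]
  simp only [e2]
  simp only [timeCoeff]
  linarith

theorem IsEntropicMVSolution.weak_entropy (hsol : IsEntropicMVSolution ψ p q T U ν μ ν₀ μ₀)
    (hreg : Regular ψ) (hp : 1 < p) (hq : 1 < q) (ha3 : EntropyGrowth ψ p q)
    (hS : S < T) (hν₀ : ∀ᵐ x : Torus d, ν₀ x = Measure.dirac (Ub (x, 0)))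
    (hφ : ContDiff ℝ ∞ φ) (hφS : ∀ t, S ≤ t → φ t = 0) (hφ0 : ∀ t, 0 ≤ φ t)
    {f : Torus d × ℝ → ℝ} {K : ℝ≥0} (hf : LipschitzWith K f) {B : ℝ} (hB : ∀ z, |f z| ≤ B)
    (hf0 : ∀ z, 0 ≤ f z)
    (hini : Integrable fun x : Torus d => entropy ψ (Ub (x, 0)).1 (Ub (x, 0)).2.2) :
    Integrable (fun x => timeCoeff φ f x.1 * entropy ψ x.2.1 x.2.2.2) (young S ν) ∧
      ∫ x, timeCoeff φ f x.1 * entropy ψ x.2.1 x.2.2.2 ∂(young S ν)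
        ≤ -∫ x : Torus d, φ 0 * f (x, 0) * entropy ψ (Ub (x, 0)).1 (Ub (x, 0)).2.2 := by
  have he := hsol.integrable_comp_snd hS (admissible_entropy hreg hp hq ha3)
  have i1 := integrable_timeCoeff (h := fun u => entropy ψ u.1 u.2.2) he hf hB hφ
  refine ⟨i1, ?_⟩
  obtain ⟨G, hG, hGpos, hGt, -, -, hG0⟩ := exists_test_seq hS hf hB hφ hφS hφ0
  have l1 := (hGt _ (integrableOn_average (h := fun u => entropy ψ u.1 u.2.2) he)).add (hG0 _ hini)
  have key := le_of_tendsto' l1 fun n => by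
    rw [← integral_init_eq hν₀ (G n) (fun u => entropy ψ u.1 u.2.2)]
    exact hsol.ineq_entropy (G n) (hG n) fun z _ => hGpos hf0 n z
  have e1 := integral_young_mul (h := fun u => entropy ψ u.1 u.2.2) i1
  rw [e1]
  simp only [timeCoeff]
  linarith

/-- A cut-off in time alone is already a smooth test function and annihilates the energy flux. The
concentration measure survives only as ∫ φ' dμ, which is nonpositive, so discarding it turns the
equation into an inequality. -/
theorem IsEntropicMVSolution.weak_energy (hsol : IsEntropicMVSolution ψ p q T U ν μ ν₀ μ₀)
    (hreg : Regular ψ) (ha1 : EnergyGrowth ψ p q)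
    (hS : S < T) (hν₀ : ∀ᵐ x : Torus d, ν₀ x = Measure.dirac (Ub (x, 0))) (hμ₀ : μ₀ = 0)
    (hφ : ContDiff ℝ ∞ φ) (hφS : ∀ t, S ≤ t → φ t = 0) (hφ0 : ∀ t, 0 ≤ φ t)
    (hφ' : ∀ t, 0 ≤ t → deriv φ t ≤ 0) :
    Integrable (fun x => deriv φ x.1.2 * totalEnergy ψ x.2) (young S ν) ∧
      -∫ x : Torus d, φ 0 * totalEnergy ψ (Ub (x, 0))
        ≤ ∫ x, deriv φ x.1.2 * totalEnergy ψ x.2 ∂(young S ν) := by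
  have hE := hsol.integrable_comp_snd hS (admissible_totalEnergy hreg ha1)
  have hφc : Continuous (deriv φ) := hφ.continuous_deriv (by simp)
  obtain ⟨C, hC0, hC⟩ := exists_abs_le_of_mem_Q (d := d) hφc S
  have i1 := integrable_young_mul (a := fun z => deriv φ z.2) hE
    (hφc.measurable.comp measurable_snd) hC
  refine ⟨i1, ?_⟩
  have htest : IsTest T (fun z : Torus d × ℝ => φ z.2) :=
    ⟨hφ.comp contDiff_snd, S, hS, fun x t ht => hφS t ht⟩
  have hdt : ∀ z : Torus d × ℝ, dt (fun z : Torus d × ℝ => φ z.2) z = deriv φ z.2 := fun _ => rfl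
  have hdx : ∀ (α : Fin d) (z : Torus d × ℝ), dx α (fun z : Torus d × ℝ => φ z.2) z = 0 :=
    fun α z => deriv_const (0 : ℝ) (φ z.2)
  have hd0 : ∀ t, S ≤ t → deriv φ t = 0 := fun t ht =>
    IsLocalMin.deriv_eq_zero (.of_forall fun s => by rw [hφS t ht]; exact hφ0 s)
  have h1 := hsol.eq_energy _ htest
  have h2 := integral_init_eq hν₀ (fun z => φ z.2) (totalEnergy ψ)
  simp only [hdt, hdx, zero_mul, Finset.sum_const_zero, integral_zero] at h1
  rw [h2, hμ₀, integral_zero_measure, add_zero] at h1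
  have h3 : ∫ z in Q d T, deriv φ z.2 ∂μ ≤ 0 :=
    setIntegral_nonpos (measurableSet_Q T) fun z hz => hφ' z.2 hz.2.1
  rw [integral_Q_eq_of_support (T := T) hS.le fun z hz => by rw [hd0 z.2 hz, zero_mul]] at h1
  have e1 := integral_young_mul (a := fun z => deriv φ z.2) i1
  rw [e1]
  linarith

end Weak

end

section

variable {d : ℕ} {ψ : Mat d → ℝ → ℝ}

/-! ### Calculus along a Lipschitz state -/

/-- The deformation gradient and temperature of a state. -/
def elastic (u : State d) : Mat d × ℝ := (u.1, u.2.2)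

theorem isCompact_Gam (M δ : ℝ) : IsCompact (Gam d M δ) := by
  have h : Gam d M δ = Metric.closedBall 0 M ×ˢ (Metric.closedBall 0 M ×ˢ Icc δ M) := by
    ext u
    simp [Gam]
  rw [h]
  exact (isCompact_closedBall 0 M).prod ((isCompact_closedBall 0 M).prod isCompact_Icc)

theorem exists_lipschitzWith_comp {V : Torus d × ℝ → State d} {K : ℝ≥0} (hV : LipschitzWith K V)
    {M δ : ℝ} (hΓ : ∀ z, V z ∈ Gam d M δ) {h : State d → ℝ}
    (hh : ∀ u ∈ Gam d M δ, ContDiffAt ℝ 1 h u) :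
    ∃ L B, LipschitzWith L (fun z => h (V z)) ∧ ∀ z, |h (V z)| ≤ B := by
  obtain ⟨L, hL⟩ := exists_lipschitzOnWith_of_contDiffAt (isCompact_Gam M δ) hh
  obtain ⟨B, hB⟩ := (isCompact_Gam M δ).exists_bound_of_continuousOn hL.continuousOn
  exact ⟨L * K, B, lipschitzOnWith_univ.1 (hL.comp hV.lipschitzOnWith fun z _ => hΓ z),
    fun z => hB _ (hΓ z)⟩

theorem dt_comp {V : Torus d × ℝ → State d} {z : Torus d × ℝ} {a : State d}
    (ha : HasDerivAt (fun s => V (timeLine z s)) a z.2) {h : State d → ℝ}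
    {h' : State d →L[ℝ] ℝ} (hh : HasFDerivAt h h' (V z)) : dt (fun w => h (V w)) z = h' a :=
  (HasFDerivAt.comp_hasDerivAt z.2 (f := fun s => V (timeLine z s)) hh ha).deriv

theorem dx_comp {V : Torus d × ℝ → State d} {z : Torus d × ℝ} {α : Fin d} {b : State d}
    (hb : HasDerivAt (fun s => V (spaceLine α z s)) b 0) {h : State d → ℝ}
    {h' : State d →L[ℝ] ℝ} (hh : HasFDerivAt h h' (V z)) : dx α (fun w => h (V w)) z = h' b := by
  have hz : spaceLine α z 0 = z := by simp [spaceLine]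
  exact (HasFDerivAt.comp_hasDerivAt 0 (f := fun s => V (spaceLine α z s))
    (hz.symm ▸ hh) hb).deriv

/-- `elastic` as a linear map. -/
def elasticL (d : ℕ) : State d →L[ℝ] Mat d × ℝ :=
  (ContinuousLinearMap.fst ℝ _ _).prod
    ((ContinuousLinearMap.snd ℝ _ _).comp (ContinuousLinearMap.snd ℝ _ _))

theorem elasticL_apply (u : State d) : elasticL d u = elastic u := rfl

/-- The velocity of a state, as a linear map. -/
def velocityL (d : ℕ) : State d →L[ℝ] Vec d :=
  (ContinuousLinearMap.fst ℝ _ _).comp (ContinuousLinearMap.snd ℝ _ _)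

theorem velocityL_apply (u : State d) : velocityL d u = u.2.1 := rfl

theorem Regular.hasFDerivAt_stress_state (h : Regular ψ) {u : State d} (hu : 0 < u.2.2) :
    HasFDerivAt (fun u : State d => stress ψ u.1 u.2.2)
      ((dstress ψ (elastic u)).comp (elasticL d)) u :=
  HasFDerivAt.comp (g := fun w : Mat d × ℝ => stress ψ w.1 w.2) u
    (h.hasFDerivAt_stress (w := elastic u) hu) (elasticL d).hasFDerivAt

theorem Regular.hasFDerivAt_entropy_state (h : Regular ψ) {u : State d} (hu : 0 < u.2.2) :
    HasFDerivAt (fun u : State d => entropy ψ u.1 u.2.2)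
      ((dentropy ψ (elastic u)).comp (elasticL d)) u :=
  HasFDerivAt.comp (g := fun w : Mat d × ℝ => entropy ψ w.1 w.2) u
    (h.hasFDerivAt_entropy (w := elastic u) hu) (elasticL d).hasFDerivAt

theorem Regular.hasFDerivAt_stress_coord (h : Regular ψ) {u : State d} (hu : 0 < u.2.2)
    (i : Fin d × Fin d) : HasFDerivAt (fun u : State d => stress ψ u.1 u.2.2 i)
      ((EuclideanSpace.proj i).comp ((dstress ψ (elastic u)).comp (elasticL d))) u :=
  HasFDerivAt.comp (g := fun X : Mat d => X i) u
    (EuclideanSpace.proj (𝕜 := ℝ) i).hasFDerivAt (h.hasFDerivAt_stress_state hu)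

theorem hasFDerivAt_velocity_coord (i : Fin d) (u : State d) :
    HasFDerivAt (fun u : State d => u.2.1 i) ((EuclideanSpace.proj i).comp (velocityL d)) u :=
  ((EuclideanSpace.proj (𝕜 := ℝ) i).comp (velocityL d)).hasFDerivAt

theorem hasFDerivAt_deformation_coord (i : Fin d × Fin d) (u : State d) :
    HasFDerivAt (fun u : State d => u.1 i)
      ((EuclideanSpace.proj i).comp (ContinuousLinearMap.fst ℝ _ _)) u :=
  ((EuclideanSpace.proj (𝕜 := ℝ) i).comp
    (ContinuousLinearMap.fst ℝ (Mat d) (Vec d × ℝ))).hasFDerivAt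

theorem hasFDerivAt_temperature (u : State d) :
    HasFDerivAt (fun u : State d => u.2.2)
      ((ContinuousLinearMap.snd ℝ _ _).comp (ContinuousLinearMap.snd ℝ _ _)) u :=
  ((ContinuousLinearMap.snd ℝ (Vec d) ℝ).comp
    (ContinuousLinearMap.snd ℝ (Mat d) (Vec d × ℝ))).hasFDerivAt

/-- The part of the relative energy that depends on the strong solution only. -/
def background (ψ : Mat d → ℝ → ℝ) (u : State d) : ℝ :=
  inner ℝ (stress ψ u.1 u.2.2) u.1 + 1 / 2 * ‖u.2.1‖ ^ 2 - ψ u.1 u.2.2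

theorem Regular.contDiffAt_elastic {E : Type*} [NormedAddCommGroup E] [NormedSpace ℝ E]
    {g : Mat d × ℝ → E} {n : ℕ∞ω} {u : State d} (hg : ContDiffAt ℝ n g (elastic u)) :
    ContDiffAt ℝ n (fun u : State d => g (u.1, u.2.2)) u :=
  ContDiffAt.comp (g := g) u hg (elasticL d).contDiff.contDiffAt

theorem Regular.contDiffAt_background (h : Regular ψ) {u : State d} (hu : 0 < u.2.2) :
    ContDiffAt ℝ 1 (background ψ) u := by
  have h1 : ContDiffAt ℝ 1 (fun u : State d => stress ψ u.1 u.2.2) u :=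
    Regular.contDiffAt_elastic ((h.contDiffAt_stress (w := elastic u) hu).of_le (by norm_num))
  have h2 : ContDiffAt ℝ 1 (fun u : State d => ψ u.1 u.2.2) u :=
    Regular.contDiffAt_elastic (g := fun w : Mat d × ℝ => ψ w.1 w.2)
      ((ContDiffOn.contDiffAt h (halfSpace_mem_nhds (w := elastic u) hu)).of_le (by norm_num))
  have h3 : ContDiffAt ℝ 1 (fun u : State d => u.2.1) u := (velocityL d).contDiff.contDiffAt
  exact ((h1.inner ℝ contDiffAt_fst).add (contDiffAt_const.mul (h3.norm_sq ℝ))).sub h2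

/-- The term Σ · dF arises both from Σ · F and from ψ, and cancels. -/
theorem Regular.exists_hasFDerivAt_background (h : Regular ψ) {u : State d} (hu : 0 < u.2.2) :
    ∃ B' : State d →L[ℝ] ℝ, HasFDerivAt (background ψ) B' u ∧
      ∀ a : State d, B' a = inner ℝ (dstress ψ (elastic u) (elastic a)) u.1
        + inner ℝ u.2.1 a.2.1 + entropy ψ u.1 u.2.2 * a.2.2 := by
  have h1 := (h.hasFDerivAt_stress_state hu).inner ℝ
    (ContinuousLinearMap.fst ℝ (Mat d) (Vec d × ℝ)).hasFDerivAt
  have h2 : HasFDerivAt (fun u : State d => ψ u.1 u.2.2)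
      ((dfree ψ (elastic u)).comp (elasticL d)) u :=
    HasFDerivAt.comp (g := fun w : Mat d × ℝ => ψ w.1 w.2) u
      (h.hasFDerivAt (w := elastic u) hu) (elasticL d).hasFDerivAt
  have h3 := ((velocityL d).hasFDerivAt (x := u)).norm_sq.const_mul (1 / 2)
  refine ⟨_, (h1.add h3).sub h2, fun a => ?_⟩
  have h4 := h.dfree_apply (w := elastic u) hu.le (elastic a)
  simp only [elastic] at h4
  simp only [sub_apply, add_apply, ContinuousLinearMap.comp_apply, elasticL_apply,
    fderivInnerCLM_apply, ContinuousLinearMap.prod_apply, smul_apply, velocityL_apply,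
    innerSL_apply_apply, ContinuousLinearMap.coe_fst', smul_eq_mul, elastic]
  rw [h4]
  simp only [nsmul_eq_mul, Nat.cast_ofNat]
  ring

/-! ### The relative energy identity -/

/-- The relative energy of states. -/
def relTotal (ψ : Mat d → ℝ → ℝ) (ub u : State d) : ℝ :=
  relEnergy ψ (elastic ub) (elastic u) + 1 / 2 * ‖u.2.1 - ub.2.1‖ ^ 2

theorem inner_eq_sum_coord (v w : Vec d) : inner ℝ v w = ∑ i, v i * w i := by
  simp [PiLp.inner_apply, mul_comm]

theorem inner_eq_sum_sum_coord (X Y : Mat d) :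
    inner ℝ X Y = ∑ i, ∑ α, X (i, α) * Y (i, α) := by
  simp [PiLp.inner_apply, mul_comm, Fintype.sum_prod_type]

/-- Here `a` stands for ∂_t Ū, `sx` for ∂_α Σ̄_{iα}, and `c`, `c'` for φ, φ'. The terms with `c'`
assemble into the relative energy. Those with `c` reduce to ∂_t F̄ · (Σ - Σ̄) - ∂_t θ̄ (η - η̄) -
∂_t Σ̄ · (F - F̄). -/
theorem relative_energy_identity (h : Regular ψ) {ub u a : State d} {sx : Mat d}
    (hub : 0 < ub.2.2) (hv : ∀ i, a.2.1 i = ∑ α, sx (i, α))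
    (hη : dentropy ψ (elastic ub) (elastic a) = 0) (c c' : ℝ) :
    c' * totalEnergy ψ u - (c * a.2.2 + c' * ub.2.2) * entropy ψ u.1 u.2.2
      - (∑ i, ((c * a.2.1 i + c' * ub.2.1 i) * u.2.1 i
          - ∑ α, c * a.1 (i, α) * stress ψ u.1 u.2.2 (i, α)))
      - (∑ i, ∑ α, ((c * dstress ψ (elastic ub) (elastic a) (i, α)
            + c' * stress ψ ub.1 ub.2.2 (i, α)) * u.1 (i, α) - c * sx (i, α) * u.2.1 i))
      + (c * (inner ℝ (dstress ψ (elastic ub) (elastic a)) ub.1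
          + inner ℝ ub.2.1 a.2.1 + entropy ψ ub.1 ub.2.2 * a.2.2) + c' * background ψ ub)
      - (∑ i, ∑ α, c * (a.1 (i, α) * stress ψ ub.1 ub.2.2 (i, α) + ub.2.1 i * sx (i, α)))
    = c' * relTotal ψ ub u
      + c * (inner ℝ a.1 (stress ψ u.1 u.2.2 - stress ψ ub.1 ub.2.2
            - dstress ψ (elastic ub) (elastic u - elastic ub))
          - a.2.2 * (entropy ψ u.1 u.2.2 - entropy ψ ub.1 ub.2.2
            - dentropy ψ (elastic ub) (elastic u - elastic ub))) := by
  have e1 : (∑ i, ((c * a.2.1 i + c' * ub.2.1 i) * u.2.1 i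
      - ∑ α, c * a.1 (i, α) * stress ψ u.1 u.2.2 (i, α)))
      = c * inner ℝ a.2.1 u.2.1 + c' * inner ℝ ub.2.1 u.2.1
        - c * inner ℝ a.1 (stress ψ u.1 u.2.2) := by
    simp only [inner_eq_sum_coord, inner_eq_sum_sum_coord, Finset.mul_sum,
      ← Finset.sum_add_distrib, ← Finset.sum_sub_distrib]
    refine Finset.sum_congr rfl fun i _ => ?_
    congr 1
    · ring
    · exact Finset.sum_congr rfl fun α _ => by ring
  have e2 : (∑ i, ∑ α, ((c * dstress ψ (elastic ub) (elastic a) (i, α)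
      + c' * stress ψ ub.1 ub.2.2 (i, α)) * u.1 (i, α) - c * sx (i, α) * u.2.1 i))
      = c * inner ℝ (dstress ψ (elastic ub) (elastic a)) u.1
        + c' * inner ℝ (stress ψ ub.1 ub.2.2) u.1 - c * inner ℝ a.2.1 u.2.1 := by
    simp only [inner_eq_sum_coord, inner_eq_sum_sum_coord, hv, Finset.mul_sum, Finset.sum_mul,
      ← Finset.sum_add_distrib, ← Finset.sum_sub_distrib]
    exact Finset.sum_congr rfl fun i _ => Finset.sum_congr rfl fun α _ => by ring
  have e3 : (∑ i, ∑ α, c * (a.1 (i, α) * stress ψ ub.1 ub.2.2 (i, α) + ub.2.1 i * sx (i, α)))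
      = c * inner ℝ a.1 (stress ψ ub.1 ub.2.2) + c * inner ℝ ub.2.1 a.2.1 := by
    simp only [inner_eq_sum_coord, inner_eq_sum_sum_coord, hv, Finset.mul_sum,
      ← Finset.sum_add_distrib]
    exact Finset.sum_congr rfl fun i _ => Finset.sum_congr rfl fun α _ => by ring
  -- Since ∂_t η̄ = 0, symmetry rewrites ∂_t Σ̄ · (F - F̄) as the linearizations of Σ and η in u -
  -- Ū, paired with ∂_t F̄ and -∂_t θ̄. These complete the differences to Taylor remainders.
  have hs := h.hessian_symm (w := elastic ub) hub (elastic a) (elastic u - elastic ub)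
  rw [hη, zero_mul, sub_zero] at hs
  have hs1 : (elastic u - elastic ub).1 = u.1 - ub.1 := rfl
  have hs2 : (elastic a).1 = a.1 := rfl
  have hs3 : (elastic a).2 = a.2.2 := rfl
  rw [hs1, hs2, hs3, inner_sub_right, real_inner_comm a.1] at hs
  have hn := norm_sub_sq_real u.2.1 ub.2.1
  rw [real_inner_comm] at hn
  rw [e1, e2, e3]
  simp only [relTotal, relEnergy, totalEnergy, background, elastic, internalEnergy,
    inner_sub_right] at hs ⊢
  rw [hn]
  linear_combination -c * hs

theorem relTotal_nonneg (h : Regular ψ) (hG : Gibbs ψ) {ub u : State d} (hub : 0 < ub.2.2)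
    (hu : u ∈ physical d) : 0 ≤ relTotal ψ ub u :=
  add_nonneg (relEnergy_nonneg h hG (wb := elastic ub) hub hu) (by positivity)

theorem eq_of_relTotal_nonpos (h : Regular ψ) (hG : Gibbs ψ) {ub u : State d} (hub : 0 < ub.2.2)
    (hu : u ∈ physical d) (hle : relTotal ψ ub u ≤ 0) : u = ub := by
  have h1 := relEnergy_nonneg h hG (wb := elastic ub) (w := elastic u) hub hu
  have h2 := sq_nonneg ‖u.2.1 - ub.2.1‖
  rw [relTotal] at hle
  have h3 : ‖u.2.1 - ub.2.1‖ = 0 := by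
    have : ‖u.2.1 - ub.2.1‖ ^ 2 = 0 := by linarith
    exact pow_eq_zero_iff (two_ne_zero) |>.1 this
  have h4 : elastic u = elastic ub := by
    by_contra hne
    have := relEnergy_pos h hG (wb := elastic ub) (w := elastic u) hub hu hne
    linarith
  have h5 := congrArg Prod.fst h4
  have h6 := congrArg Prod.snd h4
  exact Prod.ext h5 (Prod.ext (sub_eq_zero.1 (norm_eq_zero.1 h3)) h6)

/-- The remainders cost at most K C c times the relative energy; the decay of the cut-off pays for
this and leaves one further multiple of c. -/
theorem relative_energy_bound (h : Regular ψ) (hG : Gibbs ψ) {M δ C : ℝ} (hδ : 0 < δ)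
    (hC0 : 0 ≤ C) (hC : ∀ wb ∈ box d M δ, ∀ w : Mat d × ℝ, 0 ≤ w.2 →
      relRemainder ψ wb w ≤ C * relEnergy ψ wb w) {ub u a : State d} (hub : ub ∈ Gam d M δ)
    (hu : u ∈ physical d) {K c c' : ℝ} (ha : ‖a‖ ≤ K) (hc : 0 ≤ c)
    (hc' : c' ≤ -((K * C + 1) * c)) :
    c' * relTotal ψ ub u
      + c * (inner ℝ a.1 (stress ψ u.1 u.2.2 - stress ψ ub.1 ub.2.2
            - dstress ψ (elastic ub) (elastic u - elastic ub))
          - a.2.2 * (entropy ψ u.1 u.2.2 - entropy ψ ub.1 ub.2.2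
            - dentropy ψ (elastic ub) (elastic u - elastic ub)))
    ≤ -(c * relTotal ψ ub u) := by
  have hub0 : 0 < ub.2.2 := hδ.trans_le hub.2.2.1
  have hK : 0 ≤ K := (norm_nonneg a).trans ha
  have hH := relTotal_nonneg h hG hub0 hu
  have hR := hC (elastic ub) (mem_box.2 ⟨hub.1, hub.2.2.1, hub.2.2.2⟩) (elastic u) hu
  have hle : relEnergy ψ (elastic ub) (elastic u) ≤ relTotal ψ ub u := by
    rw [relTotal]
    have := sq_nonneg ‖u.2.1 - ub.2.1‖
    linarith
  set X := stress ψ u.1 u.2.2 - stress ψ ub.1 ub.2.2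
            - dstress ψ (elastic ub) (elastic u - elastic ub)
  set x := entropy ψ u.1 u.2.2 - entropy ψ ub.1 ub.2.2
            - dentropy ψ (elastic ub) (elastic u - elastic ub)
  have hR' : ‖X‖ + |x| ≤ C * relTotal ψ ub u :=
    hR.trans (mul_le_mul_of_nonneg_left hle hC0)
  have h1 : inner ℝ a.1 X ≤ K * ‖X‖ := (real_inner_le_norm _ _).trans
    (mul_le_mul_of_nonneg_right ((norm_fst_le a).trans ha) (norm_nonneg _))
  have h2 : -(a.2.2 * x) ≤ K * |x| := by
    refine (neg_le_abs _).trans ?_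
    rw [abs_mul]
    exact mul_le_mul_of_nonneg_right
      (((norm_snd_le a.2).trans (norm_snd_le a)).trans ha) (abs_nonneg _)
  have h3 : inner ℝ a.1 X - a.2.2 * x ≤ K * (C * relTotal ψ ub u) := by
    have := mul_le_mul_of_nonneg_left hR' hK
    linarith
  have h4 := mul_le_mul_of_nonneg_left h3 hc
  have h5 := mul_le_mul_of_nonneg_right hc' hH
  linarith

end

section

variable {d : ℕ} {ψ : Mat d → ℝ → ℝ}

/-! ### Uniqueness on a slab -/

theorem ae_young_of_ae {S : ℝ} {ν : Kernel (Torus d × ℝ) (State d)} [IsMarkovKernel ν]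
    {P : Torus d × ℝ → Prop} (h : ∀ᵐ z ∂(volume.restrict (Q d S)), P z) :
    ∀ᵐ x ∂(young S ν), P x.1 := by
  have hq : Measure.QuasiMeasurePreserving Prod.fst (young S ν) (volume.restrict (Q d S)) := by
    refine ⟨measurable_fst, ?_⟩
    have h1 : Measure.map Prod.fst (young S ν) = volume.restrict (Q d S) :=
      Measure.fst_compProd (volume.restrict (Q d S)) ν
    rw [h1]
  exact hq.ae h

theorem integrable_init {f : Torus d × ℝ → ℝ} {K : ℝ≥0} (hf : LipschitzWith K f) {B : ℝ}
    (hB : ∀ z, |f z| ≤ B) : Integrable fun x : Torus d => f (x, 0) :=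
  Integrable.of_bound (hf.continuous.comp (by fun_prop)).aestronglyMeasurable B
    (.of_forall fun x => hB _)

theorem integrable_init_mul {f g : Torus d × ℝ → ℝ} {K L : ℝ≥0} (hf : LipschitzWith K f) {B : ℝ}
    (hB : ∀ z, |f z| ≤ B) (hg : LipschitzWith L g) {D : ℝ} (hD : ∀ z, |g z| ≤ D) (c : ℝ) :
    Integrable fun x : Torus d => c * f (x, 0) * g (x, 0) :=
  Integrable.bdd_mul (integrable_init hg hD) (c := |c| * B)
    (continuous_const.mul (hf.continuous.comp (by fun_prop))).aestronglyMeasurable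
    (.of_forall fun x => by
      rw [norm_mul]
      exact mul_le_mul_of_nonneg_left (hB _) (abs_nonneg _))

theorem integral_young_timeCoeff {S : ℝ} (hS : 0 ≤ S) {ν : Kernel (Torus d × ℝ) (State d)}
    [IsMarkovKernel ν] {f : Torus d × ℝ → ℝ} {K : ℝ≥0} (hf : LipschitzWith K f) {B : ℝ}
    (hB : ∀ z, |f z| ≤ B) {φ : ℝ → ℝ} (hφ : ContDiff ℝ ∞ φ) (hφS : ∀ t, S ≤ t → φ t = 0) :
    Integrable (fun x => timeCoeff φ f x.1) (young S ν) ∧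
      ∫ x, timeCoeff φ f x.1 ∂(young S ν) = -∫ x : Torus d, φ 0 * f (x, 0) := by
  have : IsFiniteMeasure (young S ν) := by unfold young; infer_instance
  have h1 := integrable_timeCoeff (ν := ν) (S := S) (h := fun _ => 1) (integrable_const 1) hf hB hφ
  have h2 := integral_young_mul (h := fun _ => 1) h1
  simp only [mul_one, integral_const, probReal_univ, smul_eq_mul] at h1 h2
  exact ⟨h1, h2.trans (integral_dt_eq hS hf hB hφ hφS)⟩

theorem integral_young_spaceCoeff {S : ℝ} {ν : Kernel (Torus d × ℝ) (State d)}
    [IsMarkovKernel ν] {f : Torus d × ℝ → ℝ} {K : ℝ≥0} (hf : LipschitzWith K f) {B : ℝ}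
    (hB : ∀ z, |f z| ≤ B) {φ : ℝ → ℝ} (hφ : Continuous φ) (α : Fin d) :
    Integrable (fun x => φ x.1.2 * dx α f x.1) (young S ν) ∧
      ∫ x, φ x.1.2 * dx α f x.1 ∂(young S ν) = 0 := by
  have : IsFiniteMeasure (young S ν) := by unfold young; infer_instance
  have h1 := integrable_spaceCoeff (ν := ν) (S := S) (h := fun _ => 1) (integrable_const 1) hf hφ α
  have h2 := integral_young_mul (h := fun _ => 1) (a := fun z => φ z.2 * dx α f z) h1
  simp only [mul_one, integral_const, probReal_univ, smul_eq_mul] at h1 h2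
  exact ⟨h1, h2.trans (integral_dx_eq_zero hf hB hφ α)⟩

/-- The integrand of the relative energy balance. -/
def balance (ψ : Mat d → ℝ → ℝ) (φ : ℝ → ℝ) (V : Torus d × ℝ → State d)
    (x : (Torus d × ℝ) × State d) : ℝ :=
  deriv φ x.1.2 * totalEnergy ψ x.2
    - timeCoeff φ (fun z => (V z).2.2) x.1 * entropy ψ x.2.1 x.2.2.2
    - (∑ i, (timeCoeff φ (fun z => (V z).2.1 i) x.1 * x.2.2.1 i
        - ∑ α, φ x.1.2 * dx α (fun z => (V z).2.1 i) x.1 * stress ψ x.2.1 x.2.2.2 (i, α)))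
    - (∑ i, ∑ α, (timeCoeff φ (fun z => stress ψ (V z).1 (V z).2.2 (i, α)) x.1 * x.2.1 (i, α)
        - φ x.1.2 * dx α (fun z => stress ψ (V z).1 (V z).2.2 (i, α)) x.1 * x.2.2.1 i))
    + timeCoeff φ (fun z => background ψ (V z)) x.1
    - ∑ i, ∑ α, φ x.1.2 * dx α (fun z => (V z).2.1 i * stress ψ (V z).1 (V z).2.2 (i, α)) x.1

theorem contDiffAt_velocity_coord (i : Fin d) (u : State d) :
    ContDiffAt ℝ 1 (fun u : State d => u.2.1 i) u :=
  ((EuclideanSpace.proj (𝕜 := ℝ) i).comp (velocityL d)).contDiff.contDiffAt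

theorem contDiffAt_deformation_coord (i : Fin d × Fin d) (u : State d) :
    ContDiffAt ℝ 1 (fun u : State d => u.1 i) u :=
  ((EuclideanSpace.proj (𝕜 := ℝ) i).comp
    (ContinuousLinearMap.fst ℝ (Mat d) (Vec d × ℝ))).contDiff.contDiffAt

theorem contDiffAt_temperature (u : State d) : ContDiffAt ℝ 1 (fun u : State d => u.2.2) u :=
  ((ContinuousLinearMap.snd ℝ (Vec d) ℝ).comp
    (ContinuousLinearMap.snd ℝ (Mat d) (Vec d × ℝ))).contDiff.contDiffAt

theorem Regular.contDiffAt_stress_coord (h : Regular ψ) {u : State d} (hu : 0 < u.2.2)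
    (i : Fin d × Fin d) : ContDiffAt ℝ 1 (fun u : State d => stress ψ u.1 u.2.2 i) u :=
  (EuclideanSpace.proj (𝕜 := ℝ) i).contDiff.contDiffAt.comp u
    (Regular.contDiffAt_elastic ((h.contDiffAt_stress (w := elastic u) hu).of_le (by norm_num)))

theorem Regular.contDiffAt_entropy_state (h : Regular ψ) {u : State d} (hu : 0 < u.2.2) :
    ContDiffAt ℝ 1 (fun u : State d => entropy ψ u.1 u.2.2) u :=
  Regular.contDiffAt_elastic ((h.contDiffAt_entropy (w := elastic u) hu).of_le (by norm_num))

theorem Regular.contDiffAt_totalEnergy (h : Regular ψ) {u : State d} (hu : 0 < u.2.2) :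
    ContDiffAt ℝ 1 (totalEnergy ψ) u := by
  have h2 : ContDiffAt ℝ 1 (fun u : State d => ψ u.1 u.2.2) u :=
    Regular.contDiffAt_elastic (g := fun w : Mat d × ℝ => ψ w.1 w.2)
      ((ContDiffOn.contDiffAt h (halfSpace_mem_nhds (w := elastic u) hu)).of_le (by norm_num))
  have h3 : ContDiffAt ℝ 1 (fun u : State d => u.2.1) u := (velocityL d).contDiff.contDiffAt
  exact (contDiffAt_const.mul (h3.norm_sq ℝ)).add
    (h2.add ((contDiffAt_temperature u).mul (h.contDiffAt_entropy_state hu)))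

/-! ### The relative energy balance, its sign, and the exhaustion of `Q_T` by slabs -/

section Slab

variable {p q T : ℝ} {U : Torus d × ℝ → State d}
  {ν : Kernel (Torus d × ℝ) (State d)} [IsMarkovKernel ν] {μ : Measure (Torus d × ℝ)}
  {ν₀ : Kernel (Torus d) (State d)} [IsMarkovKernel ν₀] {μ₀ : Measure (Torus d)}

/-- The weak laws tested with φ, φθ̄, φv̄ and φΣ̄ are added up. Positivity of θ̄ makes φθ̄
admissible in the entropy inequality, which enters with a minus sign and so bounds the sum from
below, as the energy does. -/
theorem IsEntropicMVSolution.integral_balance_nonneg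
    (hsol : IsEntropicMVSolution ψ p q T U ν μ ν₀ μ₀) (hreg : Regular ψ)
    (hp : 1 < p) (hq : 1 < q) (ha1 : EnergyGrowth ψ p q) (ha2 : StressGrowth ψ p q)
    (ha3 : EntropyGrowth ψ p q) {S M δ : ℝ} (hS0 : 0 < S) (hS : S < T) (hδ : 0 < δ)
    {V : Torus d × ℝ → State d} {K : ℝ≥0} (hV : LipschitzWith K V)
    (hΓ : ∀ z, V z ∈ Gam d M δ) (hν₀ : ∀ᵐ x : Torus d, ν₀ x = Measure.dirac (V (x, 0)))
    (hμ₀ : μ₀ = 0) {φ : ℝ → ℝ} (hφ : ContDiff ℝ ∞ φ) (hφS : ∀ t, S ≤ t → φ t = 0)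
    (hφ0 : ∀ t, 0 ≤ φ t) (hφ' : ∀ t, 0 ≤ t → deriv φ t ≤ 0) :
    Integrable (balance ψ φ V) (young S ν) ∧ 0 ≤ ∫ x, balance ψ φ V x ∂(young S ν) := by
  have hpos : ∀ u ∈ Gam d M δ, 0 < u.2.2 := fun u hu => hδ.trans_le hu.2.2.1
  obtain ⟨_, _, Lθ, Bθ⟩ := exists_lipschitzWith_comp hV hΓ (h := fun u => u.2.2)
    fun u _ => contDiffAt_temperature u
  obtain ⟨_, _, Lη, Bη⟩ := exists_lipschitzWith_comp hV hΓ (h := fun u => entropy ψ u.1 u.2.2)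
    fun u hu => hreg.contDiffAt_entropy_state (hpos u hu)
  obtain ⟨_, _, LE, BE⟩ := exists_lipschitzWith_comp hV hΓ (h := totalEnergy ψ)
    fun u hu => hreg.contDiffAt_totalEnergy (hpos u hu)
  obtain ⟨_, _, Lb, Bb⟩ := exists_lipschitzWith_comp hV hΓ (h := background ψ)
    fun u hu => hreg.contDiffAt_background (hpos u hu)
  choose _ _ Lv Bv using fun i => exists_lipschitzWith_comp hV hΓ (h := fun u => u.2.1 i)
    fun u _ => contDiffAt_velocity_coord i u
  choose _ _ LF BF using fun i => exists_lipschitzWith_comp hV hΓ (h := fun u => u.1 i)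
    fun u _ => contDiffAt_deformation_coord i u
  choose _ _ Ls Bs using fun i => exists_lipschitzWith_comp hV hΓ
    (h := fun u => stress ψ u.1 u.2.2 i) fun u hu => hreg.contDiffAt_stress_coord (hpos u hu) i
  choose _ _ Lk Bk using fun i : Fin d × Fin d => exists_lipschitzWith_comp hV hΓ
    (h := fun u => u.2.1 i.1 * stress ψ u.1 u.2.2 i)
    fun u hu => (contDiffAt_velocity_coord i.1 u).mul (hreg.contDiffAt_stress_coord (hpos u hu) i)
  obtain ⟨iE, wE⟩ := hsol.weak_energy hreg ha1 hS hν₀ hμ₀ hφ hφS hφ0 hφ'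
  obtain ⟨iS, wS⟩ := hsol.weak_entropy hreg hp hq ha3 hS hν₀ hφ hφS hφ0 Lθ Bθ
    (fun z => (hpos _ (hΓ z)).le) (integrable_init Lη Bη)
  have hv := fun i => hsol.weak_v hreg hp hq ha2 hS hν₀ hφ hφS hφ0 (Lv i) (Bv i) i
    (integrable_init (Lv i) (Bv i))
  have hF := fun i α => hsol.weak_F hp hS hν₀ hφ hφS hφ0 (Ls (i, α)) (Bs (i, α)) i α
    (integrable_init (LF (i, α)) (BF (i, α)))
  obtain ⟨iB, wB⟩ := integral_young_timeCoeff (ν := ν) hS0.le Lb Bb hφ hφS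
  have hD := fun i : Fin d × Fin d =>
    integral_young_spaceCoeff (S := S) (ν := ν) (Lk i) (Bk i) hφ.continuous i.2
  have sV := integrable_finsetSum Finset.univ fun i _ => (hv i).1
  have sF := integrable_finsetSum Finset.univ fun i _ =>
    integrable_finsetSum Finset.univ fun α _ => (hF i α).1
  have sD := integrable_finsetSum Finset.univ fun i _ =>
    integrable_finsetSum Finset.univ fun α _ => (hD (i, α)).1
  have i1 := iE.sub iS
  have i2 := i1.sub sV
  have i3 := i2.sub sF
  have i4 := i3.add iB
  refine ⟨i4.sub sD, ?_⟩
  have e : ∫ x, balance ψ φ V x ∂(young S ν) = _ := integral_sub i4 sD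
  rw [e]
  have e4 := integral_add i3 iB
  have e3 := integral_sub i2 sF
  have e2 := integral_sub i1 sV
  have e1 := integral_sub iE iS
  have eV := integral_finsetSum Finset.univ fun i _ => (hv i).1
  have eF := integral_finsetSum Finset.univ fun i _ =>
    integrable_finsetSum Finset.univ fun α _ => (hF i α).1
  have eF' := fun i => integral_finsetSum Finset.univ fun α _ => (hF i α).1
  have eD := integral_finsetSum Finset.univ fun i _ =>
    integrable_finsetSum Finset.univ fun α _ => (hD (i, α)).1
  have eD' := fun i => integral_finsetSum Finset.univ fun α _ => (hD (i, α)).1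
  have jE := (integrable_init LE BE).const_mul (φ 0)
  have jB := (integrable_init Lb Bb).const_mul (φ 0)
  have jS := integrable_init_mul Lθ Bθ Lη Bη (φ 0)
  have jV := fun i => integrable_init_mul (Lv i) (Bv i) (Lv i) (Bv i) (φ 0)
  have jF := fun i α => integrable_init_mul (Ls (i, α)) (Bs (i, α)) (LF (i, α)) (BF (i, α)) (φ 0)
  have jV' := integrable_finsetSum Finset.univ fun i _ => jV i
  have jF' := integrable_finsetSum Finset.univ fun i _ =>
    integrable_finsetSum Finset.univ fun α _ => jF i α
  -- All initial contributions cancel: for coinciding data this is e = ψ + θη together with the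
  -- choice of `background`.
  have z0 : ∀ x : Torus d, φ 0 * (V (x, 0)).2.2 * entropy ψ (V (x, 0)).1 (V (x, 0)).2.2
      + (∑ i, φ 0 * (V (x, 0)).2.1 i * (V (x, 0)).2.1 i)
      + (∑ i, ∑ α, φ 0 * stress ψ (V (x, 0)).1 (V (x, 0)).2.2 (i, α) * (V (x, 0)).1 (i, α))
      - φ 0 * totalEnergy ψ (V (x, 0)) - φ 0 * background ψ (V (x, 0)) = 0 := by
    intro x
    have s1 : (∑ i, φ 0 * (V (x, 0)).2.1 i * (V (x, 0)).2.1 i)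
        = φ 0 * inner ℝ (V (x, 0)).2.1 (V (x, 0)).2.1 := by
      rw [inner_eq_sum_coord, Finset.mul_sum]
      exact Finset.sum_congr rfl fun i _ => mul_assoc _ _ _
    have s2 : (∑ i, ∑ α, φ 0 * stress ψ (V (x, 0)).1 (V (x, 0)).2.2 (i, α) * (V (x, 0)).1 (i, α))
        = φ 0 * inner ℝ (stress ψ (V (x, 0)).1 (V (x, 0)).2.2) (V (x, 0)).1 := by
      rw [inner_eq_sum_sum_coord, Finset.mul_sum]
      refine Finset.sum_congr rfl fun i _ => ?_
      rw [Finset.mul_sum]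
      exact Finset.sum_congr rfl fun α _ => mul_assoc _ _ _
    rw [s1, s2, real_inner_self_eq_norm_sq, totalEnergy, background, internalEnergy]
    ring
  have k1 := integral_add jS jV'
  have k2 := integral_add (jS.add jV') jF'
  have k3 := integral_sub ((jS.add jV').add jF') jE
  have k4 := integral_sub (((jS.add jV').add jF').sub jE) jB
  have kV := integral_finsetSum Finset.univ fun i _ => jV i
  have kF := integral_finsetSum Finset.univ fun i _ =>
    integrable_finsetSum Finset.univ fun α _ => jF i α
  have kF' := fun i => integral_finsetSum Finset.univ fun α _ => jF i α
  have k0 := integral_congr_ae (μ := (volume : Measure (Torus d))) (.of_forall z0)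
  simp only [Pi.add_apply, Pi.sub_apply, integral_zero] at *
  have hD2 : ∀ i α, _ = (0 : ℝ) := fun i α => (hD (i, α)).2
  simp only [eF', eD', (hv _).2, (hF _ _).2, hD2, kF', Finset.sum_neg_distrib,
    Finset.sum_const_zero] at eV eF eD kF
  linarith

/-- At a point of differentiability the chain rule turns every coefficient of `balance` into data of
∂_t Ū. The deformation equation replaces ∇v̄ by ∂_t F̄, and the momentum equation gives ∂_t v̄ as
div Σ̄. -/
theorem balance_le (hreg : Regular ψ) (hG : Gibbs ψ) {M δ C : ℝ} (hδ : 0 < δ)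
    (hC0 : 0 ≤ C) (hC : ∀ wb ∈ box d M δ, ∀ w : Mat d × ℝ, 0 ≤ w.2 →
      relRemainder ψ wb w ≤ C * relEnergy ψ wb w)
    {V : Torus d × ℝ → State d} {K : ℝ≥0} (hV : LipschitzWith K V) {z : Torus d × ℝ}
    (hΓ : V z ∈ Gam d M δ) (hdt : DifferentiableAt ℝ (fun s => V (timeLine z s)) z.2)
    (hdx : ∀ α, DifferentiableAt ℝ (fun s => V (spaceLine α z s)) 0)
    (eqF : ∀ i α, dt (fun w => (V w).1 (i, α)) z = dx α (fun w => (V w).2.1 i) z)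
    (eqv : ∀ i, dt (fun w => (V w).2.1 i) z
      = ∑ α, dx α (fun w => stress ψ (V w).1 (V w).2.2 (i, α)) z)
    (eqη : dt (fun w => entropy ψ (V w).1 (V w).2.2) z = 0)
    {φ : ℝ → ℝ} (hφ0 : 0 ≤ φ z.2) (hφ' : deriv φ z.2 ≤ -((K * C + 1) * φ z.2))
    {u : State d} (hu : u ∈ physical d) :
    balance ψ φ V (z, u) ≤ -(φ z.2 * relTotal ψ (V z) u) := by
  have hpos : 0 < (V z).2.2 := hδ.trans_le hΓ.2.2.1
  set a : State d := deriv (fun s => V (timeLine z s)) z.2 with ha_def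
  have ha : HasDerivAt (fun s => V (timeLine z s)) a z.2 := hdt.hasDerivAt
  have hb := fun α => (hdx α).hasDerivAt
  have haK : ‖a‖ ≤ K := by
    have h1 := hV.comp (lipschitzWith_timeLine z)
    rw [mul_one] at h1
    exact norm_deriv_le_of_lipschitz h1
  set sx : Mat d := WithLp.toLp 2 fun i =>
    dx i.2 (fun w => stress ψ (V w).1 (V w).2.2 i) z with hsx
  have hsx' : ∀ i α, dx α (fun w => stress ψ (V w).1 (V w).2.2 (i, α)) z = sx (i, α) :=
    fun i α => rfl
  have t1 : dt (fun w => (V w).2.2) z = a.2.2 := dt_comp ha (hasFDerivAt_temperature _)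
  have t2 : ∀ i, dt (fun w => (V w).2.1 i) z = a.2.1 i := fun i =>
    dt_comp ha (hasFDerivAt_velocity_coord i _)
  have t3 : ∀ i, dt (fun w => stress ψ (V w).1 (V w).2.2 i) z
      = dstress ψ (elastic (V z)) (elastic a) i := fun i =>
    dt_comp ha (hreg.hasFDerivAt_stress_coord hpos i)
  have t4 : dentropy ψ (elastic (V z)) (elastic a) = 0 :=
    (dt_comp ha (hreg.hasFDerivAt_entropy_state hpos)).symm.trans eqη
  obtain ⟨B', hB', hB'a⟩ := hreg.exists_hasFDerivAt_background hpos
  have t5 : dt (fun w => background ψ (V w)) z = _ := (dt_comp ha hB').trans (hB'a a)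
  have t6 : ∀ i α, dx α (fun w => (V w).2.1 i) z = a.1 (i, α) := fun i α =>
    (eqF i α).symm.trans (dt_comp ha (hasFDerivAt_deformation_coord (i, α) _))
  have t7 : ∀ i α, dx α (fun w => (V w).2.1 i * stress ψ (V w).1 (V w).2.2 (i, α)) z
      = a.1 (i, α) * stress ψ (V z).1 (V z).2.2 (i, α) + (V z).2.1 i * sx (i, α) := by
    intro i α
    have h1 := hasFDerivAt_velocity_coord i (V z)
    have h2 := hreg.hasFDerivAt_stress_coord hpos (i, α)
    rw [← t6, ← hsx', dx_comp (hb α) h1, dx_comp (hb α) h2]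
    refine (dx_comp (hb α) (h1.mul h2)).trans ?_
    simp only [add_apply, smul_apply, smul_eq_mul]
    ring
  have hv : ∀ i, a.2.1 i = ∑ α, sx (i, α) := fun i => (t2 i).symm.trans (eqv i)
  have key := relative_energy_identity hreg (u := u) hpos hv t4 (φ z.2) (deriv φ z.2)
  refine le_trans (le_of_eq ?_)
    (relative_energy_bound hreg hG hδ hC0 hC hΓ hu haK hφ0 hφ')
  rw [← key]
  simp only [balance, timeCoeff, t1, t2, t3, t5, t6, t7, hsx']

theorem IsEntropicMVSolution.ae_eq_of_slab
    (hsol : IsEntropicMVSolution ψ p q T U ν μ ν₀ μ₀) (hreg : Regular ψ) (hG : Gibbs ψ)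
    (hp : 1 < p) (hq : 1 < q) (ha1 : EnergyGrowth ψ p q) (ha2 : StressGrowth ψ p q)
    (ha3 : EntropyGrowth ψ p q) {S M δ : ℝ} (hS0 : 0 < S) (hS : S < T) (hδ : 0 < δ)
    {V : Torus d × ℝ → State d} {K : ℝ≥0} (hV : LipschitzWith K V)
    (hΓ : ∀ z, V z ∈ Gam d M δ) (hν₀ : ∀ᵐ x : Torus d, ν₀ x = Measure.dirac (V (x, 0)))
    (hμ₀ : μ₀ = 0)
    (eqF : ∀ᵐ z ∂(volume.restrict (Q d S)), ∀ i α,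
      dt (fun w => (V w).1 (i, α)) z = dx α (fun w => (V w).2.1 i) z)
    (eqv : ∀ᵐ z ∂(volume.restrict (Q d S)), ∀ i, dt (fun w => (V w).2.1 i) z
      = ∑ α, dx α (fun w => stress ψ (V w).1 (V w).2.2 (i, α)) z)
    (eqη : ∀ᵐ z ∂(volume.restrict (Q d S)), dt (fun w => entropy ψ (V w).1 (V w).2.2) z = 0) :
    ∀ᵐ x ∂(young S ν), x.2 = V x.1 := by
  obtain ⟨C, hC0, hC⟩ := exists_remainder_le hreg hG hp hq ha1 ha2 ha3 (M := M) hδ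
  -- The rate `K * C` absorbs the remainders; the extra `1` leaves a strictly useful term.
  obtain ⟨φ, hφ, hφS, hφ0, hφpos, hφ'⟩ := exists_cutoff (C := K * C + 1) hS0 (by positivity)
  obtain ⟨hint, hnn⟩ := hsol.integral_balance_nonneg hreg hp hq ha1 ha2 ha3 hS0 hS hδ hV hΓ hν₀
    hμ₀ hφ hφS hφ0 fun t ht => (hφ' t ht).trans
      (neg_nonpos.2 (mul_nonneg (by positivity) (hφ0 t)))
  have hphys := hsol.ae_physical hS
  have hle : ∀ᵐ x ∂(young S ν), balance ψ φ V x ≤ -(φ x.1.2 * relTotal ψ (V x.1) x.2) := by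
    have hgood : ∀ᵐ z ∂(volume.restrict (Q d S)), ∀ u ∈ physical d,
        balance ψ φ V (z, u) ≤ -(φ z.2 * relTotal ψ (V z) u) := by
      filter_upwards [ae_mem_Q S, ae_restrict_of_ae (ae_differentiableAt_lines hV), eqF, eqv, eqη]
        with z hz hd h1 h2 h3 u hu
      exact balance_le hreg hG hδ hC0 hC hV (hΓ z) hd.1 hd.2 h1 h2 h3 (hφ0 _) (hφ' _ hz.2.1) hu
    filter_upwards [ae_young_of_ae (ν := ν) hgood, hphys] with x h1 h2 using h1 x.2 h2
  have hHnn : ∀ x : (Torus d × ℝ) × State d, x.2 ∈ physical d → 0 ≤ relTotal ψ (V x.1) x.2 :=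
    fun x hx => relTotal_nonneg hreg hG (hδ.trans_le (hΓ x.1).2.2.1) hx
  have hint' : Integrable (fun x => -balance ψ φ V x) (young S ν) := hint.neg
  -- `balance` is nonpositive almost everywhere with nonnegative integral, so it vanishes; as φ > 0
  -- before `S`, so does the relative energy.
  have hzero : (fun x => -balance ψ φ V x) =ᵐ[young S ν] 0 := by
    refine (integral_eq_zero_iff_of_nonneg_ae ?_ hint').1 ?_
    · filter_upwards [hle, hphys] with x h1 h2
      have := mul_nonneg (hφ0 x.1.2) (hHnn x h2)
      simp only [Pi.zero_apply]
      linarith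
    · refine le_antisymm ?_ (integral_nonneg_of_ae ?_)
      · rw [integral_neg]
        linarith
      · filter_upwards [hle, hphys] with x h1 h2
        have := mul_nonneg (hφ0 x.1.2) (hHnn x h2)
        simp only [Pi.zero_apply]
        linarith
  filter_upwards [hle, hphys, hzero, ae_young_of_ae (ν := ν) (ae_mem_Q S)] with x h1 h2 h3 h4
  have h5 := hφpos x.1.2 h4.2.2
  simp only [Pi.zero_apply] at h3
  refine eq_of_relTotal_nonpos hreg hG (hδ.trans_le (hΓ x.1).2.2.1) h2 ?_
  by_contra hcon
  have := mul_pos h5 (not_le.1 hcon)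
  linarith

/-- The state frozen before time `0` and after time `S`. -/
def freeze {S : ℝ} (hS : 0 ≤ S) (Ub : Torus d × ℝ → State d) (z : Torus d × ℝ) : State d :=
  Ub (z.1, projIcc 0 S hS z.2)

theorem freeze_eq {S : ℝ} (hS : 0 ≤ S) (Ub : Torus d × ℝ → State d) {z : Torus d × ℝ}
    (hz : z.2 ∈ Icc 0 S) : freeze hS Ub z = Ub z := by
  rw [freeze, projIcc_of_mem hS hz]

theorem dt_freeze {S : ℝ} (hS : 0 ≤ S) (Ub : Torus d × ℝ → State d) (h : State d → ℝ)
    {z : Torus d × ℝ} (hz : z.2 ∈ Ioo 0 S) :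
    dt (fun w => h (freeze hS Ub w)) z = dt (fun w => h (Ub w)) z := by
  refine Filter.EventuallyEq.deriv_eq ?_
  filter_upwards [isOpen_Ioo.mem_nhds hz] with s hs
  rw [freeze_eq hS Ub (z := (z.1, s)) (Ioo_subset_Icc_self hs)]

theorem dx_freeze {S : ℝ} (hS : 0 ≤ S) (Ub : Torus d × ℝ → State d) (h : State d → ℝ) (α : Fin d)
    {z : Torus d × ℝ} (hz : z.2 ∈ Icc 0 S) :
    dx α (fun w => h (freeze hS Ub w)) z = dx α (fun w => h (Ub w)) z := by
  exact Filter.EventuallyEq.deriv_eq (.of_forall fun _ => congrArg h (freeze_eq hS Ub hz))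

theorem eq_dirac_of_ae_eq {Ω : Type*} [MeasurableSpace Ω] {m : Measure Ω} [IsProbabilityMeasure m]
    {c : Ω} (h : ∀ᵐ u ∂m, u = c) : m = Measure.dirac c := by
  have h1 : Measure.map id m = Measure.map (fun _ => c) m := Measure.map_congr h
  rwa [Measure.map_id, Measure.map_const, measure_univ, one_smul] at h1

/-- Mollification needs a Lipschitz state on all of space-time with values in `Gam d M δ`
everywhere. Freezing `Ub` outside [0, S] provides one without changing it, or its derivatives at
interior times, inside the slab. -/
theorem IsEntropicMVSolution.ae_eq_dirac_of_lt
    (hsol : IsEntropicMVSolution ψ p q T U ν μ ν₀ μ₀) (hreg : Regular ψ) (hG : Gibbs ψ)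
    (hp : 1 < p) (hq : 1 < q) (ha1 : EnergyGrowth ψ p q) (ha2 : StressGrowth ψ p q)
    (ha3 : EntropyGrowth ψ p q) {Ub : Torus d × ℝ → State d} (hUb : IsStrongSolution ψ T Ub)
    {M δ : ℝ} (hδ : 0 < δ) (hΓ : ∀ z ∈ Q d T, Ub z ∈ Gam d M δ) (hμ₀ : μ₀ = 0)
    (hν₀ : ∀ᵐ x : Torus d, ν₀ x = Measure.dirac (Ub (x, 0))) {S : ℝ} (hS0 : 0 < S) (hS : S < T) :
    ∀ᵐ z ∂(volume.restrict (Q d S)), ν z = Measure.dirac (Ub z) := by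
  obtain ⟨K, hK⟩ := hUb.lipschitz
  have hproj : ∀ t, (projIcc 0 S hS0.le t : ℝ) ∈ Icc 0 S := fun t => (projIcc 0 S hS0.le t).2
  have hV : LipschitzWith (K * max 1 1) (freeze hS0.le Ub) := by
    have h1 : LipschitzWith (max 1 1) fun z : Torus d × ℝ =>
        (z.1, (projIcc 0 S hS0.le z.2 : ℝ)) := by
      refine LipschitzWith.prod_fst.prodMk ?_
      have := (LipschitzWith.subtype_val (Icc (0 : ℝ) S)).comp
        ((LipschitzWith.projIcc hS0.le).comp (LipschitzWith.prod_snd (α := Torus d)))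
      rw [mul_one, mul_one] at this
      exact this
    exact lipschitzOnWith_univ.1 (hK.comp h1.lipschitzOnWith
      fun z _ => ⟨mem_univ _, (hproj z.2).1, (hproj z.2).2.trans hS.le⟩)
  have hVΓ : ∀ z, freeze hS0.le Ub z ∈ Gam d M δ := fun z =>
    hΓ _ ⟨mem_univ _, (hproj z.2).1, (hproj z.2).2.trans_lt hS⟩
  -- Freezing can alter the time derivative at t = 0, which is a null slice.
  have hIoo : ∀ᵐ z ∂(volume.restrict (Q d S)), z.2 ∈ Ioo 0 S := by
    have h0 : ∀ᵐ z : Torus d × ℝ, z.2 ≠ 0 :=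
      Measure.quasiMeasurePreserving_snd.ae (Measure.ae_ne volume (0 : ℝ))
    filter_upwards [ae_mem_Q S, ae_restrict_of_ae h0] with z hz hz0
    exact ⟨lt_of_le_of_ne hz.2.1 hz0.symm, hz.2.2⟩
  have sub : ∀ {P : Torus d × ℝ → Prop}, (∀ᵐ z ∂(volume.restrict (Q d T)), P z) →
      ∀ᵐ z ∂(volume.restrict (Q d S)), P z :=
    fun h => ae_restrict_of_ae_restrict_of_subset (Q_mono hS.le) h
  have key := hsol.ae_eq_of_slab hreg hG hp hq ha1 ha2 ha3 hS0 hS hδ hV hVΓ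
    (by
      filter_upwards [hν₀] with x hx
      rw [hx, freeze_eq hS0.le Ub (z := (x, 0)) ⟨le_rfl, hS0.le⟩]) hμ₀
    (by
      filter_upwards [hIoo, sub hUb.eq_F] with z hz h i α
      rw [dt_freeze hS0.le Ub (fun u => u.1 (i, α)) hz,
        dx_freeze hS0.le Ub (fun u => u.2.1 i) α (Ioo_subset_Icc_self hz)]
      exact h i α)
    (by
      filter_upwards [hIoo, sub hUb.eq_v] with z hz h i
      rw [dt_freeze hS0.le Ub (fun u => u.2.1 i) hz, h i]
      exact Finset.sum_congr rfl fun α _ => (dx_freeze hS0.le Ub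
        (fun u => stress ψ u.1 u.2.2 (i, α)) α (Ioo_subset_Icc_self hz)).symm)
    (by
      filter_upwards [hIoo, sub hUb.eq_entropy] with z hz h
      rw [dt_freeze hS0.le Ub (fun u => entropy ψ u.1 u.2.2) hz, h])
  filter_upwards [Measure.ae_ae_of_ae_compProd key, hIoo] with z h1 h2
  refine eq_dirac_of_ae_eq ?_
  filter_upwards [h1] with u hu
  rw [hu]
  exact freeze_eq hS0.le Ub (Ioo_subset_Icc_self h2)

theorem IsEntropicMVSolution.ae_eq_dirac
    (hsol : IsEntropicMVSolution ψ p q T U ν μ ν₀ μ₀) (hreg : Regular ψ) (hG : Gibbs ψ)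
    (hp : 1 < p) (hq : 1 < q) (ha1 : EnergyGrowth ψ p q) (ha2 : StressGrowth ψ p q)
    (ha3 : EntropyGrowth ψ p q) (hT : 0 < T) {Ub : Torus d × ℝ → State d}
    (hUb : IsStrongSolution ψ T Ub) {M δ : ℝ} (hδ : 0 < δ)
    (hΓ : ∀ z ∈ Q d T, Ub z ∈ Gam d M δ) (hμ₀ : μ₀ = 0)
    (hν₀ : ∀ᵐ x : Torus d, ν₀ x = Measure.dirac (Ub (x, 0))) :
    ∀ᵐ z ∂(volume.restrict (Q d T)), ν z = Measure.dirac (Ub z) := by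
  -- Countably many slabs suffice; each stays below `T`, where the moment bounds and the values in
  -- `Gam d M δ` are available.
  obtain ⟨S, -, hS, hlim⟩ := exists_seq_strictMono_tendsto' hT
  have hcover : Q d T ⊆ ⋃ n, Q d (S n) := fun z hz => by
    obtain ⟨n, hn⟩ := (hlim.eventually_const_lt hz.2.2).exists
    exact mem_iUnion.2 ⟨n, mem_univ _, hz.2.1, hn⟩
  refine ae_restrict_of_ae_restrict_of_subset hcover ((ae_restrict_iUnion_iff _ _).2 fun n => ?_)
  exact hsol.ae_eq_dirac_of_lt hreg hG hp hq ha1 ha2 ha3 hUb hδ hΓ hμ₀ hν₀ (hS n).1 (hS n).2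

end Slab

end

end Thermoelasticity

end

/-! ### Conclusion: Dirac masses and their barycentres -/

theorem mainTheorem4 {d : ℕ} (hd : 0 < d) (p q : ℝ) (hp : 1 < p) (hq : 1 < q)
    (ψ : Thermoelasticity.Mat d → ℝ → ℝ)
    (hreg : Thermoelasticity.Regular ψ)
    (hG : Thermoelasticity.Gibbs ψ)
    (ha1 : Thermoelasticity.EnergyGrowth ψ p q)
    (ha2 : Thermoelasticity.StressGrowth ψ p q)
    (ha3 : Thermoelasticity.EntropyGrowth ψ p q)
    (ha4 : Thermoelasticity.PowerGrowth ψ p q)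
    (ha5 : Thermoelasticity.HasEnergyRecession ψ p q)
    (T : ℝ) (hT : 0 < T)
    (U : Thermoelasticity.Torus d × ℝ → Thermoelasticity.State d)
    (ν : Kernel (Thermoelasticity.Torus d × ℝ) (Thermoelasticity.State d))
    [IsMarkovKernel ν]
    (μ : Measure (Thermoelasticity.Torus d × ℝ))
    (ν₀ : Kernel (Thermoelasticity.Torus d) (Thermoelasticity.State d))
    [IsMarkovKernel ν₀]
    (μ₀ : Measure (Thermoelasticity.Torus d))
    (hsol : Thermoelasticity.IsEntropicMVSolution ψ p q T U ν μ ν₀ μ₀)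
    (Ub : Thermoelasticity.Torus d × ℝ → Thermoelasticity.State d)
    (hUb : Thermoelasticity.IsStrongSolution ψ T Ub)
    (M δ : ℝ) (hM : 0 < M) (hδ : 0 < δ)
    (hΓ : ∀ z ∈ Thermoelasticity.Q d T, Ub z ∈ Thermoelasticity.Gam d M δ)
    (hμ₀ : μ₀ = 0)
    (hν₀ : ∀ᵐ x : Thermoelasticity.Torus d, ν₀ x = Measure.dirac (Ub (x, 0))) :
    (∀ᵐ z ∂(volume.restrict (Thermoelasticity.Q d T)), ν z = Measure.dirac (Ub z)) ∧
    (∀ᵐ z ∂(volume.restrict (Thermoelasticity.Q d T)), U z = Ub z) := by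
  have key := hsol.ae_eq_dirac hreg hG hp hq ha1 ha2 ha3 hT hUb hδ hΓ hμ₀ hν₀
  refine ⟨key, ?_⟩
  filter_upwards [key, hsol.mean] with z h1 h2
  rw [h2, h1]
  simp only [integral_dirac]
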